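/- Let $n\ge 0$ be an integer, $k\in\mathbb C$ and $\alpha=k+n$. Let $e_{i,j}$ $(1\le i,j\le n)$ be the matrix units of $\mathfrak{gl}(n)$, let $$\kappa(e_{i,j},e_{p,q})=\delta_{j,p}\delta_{i,q}\,\alpha+\delta_{i,j}\delta_{p,q},$$ and let $V^\kappa(\mathfrak{gl}(n))$ be the universal affine vertex algebra of $\mathfrak{gl}(n)$ with respect to $\kappa$. Write $e_{i,j}[-m]=e_{i,j}t^{-m}|0\rangle$, and let $e^{(1)}_{i,j}[-m]=e_{i,j}[-m]\otimes 1$, $e^{(2)}_{i,j}[-m]=1\otimes e_{i,j}[-m]$ in the tensor product vertex algebra $V^\kappa(\mathfrak{gl}(n))^{\otimes2}$. For $1\le i,j\le n$ put $$W^{(1)}_{i,j}=e^{(1)}_{i,j}[-1]+e^{(2)}_{i,j}[-1],\qquad W^{(2)}_{i,j}=\sum_{u=1}^{n}e^{(1)}_{u,j}[-1]\,e^{(2)}_{i,u}[-1]-\alpha\, e^{(1)}_{i,j}[-2].$$ The rectangular $W$-algebra $\mathcal W^k(\mathfrak{gl}(2n),(2^n))$ is taken in its realization as the vertex subalgebra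 of $V^\kappa(\mathfrak{gl}(n))^{\otimes 2}$ generated by all $W^{(1)}_{i,j}$, $W^{(2)}_{i,j}$. Write $a_{(s)}b$ for the $s$-th product, $|0\rangle$ for the vacuum and $\partial$ for the translation operator. The elements $W^{(1)}_{i,j}$, $W^{(2)}_{i,j}$ are strong generators: $\mathcal W^k(\mathfrak{gl}(2n),(2^n))$ is spanned by the vectors $a^1_{(-m_1)}\cdots a^r_{(-m_r)}|0\rangle$ with $r\ge0$, $m_l\ge1$ and each $a^l$ one of these elements. For all $1\le p,q,i,j\le n$ their products are as follows. (1) $$(W^{(1)}_{p,q})_{(0)}W^{(1)}_{i,j}=\delta_{q,i}W^{(1)}_{p,j}-\delta_{p,j}W^{(1)}_{i,q},\qquad (W^{(1)}_{p,q})_{(1)}W^{(1)}_{i,j}=(2\delta_{q,i}\delta_{p,j}\alpha+2\delta_{p,q}\delta_{i,j})|0\rangle,$$ and $(W^{(1)}_{p,q})_{(s)}W^{(1)}_{i,j}=0$ for all $s>1$. (2) $$(W^{(1)}_{p,q})_{(0)}W^{(2)}_{i,j}=-\delta_{p,j}W^{(2)}_{i,q}+\delta_{i,q}W^{(2)}_{p,j},\qquad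 (W^{(1)}_{p,q})_{(1)}W^{(2)}_{i,j}=\delta_{p,j}\alpha W^{(1)}_{i,q}+\delta_{p,q}W^{(1)}_{i,j},$$ $$(W^{(1)}_{p,q})_{(2)}W^{(2)}_{i,j}=(-2\delta_{q,i}\delta_{p,j}\alpha^2-2\delta_{p,q}\delta_{i,j}\alpha)|0\rangle,$$ and $(W^{(1)}_{p,q})_{(s)}W^{(2)}_{i,j}=0$ for all $s>2$. (3) $$\begin{aligned}(W^{(2)}_{p,q})_{(0)}W^{(2)}_{i,j}={}&(W^{(2)}_{p,j})_{(-1)}W^{(1)}_{i,q}-(W^{(1)}_{p,j})_{(-1)}W^{(2)}_{i,q}+\alpha(\partial W^{(1)}_{p,j})_{(-1)}W^{(1)}_{i,q}+(\partial W^{(1)}_{p,q})_{(-1)}W^{(1)}_{i,j}\\&-\delta_{q,i}\alpha\,\partial W^{(2)}_{p,j}-\delta_{i,q}\tfrac{2\alpha^2+1}{2}\partial^2W^{(1)}_{p,j}-\delta_{i,j}\partial W^{(2)}_{p,q}-\tfrac32\delta_{i,j}\alpha\,\partial^2W^{(1)}_{p,q},\end{aligned}$$ $$\begin{aligned}(W^{(2)}_{p,q})_{(1)}W^{(2)}_{i,j}={}&\alpha(W^{(1)}_{p,j})_{(-1)}W^{(1)}_{i,q}+(W^{(1)}_{p,q})_{(-1)}W^{(1)}_{i,j}-\delta_{q,i}\alpha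 W^{(2)}_{p,j}-2\delta_{q,i}\alpha^2\partial W^{(1)}_{p,j}\\&-\delta_{p,j}\alpha W^{(2)}_{i,q}-\delta_{i,j}W^{(2)}_{p,q}-2\delta_{i,j}\alpha\,\partial W^{(1)}_{p,q}-\delta_{p,q}W^{(2)}_{i,j},\end{aligned}$$ $$(W^{(2)}_{p,q})_{(2)}W^{(2)}_{i,j}=\delta_{p,j}(2\alpha^2-1)W^{(1)}_{i,q}-\delta_{i,j}\alpha W^{(1)}_{p,q}-\delta_{i,q}(2\alpha^2-1)W^{(1)}_{p,j}+\delta_{p,q}\alpha W^{(1)}_{i,j},$$ $$(W^{(2)}_{p,q})_{(3)}W^{(2)}_{i,j}=\big((1-5\alpha^2)\delta_{p,q}\delta_{i,j}+(2\alpha-6\alpha^3)\delta_{p,j}\delta_{i,q}\big)|0\rangle,$$ and $(W^{(2)}_{p,q})_{(s)}W^{(2)}_{i,j}=0$ for all $s>3$. In particular the coefficients depend only on $\alpha$ and not on $n$. Moreover, there is an injective homomorphism of vertex algebras $$\iota\colon\mathcal W^{k+1}(\mathfrak{gl}(2n),(2^n))\to\mathcal W^{k}(\mathfrak{gl}(2n+2),(2^{n+1})),\qquad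 \iota(W^{(u)}_{i,j})=W^{(u)}_{i,j}\quad(u=1,2,\ 1\le i,j\le n).$$ -/

import Mathlib

noncomputable section

namespace RectW

open scoped TensorProduct VertexOperator

section Fields

variable {V : Type*} [AddCommGroup V] [Module ℂ V]

theorem ncoeff_eventually_zero (A : VertexOperator ℂ V) (v : V) :
    ∃ N : ℕ, ∀ m : ℤ, (N : ℤ) ≤ m → (A[[m]]) v = 0 := by
  refine ⟨(-HahnSeries.order ((HahnModule.of ℂ).symm (A v))).toNat, fun m hm => ?_⟩
  apply VertexOperator.ncoeff_eq_zero_of_lt_order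
  omega

/-- The field `∑ f m z^{-m-1}` with prescribed modes `f m`, given that every vector is killed by
all sufficiently high modes. -/
def mkField (f : ℤ → Module.End ℂ V) (hf : ∀ v, ∃ N : ℕ, ∀ m : ℤ, (N : ℤ) ≤ m → f m v = 0) :
    VertexOperator ℂ V :=
  VertexOperator.of_coeff (fun k => f (-k - 1)) (by
    intro v
    obtain ⟨N, hN⟩ := hf v
    refine ⟨-N, fun k hk => ?_⟩
    by_contra h
    exact hk (hN _ (by omega)))

@[simp]
theorem mkField_ncoeff (f : ℤ → Module.End ℂ V) (hf) (m : ℤ) : (mkField f hf)[[m]] = f m := by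
  rw [mkField, VertexOperator.ncoeff_of_coeff]
  congr 1
  ring

theorem field_ext {A B : VertexOperator ℂ V} (h : ∀ m v, (A[[m]]) v = (B[[m]]) v) : A = B := by
  apply HVertexOperator.coeff_inj
  funext k
  ext v
  rw [VertexOperator.coeff_eq_ncoeff, VertexOperator.coeff_eq_ncoeff, h]

theorem finsum_eq_range {M : Type*} [AddCommMonoid M] {t : ℕ → M} {N : ℕ}
    (h : ∀ j, N ≤ j → t j = 0) : ∑ᶠ j, t j = ∑ j ∈ Finset.range N, t j := by
  apply finsum_eq_sum_of_support_subset
  intro j hj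
  simp only [Finset.coe_range, Set.mem_Iio]
  by_contra hc
  exact hj (h j (by omega))

/-- A bound for all `B_{n} v`, uniform in finitely many `v`. -/
theorem uniform_bound (B : VertexOperator ℂ V) (w : ℕ → V) (N : ℕ) :
    ∃ M : ℕ, ∀ j < N, ∀ m : ℤ, (M : ℤ) ≤ m → (B[[m]]) (w j) = 0 := by
  choose M hM using fun j => ncoeff_eventually_zero B (w j)
  refine ⟨∑ j ∈ Finset.range N, M j, fun j hj m hm => hM j m (le_trans ?_ hm)⟩
  exact_mod_cast Finset.single_le_sum (f := M) (fun _ _ => Nat.zero_le _) (Finset.mem_range.2 hj)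

/-- The coefficient `(-1)^j * binom(n, j)` of the binomial series, for `n` an integer. -/
def bc (n : ℤ) (j : ℕ) : ℂ := (-1) ^ j * (Ring.choose n j : ℤ)

/-- The field with modes `m ↦ ∑_{j ≥ 0} (-1)^j binom(n, j) A_{n-j} B_{m+j}`. -/
def leftProd (A : VertexOperator ℂ V) (n : ℤ) (B : VertexOperator ℂ V) : VertexOperator ℂ V :=
  mkField
    (fun m =>
      { toFun := fun v => ∑ᶠ j : ℕ, bc n j • (A[[n - j]]) ((B[[m + j]]) v)
        map_add' := by
          intro v w
          obtain ⟨N₁, h₁⟩ := ncoeff_eventually_zero B v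
          obtain ⟨N₂, h₂⟩ := ncoeff_eventually_zero B w
          rw [finsum_eq_range (N := N₁ + N₂ + m.natAbs), finsum_eq_range (N := N₁ + N₂ + m.natAbs),
            finsum_eq_range (N := N₁ + N₂ + m.natAbs), ← Finset.sum_add_distrib]
          · simp
          · intro j hj; rw [h₂ _ (by omega)]; simp
          · intro j hj; rw [h₁ _ (by omega)]; simp
          · intro j hj; rw [map_add, h₁ _ (by omega), h₂ _ (by omega)]; simp
        map_smul' := by
          intro c v
          simp only [map_smul, RingHom.id_apply]
          rw [smul_finsum]
          simp only [smul_comm c] })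
    (by
      intro v
      obtain ⟨N, h⟩ := ncoeff_eventually_zero B v
      refine ⟨N, fun m hm => ?_⟩
      simp only [LinearMap.coe_mk, AddHom.coe_mk]
      rw [finsum_eq_range (N := 0) (fun j _ => by rw [h _ (by omega)]; simp)]
      simp)

/-- The field with modes `m ↦ ∑_{j ≥ 0} (-1)^j binom(n, j) (-1)^n B_{n+m-j} A_j`. -/
def rightProd (A : VertexOperator ℂ V) (n : ℤ) (B : VertexOperator ℂ V) : VertexOperator ℂ V :=
  mkField
    (fun m =>
      { toFun := fun v => ∑ᶠ j : ℕ, (bc n j * (-1) ^ n) • (B[[n + m - j]]) ((A[[(j : ℤ)]]) v)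
        map_add' := by
          intro v w
          obtain ⟨N₁, h₁⟩ := ncoeff_eventually_zero A v
          obtain ⟨N₂, h₂⟩ := ncoeff_eventually_zero A w
          rw [finsum_eq_range (N := N₁ + N₂), finsum_eq_range (N := N₁ + N₂),
            finsum_eq_range (N := N₁ + N₂), ← Finset.sum_add_distrib]
          · simp
          · intro j hj; rw [h₂ _ (by omega)]; simp
          · intro j hj; rw [h₁ _ (by omega)]; simp
          · intro j hj; rw [map_add, h₁ _ (by omega), h₂ _ (by omega)]; simp
        map_smul' := by
          intro c v
          simp only [map_smul, RingHom.id_apply]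
          rw [smul_finsum]
          simp only [smul_comm c] })
    (by
      intro v
      obtain ⟨N, h⟩ := ncoeff_eventually_zero A v
      obtain ⟨M, hM⟩ := uniform_bound B (fun j => (A[[(j : ℤ)]]) v) N
      refine ⟨M + N + n.natAbs, fun m hm => ?_⟩
      simp only [LinearMap.coe_mk, AddHom.coe_mk]
      rw [finsum_eq_range (N := N) (fun j _ => by rw [h _ (by omega)]; simp)]
      apply Finset.sum_eq_zero
      intro j hj
      rw [Finset.mem_range] at hj
      rw [hM j hj _ (by omega), smul_zero])

/-- The `n`-th product of fields `A_{(n)} B`, whose modes are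
`(A_{(n)} B)_m = ∑_{j ≥ 0} (-1)^j binom(n, j) (A_{n-j} B_{m+j} - (-1)^n B_{n+m-j} A_j)`. -/
def fieldProd (A : VertexOperator ℂ V) (n : ℤ) (B : VertexOperator ℂ V) : VertexOperator ℂ V :=
  leftProd A n B - rightProd A n B

theorem leftProd_apply (A : VertexOperator ℂ V) (n : ℤ) (B : VertexOperator ℂ V) (m : ℤ) (v : V) :
    ((leftProd A n B)[[m]]) v = ∑ᶠ j : ℕ, bc n j • (A[[n - j]]) ((B[[m + j]]) v) := by
  rw [leftProd, mkField_ncoeff]; rfl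

theorem rightProd_apply (A : VertexOperator ℂ V) (n : ℤ) (B : VertexOperator ℂ V) (m : ℤ) (v : V) :
    ((rightProd A n B)[[m]]) v =
      ∑ᶠ j : ℕ, (bc n j * (-1) ^ n) • (B[[n + m - j]]) ((A[[(j : ℤ)]]) v) := by
  rw [rightProd, mkField_ncoeff]; rfl

theorem leftProd_apply_range (A : VertexOperator ℂ V) (n : ℤ) (B : VertexOperator ℂ V) (m : ℤ)
    (v : V) (N : ℕ) (h : ∀ j : ℕ, N ≤ j → (B[[m + j]]) v = 0) :
    ((leftProd A n B)[[m]]) v = ∑ j ∈ Finset.range N, bc n j • (A[[n - j]]) ((B[[m + j]]) v) := by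
  rw [leftProd_apply, finsum_eq_range]
  intro j hj; rw [h j hj]; simp

theorem rightProd_apply_range (A : VertexOperator ℂ V) (n : ℤ) (B : VertexOperator ℂ V) (m : ℤ)
    (v : V) (N : ℕ) (h : ∀ j : ℕ, N ≤ j → (A[[(j : ℤ)]]) v = 0) :
    ((rightProd A n B)[[m]]) v =
      ∑ j ∈ Finset.range N, (bc n j * (-1) ^ n) • (B[[n + m - j]]) ((A[[(j : ℤ)]]) v) := by
  rw [rightProd_apply, finsum_eq_range]
  intro j hj; rw [h j hj]; simp

theorem sum_triangle {M : Type*} [AddCommMonoid M] (N : ℕ) (f : ℕ → ℕ → M)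
    (h : ∀ i j, N ≤ i + j → f i j = 0) :
    ∑ i ∈ Finset.range N, ∑ j ∈ Finset.range N, f i j =
      ∑ s ∈ Finset.range N, ∑ p ∈ Finset.HasAntidiagonal.antidiagonal s, f p.1 p.2 := by
  rw [← Finset.sum_product', Finset.sum_sigma']
  symm
  apply Finset.sum_of_injOn (fun x : (_ : ℕ) × (ℕ × ℕ) => x.2)
  · rintro ⟨s, a, b⟩ h₁ ⟨t, c, d⟩ h₂ h₃
    simp at h₁ h₂ h₃
    obtain ⟨rfl, rfl⟩ := h₃
    simp [← h₁.2, ← h₂.2]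
  · rintro ⟨s, a, b⟩ h₁
    simp at h₁ ⊢
    omega
  · rintro ⟨a, b⟩ h₁ h₂
    apply h
    by_contra hc
    apply h₂
    exact ⟨⟨a + b, a, b⟩, by simp; omega, rfl⟩
  · rintro ⟨s, a, b⟩ h₁
    rfl

theorem bc_vandermonde (m n : ℤ) (s : ℕ) :
    ∑ p ∈ Finset.HasAntidiagonal.antidiagonal s, bc m p.1 * bc n p.2 = bc (m + n) s := by
  simp only [bc]
  rw [Ring.add_choose_eq s (Commute.all m n)]
  push_cast
  rw [Finset.mul_sum]
  apply Finset.sum_congr rfl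
  intro p hp
  rw [← Finset.HasAntidiagonal.mem_antidiagonal.1 hp, pow_add]
  ring

theorem bc_mul_sub (m : ℤ) (j : ℕ) : bc m j * ((m : ℂ) - j) = m * bc (m - 1) j := by
  have key : ∀ j : ℕ, Ring.choose m j * (m - j) = m * Ring.choose (m - 1) j := by
    intro j
    cases j with
    | zero => simp
    | succ j =>
      have h₁ := Ring.choose_smul_choose m (n := j + 1) (k := 1) (by omega)
      have h₂ := Ring.choose_succ_succ (m - 1) j
      simp at h₁ h₂
      push_cast
      linear_combination m * h₂ - h₁
  have := congrArg (Int.cast : ℤ → ℂ) (key j)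
  push_cast at this
  simp only [bc]
  linear_combination (-1) ^ j * this

theorem bc_central (m n : ℤ) (s : ℕ) :
    (∑ p ∈ Finset.HasAntidiagonal.antidiagonal s, bc m p.1 * bc n p.2 * ((m : ℂ) - p.1)) *
      (if m + n - s = 0 then 1 else 0) = if s = 0 ∧ m + n = 0 then (m : ℂ) else 0 := by
  have h : ∑ p ∈ Finset.HasAntidiagonal.antidiagonal s, bc m p.1 * bc n p.2 * ((m : ℂ) - p.1) =
      m * bc (m + n - 1) s := by
    rw [show m + n - 1 = (m - 1) + n by ring, ← bc_vandermonde, Finset.mul_sum]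
    apply Finset.sum_congr rfl
    intro p hp
    linear_combination bc n p.2 * bc_mul_sub m p.1
  rw [h]
  by_cases hs : m + n - s = 0
  · have h' : m + n = s := by omega
    rw [h']
    cases s with
    | zero => simp [bc]
    | succ s =>
      have : ((s + 1 : ℕ) : ℤ) - 1 = (s : ℤ) := by push_cast; ring
      simp only [bc, this, Ring.choose_natCast]
      simp
  · rw [if_neg hs, if_neg (by omega), mul_zero]

variable {X Y Z : VertexOperator ℂ V} {c : ℂ}

/-- The fields `X`, `Y` have the commutation relations of currents with
`[X, Y] = Z` and level pairing `c`. -/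
def IsCurrentBracket (X Y Z : VertexOperator ℂ V) (c : ℂ) : Prop :=
  ∀ (m n : ℤ) (v : V), (X[[m]]) ((Y[[n]]) v) - (Y[[n]]) ((X[[m]]) v) =
    (Z[[m + n]]) v + (if m + n = 0 then (m : ℂ) * c else 0) • v

theorem leftProd_comm (h : IsCurrentBracket X Y Z c) (m n : ℤ) (A : VertexOperator ℂ V) :
    leftProd X m (leftProd Y n A) - leftProd Y n (leftProd X m A) =
      leftProd Z (m + n) A + (if m + n = 0 then (m : ℂ) * c else 0) • A := by
  apply field_ext
  intro k v
  obtain ⟨N₀, hN₀⟩ := ncoeff_eventually_zero A v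
  obtain ⟨N, hN, hN1⟩ : ∃ N : ℕ, (∀ j : ℕ, N ≤ j → (A[[k + j]]) v = 0) ∧ 1 ≤ N :=
    ⟨N₀ + k.natAbs + 1, fun j hj => hN₀ _ (by omega), by omega⟩
  have dbl : ∀ (P Q : VertexOperator ℂ V) (a b : ℤ), ((leftProd P a (leftProd Q b A))[[k]]) v =
      ∑ i ∈ Finset.range N, ∑ j ∈ Finset.range N,
        (bc a i * bc b j) • (P[[a - i]]) ((Q[[b - j]]) ((A[[k + (i + j : ℕ)]]) v)) := by
    intro P Q a b
    have hQ : ∀ i : ℕ, ((leftProd Q b A)[[k + i]]) v =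
        ∑ j ∈ Finset.range N, bc b j • (Q[[b - j]]) ((A[[k + (i + j : ℕ)]]) v) := by
      intro i
      rw [leftProd_apply_range (N := N)]
      · simp only [Nat.cast_add, add_assoc]
      · intro j hj
        rw [add_assoc, ← Nat.cast_add, hN _ (by omega)]
    rw [leftProd_apply_range (N := N)]
    · apply Finset.sum_congr rfl
      intro i hi
      rw [hQ, map_sum, Finset.smul_sum]
      apply Finset.sum_congr rfl
      intro j hj
      rw [map_smul, smul_smul]
    · intro i hi
      rw [hQ]
      apply Finset.sum_eq_zero
      intro j hj
      rw [hN _ (by omega)]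
      simp
  simp only [map_sub, map_add, map_smul, Pi.sub_apply, Pi.add_apply, Pi.smul_apply,
    LinearMap.sub_apply, LinearMap.add_apply, LinearMap.smul_apply]
  rw [dbl, dbl, Finset.sum_comm (f := fun i j => (bc n i * bc m j) • _),
    ← Finset.sum_sub_distrib]
  simp only [← Finset.sum_sub_distrib]
  have step : ∀ i j : ℕ, (bc m i * bc n j) • (X[[m - i]]) ((Y[[n - j]]) ((A[[k + (i + j : ℕ)]]) v)) -
      (bc n j * bc m i) • (Y[[n - j]]) ((X[[m - i]]) ((A[[k + (j + i : ℕ)]]) v)) =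
      (bc m i * bc n j) • ((Z[[m + n - (i + j : ℕ)]]) ((A[[k + (i + j : ℕ)]]) v) +
        (if m + n - (i + j : ℕ) = 0 then ((m : ℂ) - i) * c else 0) • (A[[k + (i + j : ℕ)]]) v) := by
    intro i j
    rw [mul_comm (bc n j), add_comm j i, ← smul_sub, h]
    have e : m - i + (n - j) = m + n - (i + j : ℕ) := by push_cast; ring
    rw [e]
    push_cast
    rfl
  simp only [step]
  rw [sum_triangle N (fun i j => (bc m i * bc n j) • ((Z[[m + n - (i + j : ℕ)]])
        ((A[[k + (i + j : ℕ)]]) v) +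
        (if m + n - (i + j : ℕ) = 0 then ((m : ℂ) - i) * c else 0) • (A[[k + (i + j : ℕ)]]) v))
    (by intro i j hij; simp only [hN _ hij]; simp)]
  have inner : ∀ s : ℕ, (∑ p ∈ Finset.HasAntidiagonal.antidiagonal s,
      (bc m p.1 * bc n p.2) • ((Z[[m + n - (p.1 + p.2 : ℕ)]]) ((A[[k + (p.1 + p.2 : ℕ)]]) v) +
        (if m + n - (p.1 + p.2 : ℕ) = 0 then ((m : ℂ) - p.1) * c else 0) •
          (A[[k + (p.1 + p.2 : ℕ)]]) v)) =
      bc (m + n) s • (Z[[m + n - s]]) ((A[[k + s]]) v) +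
        (if s = 0 then (if m + n = 0 then (m : ℂ) * c else 0) • (A[[k]]) v else 0) := by
    intro s
    have : ∀ p ∈ Finset.HasAntidiagonal.antidiagonal s,
      (bc m p.1 * bc n p.2) • ((Z[[m + n - (p.1 + p.2 : ℕ)]]) ((A[[k + (p.1 + p.2 : ℕ)]]) v) +
        (if m + n - (p.1 + p.2 : ℕ) = 0 then ((m : ℂ) - p.1) * c else 0) •
          (A[[k + (p.1 + p.2 : ℕ)]]) v) =
      (bc m p.1 * bc n p.2) • (Z[[m + n - s]]) ((A[[k + s]]) v) +
      (bc m p.1 * bc n p.2 * ((m : ℂ) - p.1)) •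
        (((if m + n - s = 0 then 1 else 0) * c) • (A[[k + s]]) v) := by
      intro p hp
      rw [Finset.HasAntidiagonal.mem_antidiagonal.1 hp, smul_add, smul_smul, smul_smul]
      congr 2
      split_ifs <;> ring
    rw [Finset.sum_congr rfl this, Finset.sum_add_distrib, ← Finset.sum_smul, ← Finset.sum_smul,
      bc_vandermonde, smul_smul, ← mul_assoc, bc_central]
    congr 1
    by_cases hs : s = 0
    · subst hs
      by_cases hmn : m + n = 0 <;> simp [hmn]
    · simp [hs]
  rw [Finset.sum_congr rfl (fun s _ => inner s), Finset.sum_add_distrib,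
    leftProd_apply_range (N := N) (h := hN)]
  congr 1
  rw [Finset.sum_ite_eq' (Finset.range N) 0 (fun _ => _), if_pos (Finset.mem_range.2 (by omega))]

theorem rightProd_comm (h : IsCurrentBracket X Y Z c) (m n : ℤ) (A : VertexOperator ℂ V) :
    rightProd X m (rightProd Y n A) - rightProd Y n (rightProd X m A) =
      - rightProd Z (m + n) A := by
  apply field_ext
  intro k v
  obtain ⟨N₁, h₁⟩ := ncoeff_eventually_zero X v
  obtain ⟨N₂, h₂⟩ := ncoeff_eventually_zero Y v
  obtain ⟨N₃, h₃⟩ := uniform_bound Y (fun i => (X[[(i : ℤ)]]) v) N₁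
  obtain ⟨N₄, h₄⟩ := uniform_bound X (fun i => (Y[[(i : ℤ)]]) v) N₂
  obtain ⟨N, hX, hY, hYX, hXY, hN1⟩ : ∃ N : ℕ, (∀ j : ℕ, N ≤ j → (X[[(j : ℤ)]]) v = 0) ∧
      (∀ j : ℕ, N ≤ j → (Y[[(j : ℤ)]]) v = 0) ∧
      (∀ i j : ℕ, N ≤ j → (Y[[(j : ℤ)]]) ((X[[(i : ℤ)]]) v) = 0) ∧
      (∀ i j : ℕ, N ≤ j → (X[[(j : ℤ)]]) ((Y[[(i : ℤ)]]) v) = 0) ∧ 1 ≤ N := by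
    refine ⟨N₁ + N₂ + N₃ + N₄ + 1, fun j hj => h₁ _ (by omega), fun j hj => h₂ _ (by omega),
      fun i j hj => ?_, fun i j hj => ?_, by omega⟩
    · by_cases hi : i < N₁
      · exact h₃ i hi _ (by omega)
      · rw [h₁ i (by omega), map_zero]
    · by_cases hi : i < N₂
      · exact h₄ i hi _ (by omega)
      · rw [h₂ i (by omega), map_zero]
  have dbl : ∀ (P Q : VertexOperator ℂ V) (a b : ℤ),
      (∀ j : ℕ, N ≤ j → (P[[(j : ℤ)]]) v = 0) →
      (∀ i j : ℕ, N ≤ j → (Q[[(j : ℤ)]]) ((P[[(i : ℤ)]]) v) = 0) →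
      ((rightProd P a (rightProd Q b A))[[k]]) v =
      ∑ i ∈ Finset.range N, ∑ j ∈ Finset.range N,
        (bc a i * bc b j * (-1) ^ (a + b)) •
          (A[[a + b + k - (i + j : ℕ)]]) ((Q[[(j : ℤ)]]) ((P[[(i : ℤ)]]) v)) := by
    intro P Q a b hP hQP
    rw [rightProd_apply_range (N := N) (h := hP)]
    apply Finset.sum_congr rfl
    intro i hi
    rw [rightProd_apply_range (N := N) (h := hQP i), Finset.smul_sum]
    apply Finset.sum_congr rfl
    intro j hj
    rw [smul_smul, zpow_add₀ (by norm_num)]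
    have e : b + (a + k - i) - j = a + b + k - (i + j : ℕ) := by push_cast; ring
    rw [e]
    congr 1
    ring
  have hb : ∀ i j : ℕ, (Y[[(j : ℤ)]]) ((X[[(i : ℤ)]]) v) - (X[[(i : ℤ)]]) ((Y[[(j : ℤ)]]) v) =
      - (Z[[((i + j : ℕ) : ℤ)]]) v := by
    intro i j
    have := h i j v
    have e : (if (i : ℤ) + j = 0 then ((i : ℤ) : ℂ) * c else 0) = 0 := by
      split_ifs with hij
      · have : i = 0 := by omega
        simp [this]
      · rfl
    rw [e, zero_smul, add_zero] at this
    rw [← neg_sub, this]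
    push_cast
    rfl
  have hZ : ∀ s : ℕ, N ≤ s → (Z[[(s : ℤ)]]) v = 0 := by
    intro s hs
    have := hb 0 s
    rw [hYX 0 s hs, hY s hs, map_zero, sub_zero, zero_add] at this
    exact neg_eq_zero.1 this.symm
  simp only [map_sub, map_neg, Pi.sub_apply, Pi.neg_apply, LinearMap.sub_apply,
    LinearMap.neg_apply]
  rw [dbl X Y m n hX hYX, dbl Y X n m hY hXY,
    Finset.sum_comm (f := fun i j => (bc n i * bc m j * _) • _), ← Finset.sum_sub_distrib]
  simp only [← Finset.sum_sub_distrib]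
  have step : ∀ i j : ℕ, (bc m i * bc n j * (-1) ^ (m + n)) •
        (A[[m + n + k - (i + j : ℕ)]]) ((Y[[(j : ℤ)]]) ((X[[(i : ℤ)]]) v)) -
      (bc n j * bc m i * (-1) ^ (n + m)) •
        (A[[n + m + k - (j + i : ℕ)]]) ((X[[(i : ℤ)]]) ((Y[[(j : ℤ)]]) v)) =
      (bc m i * bc n j) • (-((-1 : ℂ) ^ (m + n) •
        (A[[m + n + k - (i + j : ℕ)]]) ((Z[[((i + j : ℕ) : ℤ)]]) v))) := by
    intro i j
    rw [mul_comm (bc n j), add_comm j i, add_comm n m, ← smul_sub, ← map_sub, hb, map_neg,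
      smul_neg, smul_neg, smul_smul]
  simp only [step]
  rw [sum_triangle N (fun i j => (bc m i * bc n j) • (-((-1 : ℂ) ^ (m + n) •
        (A[[m + n + k - (i + j : ℕ)]]) ((Z[[((i + j : ℕ) : ℤ)]]) v))))
    (by intro i j hij; simp only [hZ _ hij]; simp),
    rightProd_apply_range (N := N) (h := hZ), ← Finset.sum_neg_distrib]
  apply Finset.sum_congr rfl
  intro s hs
  rw [mul_smul, ← smul_neg, ← bc_vandermonde, Finset.sum_smul]
  apply Finset.sum_congr rfl
  intro p hp
  rw [Finset.HasAntidiagonal.mem_antidiagonal.1 hp]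

theorem leftProd_rightProd_comm (X Y : VertexOperator ℂ V) (m n : ℤ) (A : VertexOperator ℂ V) :
    leftProd X m (rightProd Y n A) = rightProd Y n (leftProd X m A) := by
  apply field_ext
  intro k v
  obtain ⟨N₁, h₁⟩ := ncoeff_eventually_zero Y v
  obtain ⟨N₂, h₂⟩ := uniform_bound A (fun j => (Y[[(j : ℤ)]]) v) N₁
  set M : ℕ := N₂ + n.natAbs + k.natAbs + N₁ with hM
  have hR : ∀ i : ℕ, ((rightProd Y n A)[[k + i]]) v = ∑ j ∈ Finset.range N₁,
      (bc n j * (-1) ^ n) • (A[[n + (k + i) - j]]) ((Y[[(j : ℤ)]]) v) := fun i =>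
    rightProd_apply_range _ _ _ _ _ _ (fun j hj => h₁ _ (by omega))
  rw [rightProd_apply_range (N := N₁) (h := fun j hj => h₁ _ (by omega)),
    leftProd_apply_range (N := M)]
  · simp only [hR]
    have : ∀ j ∈ Finset.range N₁, (bc n j * (-1) ^ n) •
        ((leftProd X m A)[[n + k - j]]) ((Y[[(j : ℤ)]]) v) = ∑ i ∈ Finset.range M,
        (bc n j * (-1) ^ n) • bc m i • (X[[m - i]]) ((A[[n + k - j + i]]) ((Y[[(j : ℤ)]]) v)) := by
      intro j hj
      rw [Finset.mem_range] at hj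
      rw [leftProd_apply_range (N := M), Finset.smul_sum]
      intro i hi
      exact h₂ j hj _ (by omega)
    rw [Finset.sum_congr rfl this, Finset.sum_comm]
    apply Finset.sum_congr rfl
    intro i hi
    rw [map_sum, Finset.smul_sum]
    apply Finset.sum_congr rfl
    intro j hj
    rw [map_smul, smul_comm]
    have e : n + (k + i) - j = n + k - j + (i : ℤ) := by ring
    rw [e]
  · intro i hi
    rw [hR]
    apply Finset.sum_eq_zero
    intro j hj
    rw [Finset.mem_range] at hj
    rw [h₂ j hj _ (by omega), smul_zero]

/-- `fieldProd X m` as a linear endomorphism of the space of fields, linear in `X` as well. -/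
def fieldProdLin (m : ℤ) : VertexOperator ℂ V →ₗ[ℂ] VertexOperator ℂ V →ₗ[ℂ] VertexOperator ℂ V :=
  LinearMap.mk₂ ℂ (fun A B => fieldProd A m B)
    (by
      intro A A' B
      apply field_ext
      intro k v
      obtain ⟨N₀, h₀⟩ := ncoeff_eventually_zero B v
      obtain ⟨N₁, h₁⟩ := ncoeff_eventually_zero A v
      obtain ⟨N₂, h₂⟩ := ncoeff_eventually_zero A' v
      simp only [fieldProd, map_sub, map_add, Pi.sub_apply, Pi.add_apply, LinearMap.sub_apply,
        LinearMap.add_apply]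
      rw [leftProd_apply_range (N := N₀ + k.natAbs), leftProd_apply_range (N := N₀ + k.natAbs),
        leftProd_apply_range (N := N₀ + k.natAbs), rightProd_apply_range (N := N₁ + N₂),
        rightProd_apply_range (N := N₁ + N₂), rightProd_apply_range (N := N₁ + N₂)]
      · simp only [map_add, Pi.add_apply, LinearMap.add_apply, smul_add, Finset.sum_add_distrib]
        abel
      all_goals intro j hj
      · exact h₂ _ (by omega)
      · exact h₁ _ (by omega)
      · simp only [map_add, Pi.add_apply, LinearMap.add_apply]
        rw [h₁ _ (by omega), h₂ _ (by omega), add_zero]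
      all_goals exact h₀ _ (by omega))
    (by
      intro a A B
      apply field_ext
      intro k v
      simp only [fieldProd, map_sub, map_smul, Pi.sub_apply, Pi.smul_apply, LinearMap.sub_apply,
        LinearMap.smul_apply, leftProd_apply, rightProd_apply, smul_sub, smul_finsum]
      simp only [smul_comm a])
    (by
      intro A B B'
      apply field_ext
      intro k v
      obtain ⟨N₀, h₀⟩ := ncoeff_eventually_zero A v
      obtain ⟨N₁, h₁⟩ := ncoeff_eventually_zero B v
      obtain ⟨N₂, h₂⟩ := ncoeff_eventually_zero B' v
      simp only [fieldProd, map_sub, map_add, Pi.sub_apply, Pi.add_apply, LinearMap.sub_apply,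
        LinearMap.add_apply]
      rw [leftProd_apply_range (N := N₁ + N₂ + k.natAbs),
        leftProd_apply_range (N := N₁ + N₂ + k.natAbs),
        leftProd_apply_range (N := N₁ + N₂ + k.natAbs), rightProd_apply_range (N := N₀),
        rightProd_apply_range (N := N₀), rightProd_apply_range (N := N₀)]
      · simp only [map_add, Pi.add_apply, LinearMap.add_apply, smul_add, Finset.sum_add_distrib]
        abel
      all_goals intro j hj
      iterate 3 exact h₀ _ (by omega)
      · exact h₂ _ (by omega)
      · exact h₁ _ (by omega)
      · simp only [map_add, Pi.add_apply, LinearMap.add_apply]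
        rw [h₁ _ (by omega), h₂ _ (by omega), add_zero])
    (by
      intro a A B
      apply field_ext
      intro k v
      simp only [fieldProd, map_sub, map_smul, Pi.sub_apply, Pi.smul_apply, LinearMap.sub_apply,
        LinearMap.smul_apply, leftProd_apply, rightProd_apply, smul_sub, smul_finsum]
      simp only [smul_comm a])

@[simp]
theorem fieldProdLin_apply (A B : VertexOperator ℂ V) (m : ℤ) :
    fieldProdLin m A B = fieldProd A m B := rfl

theorem rightProd_sub (A : VertexOperator ℂ V) (m : ℤ) (B C : VertexOperator ℂ V) :
    rightProd A m (B - C) = rightProd A m B - rightProd A m C := by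
  apply field_ext
  intro k v
  obtain ⟨N₀, h₀⟩ := ncoeff_eventually_zero A v
  simp only [map_sub, Pi.sub_apply, LinearMap.sub_apply]
  rw [rightProd_apply_range (N := N₀), rightProd_apply_range (N := N₀),
    rightProd_apply_range (N := N₀), ← Finset.sum_sub_distrib]
  · simp only [map_sub, Pi.sub_apply, LinearMap.sub_apply, smul_sub]
  all_goals exact fun j hj => h₀ _ (by omega)

theorem leftProd_sub (A : VertexOperator ℂ V) (m : ℤ) (B C : VertexOperator ℂ V) :
    leftProd A m (B - C) = leftProd A m B - leftProd A m C := by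
  have h₁ := (fieldProdLin m A).map_sub B C
  simp only [fieldProdLin_apply, fieldProd, rightProd_sub] at h₁
  calc leftProd A m (B - C) = (leftProd A m (B - C) - (rightProd A m B - rightProd A m C)) +
        (rightProd A m B - rightProd A m C) := by abel
    _ = _ := by rw [h₁]; abel

theorem fieldProd_comm (h : IsCurrentBracket X Y Z c) (m n : ℤ) (A : VertexOperator ℂ V) :
    fieldProd X m (fieldProd Y n A) - fieldProd Y n (fieldProd X m A) =
      fieldProd Z (m + n) A + (if m + n = 0 then (m : ℂ) * c else 0) • A := by
  have h₁ := leftProd_comm h m n A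
  have h₂ := rightProd_comm h m n A
  simp only [fieldProd, leftProd_sub, rightProd_sub, leftProd_rightProd_comm]
  rw [sub_eq_iff_eq_add] at h₁ h₂
  rw [h₁, h₂]
  abel

variable (V) in
/-- The identity field `Id_V`, whose only nonzero mode is the `(-1)`-st. -/
def idField : VertexOperator ℂ V :=
  mkField (fun m => if m = -1 then LinearMap.id else 0) (by
    intro v
    exact ⟨0, fun m hm => by rw [if_neg (by omega)]; rfl⟩)

theorem fieldProd_idField (X : VertexOperator ℂ V) (m : ℤ) (hm : 0 ≤ m) :
    fieldProd X m (idField V) = 0 := by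
  obtain ⟨m, rfl⟩ := Int.eq_ofNat_of_zero_le hm
  rw [fieldProd, sub_eq_zero]
  apply field_ext
  intro k v
  obtain ⟨N, hN⟩ := ncoeff_eventually_zero X v
  have hid : ∀ (p : ℤ) (w : V), ((idField V)[[p]]) w = if p = -1 then w else 0 := by
    intro p w
    rw [idField, mkField_ncoeff]
    split_ifs <;> rfl
  rw [leftProd_apply, rightProd_apply]
  simp only [hid]
  by_cases hk : k ≤ -1
  · obtain ⟨a, ha⟩ := Int.eq_ofNat_of_zero_le (show 0 ≤ -1 - k by omega)
    rw [finsum_eq_single _ a (fun j hj => by rw [if_neg (by omega)]; simp), if_pos (by omega)]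
    by_cases hmk : 0 ≤ m + k + 1
    · obtain ⟨b, hb⟩ := Int.eq_ofNat_of_zero_le hmk
      rw [finsum_eq_single _ b (fun j hj => by rw [if_neg (by omega)]; simp), if_pos (by omega)]
      have hab : a + b = m := by omega
      have e : (m : ℤ) - a = b := by omega
      rw [e]
      congr 1
      simp only [bc, Ring.choose_natCast, zpow_natCast]
      rw [← hab, Nat.choose_symm_add, pow_add]
      have hb1 : (-1 : ℂ) ^ b * (-1) ^ b = 1 := by rw [← mul_pow]; simp
      push_cast
      linear_combination (-(-1 : ℂ) ^ a * (Nat.choose (a + b) b)) * hb1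
    · have hz : bc m a = 0 := by
        simp only [bc, Ring.choose_natCast]
        rw [Nat.choose_eq_zero_of_lt (by omega)]
        simp
      rw [hz, zero_smul]
      symm
      apply finsum_eq_zero_of_forall_eq_zero
      intro j
      rw [if_neg (by omega), smul_zero]
  · rw [finsum_eq_zero_of_forall_eq_zero (fun j => by rw [if_neg (by omega)]; simp)]
    symm
    apply finsum_eq_zero_of_forall_eq_zero
    intro j
    split_ifs with hj
    · have hz : bc m j = 0 := by
        simp only [bc, Ring.choose_natCast]
        rw [Nat.choose_eq_zero_of_lt (by omega)]
        simp
      rw [hz, zero_mul, zero_smul]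
    · rw [smul_zero]

end Fields
section Structures

/-- The data of a vertex algebra on a complex vector space `V`: the vacuum vector and the
state-field correspondence `a ↦ Y a = ∑ a_{(n)} z^{-n-1}`. -/
class VertexStructure (V : Type*) [AddCommGroup V] [Module ℂ V] where
  /-- the vacuum vector -/
  vac : V
  /-- the state-field correspondence -/
  Y : V →ₗ[ℂ] VertexOperator ℂ V

end Structures

section Affine

attribute [local instance] LieRing.ofAssociativeRing

variable {g : Type*} [LieRing g] [LieAlgebra ℂ g]

/-- An inner product on a Lie algebra: a symmetric invariant bilinear form. -/
structure InvForm (g : Type*) [LieRing g] [LieAlgebra ℂ g] where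
  /-- the underlying bilinear form -/
  form : LinearMap.BilinForm ℂ g
  isSymm : form.IsSymm
  invariant : form.lieInvariant g

/-- The 2-cocycle `(x t^m, y t^n) ↦ m δ_{m+n,0} κ(x, y)` of the loop algebra `g[t, t⁻¹]`.
Mathlib's residue pairing is `(x t^m, y t^n) ↦ n δ_{m+n,0} κ(x, y)`, whence the sign. -/
def affineCocycle (κ : InvForm g) :
    LieModule.Cohomology.twoCocycle ℂ (LieAlgebra.loopAlgebra ℂ ℤ g)
      (TrivialLieModule ℂ (LieAlgebra.loopAlgebra ℂ ℤ g) ℂ) :=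
  LieAlgebra.LoopAlgebra.twoCocycleOfBilinear ℂ ℤ g (-κ.form)
    (by
      intro x y z
      simp only [LinearMap.neg_apply, neg_inj]
      exact κ.invariant x y z)
    (by
      constructor
      intro x y
      simp only [LinearMap.neg_apply, neg_inj]
      exact κ.isSymm.eq x y)

/-- The affine Lie algebra `ĝ = g[t, t⁻¹] ⊕ ℂ K` attached to the inner product `κ`. -/
abbrev AffineLie (κ : InvForm g) : Type _ := LieAlgebra.ofTwoCocycle (affineCocycle κ)

/-- The element `x t^m` of the affine Lie algebra. -/
def loopElt (κ : InvForm g) (x : g) (m : ℤ) : AffineLie κ :=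
  LieAlgebra.ofProd (affineCocycle κ) (AddMonoidAlgebra.single m 1 ⊗ₜ[ℂ] x, 0)

/-- The central element `K` of the affine Lie algebra. -/
def centralElt (κ : InvForm g) : AffineLie κ :=
  LieAlgebra.ofProd (affineCocycle κ) (0, (TrivialLieModule.equiv ℂ _ ℂ).symm 1)

theorem lie_loopElt (κ : InvForm g) (x y : g) (m n : ℤ) :
    ⁅loopElt κ x m, loopElt κ y n⁆ = loopElt κ ⁅x, y⁆ (m + n) +
      (if m + n = 0 then (m : ℂ) * κ.form x y else 0) • centralElt κ := by
  rw [LieAlgebra.bracket_ofTwoCocycle]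
  simp only [loopElt, centralElt, Equiv.symm_apply_apply, ← LieAlgebra.of_smul, ← LieAlgebra.of_add]
  congr 1
  ext1
  · simp only [LieAlgebra.ExtendScalars.bracket_tmul, AddMonoidAlgebra.single_mul_single, mul_one,
      Prod.fst_add, Prod.smul_fst, smul_zero, add_zero]
  · have h0 : ∀ (a b : TrivialLieModule ℂ (LieAlgebra.loopAlgebra ℂ ℤ g) ℂ)
        (u v : LieAlgebra.loopAlgebra ℂ ℤ g) (w : TrivialLieModule ℂ
          (LieAlgebra.loopAlgebra ℂ ℤ g) ℂ), w + ⁅u, a⁆ - ⁅v, b⁆ = w := by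
      intro a b u v w
      rw [trivial_lie_zero, trivial_lie_zero, add_zero, sub_zero]
    rw [h0]
    apply (TrivialLieModule.equiv ℂ (LieAlgebra.loopAlgebra ℂ ℤ g) ℂ).injective
    have e : (TrivialLieModule.equiv ℂ (LieAlgebra.loopAlgebra ℂ ℤ g) ℂ)
        (((affineCocycle κ : LieModule.Cohomology.twoCochain ℂ (LieAlgebra.loopAlgebra ℂ ℤ g)
      (TrivialLieModule ℂ (LieAlgebra.loopAlgebra ℂ ℤ g) ℂ)) :
          LieAlgebra.loopAlgebra ℂ ℤ g →ₗ[ℂ] LieAlgebra.loopAlgebra ℂ ℤ g →ₗ[ℂ] _)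
          (AddMonoidAlgebra.single m 1 ⊗ₜ[ℂ] x) (AddMonoidAlgebra.single n 1 ⊗ₜ[ℂ] y)) =
        LieAlgebra.LoopAlgebra.residuePairing ℂ ℤ g (-κ.form)
          (AddMonoidAlgebra.single m 1 ⊗ₜ[ℂ] x) (AddMonoidAlgebra.single n 1 ⊗ₜ[ℂ] y) := rfl
    rw [e]
    simp only [LieAlgebra.LoopAlgebra.residuePairing_apply_apply,
      LieAlgebra.LoopAlgebra.toFinsupp_single_tmul]
    rw [Finsupp.sum_single_index (by simp)]
    simp only [Prod.snd_add, Prod.smul_snd, zero_add, map_smul,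
      LinearEquiv.apply_symm_apply, Finsupp.single_apply]
    by_cases hmn : m + n = 0
    · obtain rfl : n = -m := by omega
      simp
    · rw [if_neg hmn, if_neg (by omega)]
      simp

theorem lie_centralElt (κ : InvForm g) (X : AffineLie κ) : ⁅X, centralElt κ⁆ = 0 := by
  rw [LieAlgebra.bracket_ofTwoCocycle]
  simp only [centralElt, Equiv.symm_apply_apply, lie_zero, map_zero, trivial_lie_zero,
    add_zero, sub_zero]
  rfl

theorem affineLie_induction (κ : InvForm g) {p : AffineLie κ → Prop}
    (loop : ∀ x m, p (loopElt κ x m)) (central : p (centralElt κ))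
    (add : ∀ X Y, p X → p Y → p (X + Y)) (smul : ∀ (a : ℂ) X, p X → p (a • X)) (X) : p X := by
  obtain ⟨f, a, rfl⟩ : ∃ f a, X = LieAlgebra.ofProd (affineCocycle κ) (f, 0) + a • centralElt κ := by
    refine ⟨((LieAlgebra.ofProd _).symm X).1,
      TrivialLieModule.equiv ℂ _ ℂ ((LieAlgebra.ofProd _).symm X).2, ?_⟩
    rw [centralElt, ← LieAlgebra.of_smul, ← LieAlgebra.of_add, ← Equiv.symm_apply_eq]
    ext1
    · simp
    · simp [← map_smul]
  refine add _ _ ?_ (smul _ _ central)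
  have zero : p (LieAlgebra.ofProd (affineCocycle κ) (0, 0)) := by
    have := smul 0 _ central
    rwa [zero_smul] at this
  induction f using TensorProduct.induction_on with
  | zero => exact zero
  | add u v hu hv =>
    have := add _ _ hu hv
    rw [← LieAlgebra.of_add] at this
    simpa using this
  | tmul u x =>
    induction u using AddMonoidAlgebra.induction_linear with
    | zero => rw [TensorProduct.zero_tmul]; exact zero
    | add u v hu hv =>
      have := add _ _ hu hv
      rw [← LieAlgebra.of_add] at this
      simpa [TensorProduct.add_tmul] using this
    | single m a =>
      have := smul a _ (loop x m)
      rw [loopElt, ← LieAlgebra.of_smul, Prod.smul_mk, TensorProduct.smul_tmul',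
        AddMonoidAlgebra.smul_single, smul_eq_mul, mul_one, smul_zero] at this
      exact this

theorem uea_induction {L : Type*} [LieRing L] [LieAlgebra ℂ L]
    {p : UniversalEnvelopingAlgebra ℂ L → Prop}
    (scalar : ∀ a : ℂ, p (algebraMap ℂ _ a)) (gen : ∀ x, p (UniversalEnvelopingAlgebra.ι ℂ x))
    (mul : ∀ u v, p u → p v → p (u * v)) (add : ∀ u v, p u → p v → p (u + v)) (u) : p u := by
  let S : Subalgebra ℂ (UniversalEnvelopingAlgebra ℂ L) :=
    { carrier := {u | p u}
      mul_mem' := fun {a b} => mul a b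
      add_mem' := fun {a b} => add a b
      algebraMap_mem' := scalar }
  let f : L →ₗ⁅ℂ⁆ S :=
    { toFun := fun x => ⟨UniversalEnvelopingAlgebra.ι ℂ x, gen x⟩
      map_add' := by intro x y; ext; simp
      map_smul' := by intro a x; ext; simp
      map_lie' := by intro x y; ext; simp [LieRing.of_associative_ring_bracket] }
  have h : S.val.comp (UniversalEnvelopingAlgebra.lift ℂ f) = AlgHom.id ℂ _ := by
    apply UniversalEnvelopingAlgebra.hom_ext
    ext x
    simp [f]
  have := (UniversalEnvelopingAlgebra.lift ℂ f u).2
  have h' := congrArg (fun F => F u) h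
  simp only [AlgHom.coe_comp, Function.comp_apply, Subalgebra.coe_val, AlgHom.coe_id, id_eq] at h'
  rw [h'] at this
  exact this

/-- The left ideal of `U(ĝ)` generated by `g[t]` and `K - 1`. -/
def vacuumIdeal (κ : InvForm g) :
    Submodule (UniversalEnvelopingAlgebra ℂ (AffineLie κ))
      (UniversalEnvelopingAlgebra ℂ (AffineLie κ)) :=
  Submodule.span _
    ({u | ∃ (x : g) (m : ℤ), 0 ≤ m ∧ u = UniversalEnvelopingAlgebra.ι ℂ (loopElt κ x m)} ∪
      {UniversalEnvelopingAlgebra.ι ℂ (centralElt κ) - 1})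

/-- The underlying space of the universal affine vertex algebra `V^κ(g)`: the vacuum module
`U(ĝ) ⊗_{U(g[t] ⊕ ℂ K)} ℂ`, where `g[t]` acts on `ℂ` by `0` and `K` acts by `1`, written as the
quotient of `U(ĝ)` by the left ideal generated by `g[t]` and `K - 1`. -/
def UnivAffine (κ : InvForm g) : Type _ :=
  UniversalEnvelopingAlgebra ℂ (AffineLie κ) ⧸ vacuumIdeal κ

namespace UnivAffine

variable (κ : InvForm g)

instance : AddCommGroup (UnivAffine κ) :=
  inferInstanceAs (AddCommGroup (_ ⧸ vacuumIdeal κ))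

instance : Module (UniversalEnvelopingAlgebra ℂ (AffineLie κ)) (UnivAffine κ) :=
  inferInstanceAs (Module _ (_ ⧸ vacuumIdeal κ))

instance : Module ℂ (UnivAffine κ) :=
  inferInstanceAs (Module ℂ (_ ⧸ vacuumIdeal κ))

instance : IsScalarTower ℂ (UniversalEnvelopingAlgebra ℂ (AffineLie κ)) (UnivAffine κ) :=
  inferInstanceAs (IsScalarTower ℂ _ (_ ⧸ vacuumIdeal κ))

/-- The vacuum vector `|0⟩`, the class of `1`. -/
def vacuum : UnivAffine κ := Submodule.Quotient.mk (p := vacuumIdeal κ) 1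

/-- The action of an element of the affine Lie algebra on the vacuum module. -/
def act (X : AffineLie κ) : Module.End ℂ (UnivAffine κ) :=
  Algebra.lsmul ℂ ℂ (UnivAffine κ) (UniversalEnvelopingAlgebra.ι ℂ X)

theorem act_add (X Y : AffineLie κ) : act κ (X + Y) = act κ X + act κ Y := by
  simp [act]

theorem act_smul (a : ℂ) (X : AffineLie κ) : act κ (a • X) = a • act κ X := by
  simp [act]

theorem act_lie (X Y : AffineLie κ) (v : UnivAffine κ) :
    act κ X (act κ Y v) - act κ Y (act κ X v) = act κ ⁅X, Y⁆ v := by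
  simp only [act, LieHom.map_lie, LieRing.of_associative_ring_bracket, map_sub, map_mul,
    LinearMap.sub_apply, Module.End.mul_apply]

theorem exists_smul_vacuum (v : UnivAffine κ) :
    ∃ u : UniversalEnvelopingAlgebra ℂ (AffineLie κ), v = u • vacuum κ := by
  obtain ⟨u, rfl⟩ := Submodule.Quotient.mk_surjective (vacuumIdeal κ) v
  refine ⟨u, ?_⟩
  rw [vacuum]
  change _ = Submodule.Quotient.mk (u • 1)
  rw [smul_eq_mul, mul_one]

theorem act_central (v : UnivAffine κ) : act κ (centralElt κ) v = v := by
  have hc : ∀ u : UniversalEnvelopingAlgebra ℂ (AffineLie κ),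
      UniversalEnvelopingAlgebra.ι ℂ (centralElt κ) * u =
        u * UniversalEnvelopingAlgebra.ι ℂ (centralElt κ) := by
    intro u
    induction u using uea_induction with
    | scalar a => exact (Algebra.commutes a _).symm
    | gen X =>
      have := congrArg (UniversalEnvelopingAlgebra.ι ℂ) (lie_centralElt κ X)
      rw [LieHom.map_lie, LieRing.of_associative_ring_bracket, map_zero, sub_eq_zero] at this
      exact this.symm
    | mul u v hu hv => rw [← mul_assoc, hu, mul_assoc, hv, mul_assoc]
    | add u v hu hv => rw [mul_add, add_mul, hu, hv]
  have h1 : UniversalEnvelopingAlgebra.ι ℂ (centralElt κ) • vacuum κ = vacuum κ := by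
    rw [vacuum]
    change Submodule.Quotient.mk (_ • 1) = _
    rw [smul_eq_mul, mul_one]
    exact (Submodule.Quotient.eq _).2 (Submodule.subset_span (Or.inr rfl))
  obtain ⟨u, rfl⟩ := exists_smul_vacuum κ v
  rw [act, Algebra.lsmul_coe]
  change _ • _ • _ = _
  rw [← mul_smul, hc, mul_smul, h1]

theorem induction {p : UnivAffine κ → Prop} (vac : p (vacuum κ))
    (add : ∀ v w, p v → p w → p (v + w)) (smul : ∀ (a : ℂ) v, p v → p (a • v))
    (act_mem : ∀ x m v, p v → p (act κ (loopElt κ x m) v)) (v) : p v := by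
  obtain ⟨u, rfl⟩ := exists_smul_vacuum κ v
  have key : ∀ w, p w → p (u • w) := by
    induction u using uea_induction with
    | scalar a => intro w hw; rw [algebraMap_smul]; exact smul a w hw
    | gen X =>
      intro w hw
      change p (act κ X w)
      induction X using affineLie_induction with
      | loop x m => exact act_mem x m w hw
      | central => rwa [act_central]
      | add X Y hX hY => rw [act_add]; exact add _ _ hX hY
      | smul a X hX => rw [act_smul]; exact smul _ _ hX
    | mul u u' hu hu' => intro w hw; rw [mul_smul]; exact hu _ (hu' _ hw)
    | add u u' hu hu' => intro w hw; rw [add_smul]; exact add _ _ (hu _ hw) (hu' _ hw)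
  exact key _ vac

theorem act_loop_comm (x y : g) (m n : ℤ) (v : UnivAffine κ) :
    act κ (loopElt κ x m) (act κ (loopElt κ y n) v) -
      act κ (loopElt κ y n) (act κ (loopElt κ x m) v) =
    act κ (loopElt κ ⁅x, y⁆ (m + n)) v +
      (if m + n = 0 then (m : ℂ) * κ.form x y else 0) • v := by
  rw [act_lie, lie_loopElt, act_add, act_smul, LinearMap.add_apply, LinearMap.smul_apply,
    act_central]

theorem act_loop_vacuum (x : g) (m : ℤ) (hm : 0 ≤ m) :
    act κ (loopElt κ x m) (vacuum κ) = 0 := by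
  change Submodule.Quotient.mk (_ • 1) = _
  rw [smul_eq_mul, mul_one]
  exact (Submodule.Quotient.mk_eq_zero _).2 (Submodule.subset_span (Or.inl ⟨x, m, hm, rfl⟩))

theorem act_eventually_zero (v : UnivAffine κ) :
    ∀ x : g, ∃ N : ℕ, ∀ m : ℤ, (N : ℤ) ≤ m → act κ (loopElt κ x m) v = 0 := by
  induction v using induction with
  | vac => exact fun x => ⟨0, fun m hm => act_loop_vacuum κ x m (by omega)⟩
  | add v w hv hw =>
    intro x
    obtain ⟨N₁, h₁⟩ := hv x
    obtain ⟨N₂, h₂⟩ := hw x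
    refine ⟨N₁ + N₂, fun m hm => ?_⟩
    rw [map_add, h₁ _ (by omega), h₂ _ (by omega), add_zero]
  | smul a v hv =>
    intro x
    obtain ⟨N, h⟩ := hv x
    exact ⟨N, fun m hm => by rw [map_smul, h _ hm, smul_zero]⟩
  | act_mem y n v hv =>
    intro x
    obtain ⟨N₁, h₁⟩ := hv x
    obtain ⟨N₂, h₂⟩ := hv ⁅x, y⁆
    refine ⟨N₁ + N₂ + n.natAbs + 1, fun m hm => ?_⟩
    have := act_loop_comm κ x y m n v
    rw [h₁ _ (by omega), h₂ _ (by omega), if_neg (by omega)] at this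
    simpa using this

/-- The field `x(z) = ∑ (x t^n) z^{-n-1}` on the vacuum module, for `x` in `g`. -/
def current (x : g) : VertexOperator ℂ (UnivAffine κ) :=
  mkField (fun n => act κ (loopElt κ x n)) (fun v => act_eventually_zero κ v x)

theorem current_ncoeff (x : g) (n : ℤ) : (current κ x)[[n]] = act κ (loopElt κ x n) :=
  mkField_ncoeff _ _ _

theorem current_bracket (x y : g) :
    IsCurrentBracket (current κ x) (current κ y) (current κ ⁅x, y⁆) (κ.form x y) := by
  intro m n v
  simp only [current_ncoeff]
  exact act_loop_comm κ x y m n v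

theorem loopElt_add (x y : g) (m : ℤ) : loopElt κ (x + y) m = loopElt κ x m + loopElt κ y m := by
  rw [loopElt, loopElt, loopElt, ← LieAlgebra.of_add, TensorProduct.tmul_add]
  simp

theorem loopElt_smul (a : ℂ) (x : g) (m : ℤ) : loopElt κ (a • x) m = a • loopElt κ x m := by
  rw [loopElt, loopElt, ← LieAlgebra.of_smul, TensorProduct.tmul_smul]
  simp

/-- `x ↦ x(z)` as a linear map. -/
def currentLin : g →ₗ[ℂ] VertexOperator ℂ (UnivAffine κ) where
  toFun := current κ
  map_add' x y := by
    apply field_ext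
    intro m v
    simp [current_ncoeff, loopElt_add, act_add]
  map_smul' a x := by
    apply field_ext
    intro m v
    simp [current_ncoeff, loopElt_smul, act_smul]

/-- The action of the affine Lie algebra on the space of all fields on the vacuum module, in which
`x t^m` acts by `A ↦ x(z)_{(m)} A` and `K` acts by `1`, as a linear map. -/
def fieldActionLin :
    AffineLie κ →ₗ[ℂ] Module.End ℂ (VertexOperator ℂ (UnivAffine κ)) where
  toFun X :=
    (Finsupp.lsum ℂ fun m => (fieldProdLin m).comp (currentLin κ))
      (LieAlgebra.LoopAlgebra.toFinsupp ℂ ℤ g ((LieAlgebra.ofProd _).symm X).1) +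
    (TrivialLieModule.equiv ℂ _ ℂ ((LieAlgebra.ofProd _).symm X).2) • LinearMap.id
  map_add' X Y := by
    simp only [LieAlgebra.of_symm_add, Prod.fst_add, Prod.snd_add, map_add, add_smul]
    abel
  map_smul' a X := by
    simp only [LieAlgebra.of_symm_smul, Prod.smul_fst, Prod.smul_snd, map_smul, smul_add,
      smul_assoc, RingHom.id_apply]

theorem fieldActionLin_loop (x : g) (m : ℤ) (A : VertexOperator ℂ (UnivAffine κ)) :
    fieldActionLin κ (loopElt κ x m) A = fieldProd (current κ x) m A := by
  simp only [fieldActionLin, loopElt, LinearMap.coe_mk, AddHom.coe_mk, Equiv.symm_apply_apply,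
    LieAlgebra.LoopAlgebra.toFinsupp_single_tmul, map_zero, zero_smul, add_zero,
    Finsupp.lsum_single]
  rfl

theorem fieldActionLin_central (A : VertexOperator ℂ (UnivAffine κ)) :
    fieldActionLin κ (centralElt κ) A = A := by
  simp [fieldActionLin, centralElt]

/-- `fieldActionLin` is an action of the affine Lie algebra. -/
def fieldAction : AffineLie κ →ₗ⁅ℂ⁆ Module.End ℂ (VertexOperator ℂ (UnivAffine κ)) :=
  { fieldActionLin κ with
    map_lie' := by
      intro X Y
      change fieldActionLin κ ⁅X, Y⁆ =
        fieldActionLin κ X * fieldActionLin κ Y - fieldActionLin κ Y * fieldActionLin κ X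
      have hcent : fieldActionLin κ (centralElt κ) = 1 :=
        LinearMap.ext (fieldActionLin_central κ)
      have hself : ∀ F : Module.End ℂ (VertexOperator ℂ (UnivAffine κ)), F - F = 0 :=
        fun F => LinearMap.ext fun A => by rw [LinearMap.sub_apply, sub_self, LinearMap.zero_apply]
      have hsmul : ∀ (a : ℂ) (F G : Module.End ℂ (VertexOperator ℂ (UnivAffine κ))),
          a • (F - G) = a • F - a • G := fun a F G => LinearMap.ext fun A => by
        simp only [LinearMap.sub_apply, LinearMap.smul_apply, smul_sub]
      induction Y using affineLie_induction with
      | central =>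
        rw [lie_centralElt, hcent, map_zero, mul_one, one_mul]; exact (hself _).symm
      | add Y Z hY hZ => rw [lie_add, map_add, hY, hZ, map_add, mul_add, add_mul]; abel
      | smul a Y hY => rw [lie_smul, map_smul, hY, map_smul, mul_smul_comm, smul_mul_assoc]; exact hsmul _ _ _
      | loop y n =>
        induction X using affineLie_induction with
        | central =>
          rw [← lie_skew, lie_centralElt, hcent, neg_zero, map_zero, mul_one, one_mul]; exact (hself _).symm
        | add Y Z hY hZ => rw [add_lie, map_add, hY, hZ, map_add, mul_add, add_mul]; abel
        | smul a Y hY => rw [smul_lie, map_smul, hY, map_smul, mul_smul_comm, smul_mul_assoc]; exact hsmul _ _ _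
        | loop x m =>
          apply LinearMap.ext
          intro A
          rw [lie_loopElt, map_add, map_smul]
          simp only [LinearMap.add_apply, LinearMap.smul_apply, LinearMap.sub_apply,
            Module.End.mul_apply, fieldActionLin_loop, fieldActionLin_central]
          exact (fieldProd_comm (current_bracket κ x y) m n A).symm }

/-- The state-field correspondence of `V^κ(g)`: the unique `ĝ`-equivariant linear map from the
vacuum module to fields sending `|0⟩` to the identity field, so that
`Y (x₁ t^{m₁} ⋯ x_r t^{m_r} |0⟩) = x₁(z)_{(m₁)} (⋯ (x_r(z)_{(m_r)} Id))`. -/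
def stateField : UnivAffine κ →ₗ[ℂ] VertexOperator ℂ (UnivAffine κ) :=
  Submodule.liftQ ((vacuumIdeal κ).restrictScalars ℂ)
    ((LinearMap.applyₗ (idField (UnivAffine κ))).comp
      (UniversalEnvelopingAlgebra.lift ℂ (fieldAction κ)).toLinearMap)
    (by
      intro u hu
      rw [Submodule.restrictScalars_mem] at hu
      rw [LinearMap.mem_ker]
      change UniversalEnvelopingAlgebra.lift ℂ (fieldAction κ) u (idField (UnivAffine κ)) = 0
      induction hu using Submodule.span_induction with
      | zero => simp
      | add u v _ _ hu hv => rw [map_add, LinearMap.add_apply, hu, hv, add_zero]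
      | smul a u _ hu => rw [smul_eq_mul, map_mul, Module.End.mul_apply, hu, map_zero]
      | mem u hu =>
        rcases hu with ⟨x, m, hm, rfl⟩ | rfl
        · rw [UniversalEnvelopingAlgebra.lift_ι_apply]
          exact (fieldActionLin_loop κ x m _).trans (fieldProd_idField _ m hm)
        · rw [map_sub, UniversalEnvelopingAlgebra.lift_ι_apply, map_one, LinearMap.sub_apply]
          exact sub_eq_zero.2 (fieldActionLin_central κ _))

instance : VertexStructure (UnivAffine κ) where
  vac := vacuum κ
  Y := stateField κ

/-- `Y |0⟩` is the identity field. -/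
theorem stateField_vacuum : stateField κ (vacuum κ) = idField (UnivAffine κ) := by
  change UniversalEnvelopingAlgebra.lift ℂ (fieldAction κ) 1 (idField (UnivAffine κ)) = _
  rw [map_one]
  rfl

/-- `Y (x t^m v) = x(z)_{(m)} Y v`. -/
theorem stateField_act (x : g) (m : ℤ) (v : UnivAffine κ) :
    stateField κ (act κ (loopElt κ x m) v) = fieldProd (current κ x) m (stateField κ v) := by
  obtain ⟨u, rfl⟩ := Submodule.Quotient.mk_surjective (vacuumIdeal κ) v
  change UniversalEnvelopingAlgebra.lift ℂ (fieldAction κ)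
    (UniversalEnvelopingAlgebra.ι ℂ (loopElt κ x m) * u) (idField (UnivAffine κ)) = _
  rw [map_mul, Module.End.mul_apply, UniversalEnvelopingAlgebra.lift_ι_apply]
  exact fieldActionLin_loop κ x m _

end UnivAffine

end Affine
section VertexAlgebras

variable {V : Type*} [AddCommGroup V] [Module ℂ V]

/-- The `n`-th product `a_{(n)} b`. -/
def nthProd [VertexStructure V] (a : V) (n : ℤ) (b : V) : V := ((VertexStructure.Y a)[[n]]) b

/-- The translation operator `∂ a = a_{(-2)} |0⟩`. -/
def translation [VertexStructure V] (a : V) : V := nthProd a (-2) VertexStructure.vac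

/-- A vertex subalgebra: a subspace containing the vacuum and closed under all `n`-th products. -/
structure VertexSubalgebra (V : Type*) [AddCommGroup V] [Module ℂ V] [VertexStructure V] extends
    Submodule ℂ V where
  vac_mem : VertexStructure.vac ∈ carrier
  nthProd_mem : ∀ {a b : V} (n : ℤ), a ∈ carrier → b ∈ carrier → nthProd a n b ∈ carrier

/-- The smallest vertex subalgebra containing `X`. -/
def VertexSubalgebra.generate [VertexStructure V] (X : Set V) : VertexSubalgebra V where
  toSubmodule := sInf {S | ∃ U : VertexSubalgebra V, U.toSubmodule = S ∧ X ⊆ (S : Set V)}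
  vac_mem := by
    simp only [AddSubsemigroup.mem_carrier, AddSubmonoid.mem_toSubsemigroup,
      Submodule.mem_toAddSubmonoid, Submodule.mem_sInf]
    rintro S ⟨U, rfl, -⟩
    exact U.vac_mem
  nthProd_mem := by
    intro a b n ha hb
    simp only [AddSubsemigroup.mem_carrier, AddSubmonoid.mem_toSubsemigroup,
      Submodule.mem_toAddSubmonoid, Submodule.mem_sInf] at ha hb ⊢
    rintro S ⟨U, rfl, hX⟩
    exact U.nthProd_mem n (ha _ ⟨U, rfl, hX⟩) (hb _ ⟨U, rfl, hX⟩)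

theorem VertexSubalgebra.subset_generate [VertexStructure V] (X : Set V) :
    X ⊆ ((VertexSubalgebra.generate X).toSubmodule : Set V) := by
  intro x hx
  simp only [generate, SetLike.mem_coe, Submodule.mem_sInf]
  rintro S ⟨U, rfl, hX⟩
  exact hX hx

/-- The vertex algebra structure of a vertex subalgebra, by restriction. -/
instance VertexSubalgebra.instVertexStructure [VertexStructure V] (S : VertexSubalgebra V) :
    VertexStructure S.toSubmodule where
  vac := ⟨VertexStructure.vac, S.vac_mem⟩
  Y :=
    { toFun := fun a => mkField
        (fun n => ((VertexStructure.Y (a : V))[[n]]).restrict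
          (fun b hb => S.nthProd_mem n a.2 hb))
        (by
          intro b
          obtain ⟨N, hN⟩ := ncoeff_eventually_zero (VertexStructure.Y (a : V)) (b : V)
          exact ⟨N, fun m hm => Subtype.ext (hN m hm)⟩)
      map_add' := by
        intro a b
        apply field_ext
        intro m v
        simp only [map_add, Pi.add_apply, LinearMap.add_apply, mkField_ncoeff]
        apply Subtype.ext
        simp
        rfl
      map_smul' := by
        intro c a
        apply field_ext
        intro m v
        simp only [map_smul, Pi.smul_apply, LinearMap.smul_apply, mkField_ncoeff,
          RingHom.id_apply]
        apply Subtype.ext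
        simp
        rfl }

@[simp]
theorem VertexSubalgebra.coe_nthProd [VertexStructure V] (S : VertexSubalgebra V)
    (a b : S.toSubmodule) (n : ℤ) :
    ((nthProd a n b : S.toSubmodule) : V) = nthProd (a : V) n (b : V) := by
  refine congrArg Subtype.val (congrArg (fun F => F b) (mkField_ncoeff (V := S.toSubmodule) _ ?_ n))

/-- A homomorphism of vertex algebras: a linear map preserving the vacuum and all `n`-th
products. -/
structure VertexHom (V W : Type*) [AddCommGroup V] [Module ℂ V] [VertexStructure V]
    [AddCommGroup W] [Module ℂ W] [VertexStructure W] extends V →ₗ[ℂ] W where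
  map_vac : toFun VertexStructure.vac = VertexStructure.vac
  map_nthProd : ∀ (a b : V) (n : ℤ), toFun (nthProd a n b) = nthProd (toFun a) n (toFun b)

/-- The vectors `a¹_{(-n₁-1)} ⋯ aʳ_{(-n_r-1)} |0⟩` with `aⁱ ∈ X` and `nᵢ ≥ 0`. -/
inductive StrongWord [VertexStructure V] (X : Set V) : V → Prop
  | vac : StrongWord X VertexStructure.vac
  | cons (a : V) (n : ℕ) (v : V) (ha : a ∈ X) (hv : StrongWord X v) :
      StrongWord X (nthProd a (-(n : ℤ) - 1) v)

/-- `X` is a set of strong generators of the vertex subalgebra `S`: it lies in `S`, and `S` is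
spanned by the vectors `a¹_{(-n₁-1)} ⋯ aʳ_{(-n_r-1)} |0⟩` with `aⁱ ∈ X` and `nᵢ ≥ 0`. -/
def StronglyGenerates [VertexStructure V] (X : Set V) (S : VertexSubalgebra V) : Prop :=
  X ⊆ (S.toSubmodule : Set V) ∧ Submodule.span ℂ {v | StrongWord X v} = S.toSubmodule

end VertexAlgebras

section Tensor

variable {V W : Type*} [AddCommGroup V] [Module ℂ V] [AddCommGroup W] [Module ℂ W]

theorem tensor_bounds (A : VertexOperator ℂ V) (B : VertexOperator ℂ W) (w : V ⊗[ℂ] W) :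
    ∃ N : ℕ, ∀ i j : ℤ, (N : ℤ) ≤ i ∨ (N : ℤ) ≤ j →
      TensorProduct.map (A[[i]]) (B[[j]]) w = 0 := by
  induction w using TensorProduct.induction_on with
  | zero => exact ⟨0, fun i j _ => map_zero _⟩
  | tmul v w =>
    obtain ⟨N, hN⟩ := ncoeff_eventually_zero A v
    obtain ⟨M, hM⟩ := ncoeff_eventually_zero B w
    refine ⟨N + M, fun i j hij => ?_⟩
    rw [TensorProduct.map_tmul]
    rcases hij with h | h
    · rw [hN _ (by omega), TensorProduct.zero_tmul]
    · rw [hM _ (by omega), TensorProduct.tmul_zero]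
  | add u v hu hv =>
    obtain ⟨N, hN⟩ := hu
    obtain ⟨M, hM⟩ := hv
    refine ⟨N + M, fun i j hij => ?_⟩
    rw [map_add, hN _ _ (by omega), hM _ _ (by omega), add_zero]

theorem tensor_finite (A : VertexOperator ℂ V) (B : VertexOperator ℂ W) (n : ℤ) (w : V ⊗[ℂ] W) :
    (Function.support fun i : ℤ => TensorProduct.map (A[[i]]) (B[[n - 1 - i]]) w).Finite := by
  obtain ⟨N, hN⟩ := tensor_bounds A B w
  apply (Set.finite_Icc (n - 1 - N) (N : ℤ)).subset
  intro i hi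
  by_contra hc
  rw [Set.mem_Icc] at hc
  exact hi (hN _ _ (by omega))

/-- The field `A(z) ⊗ B(z)` on `V ⊗ W`, with modes `(A ⊗ B)_n = ∑_i A_i ⊗ B_{n-1-i}`. -/
def tensorField (A : VertexOperator ℂ V) (B : VertexOperator ℂ W) : VertexOperator ℂ (V ⊗[ℂ] W) :=
  mkField
    (fun n =>
      { toFun := fun w => ∑ᶠ i : ℤ, TensorProduct.map (A[[i]]) (B[[n - 1 - i]]) w
        map_add' := by
          intro v w
          simp only [map_add]
          exact finsum_add_distrib (tensor_finite A B n v) (tensor_finite A B n w)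
        map_smul' := by
          intro c v
          simp only [map_smul, RingHom.id_apply, smul_finsum] })
    (by
      intro w
      obtain ⟨N, hN⟩ := tensor_bounds A B w
      refine ⟨N + N, fun n hn => ?_⟩
      apply finsum_eq_zero_of_forall_eq_zero
      intro i
      exact hN _ _ (by omega))

theorem tensorField_apply (A : VertexOperator ℂ V) (B : VertexOperator ℂ W) (n : ℤ)
    (w : V ⊗[ℂ] W) :
    ((tensorField A B)[[n]]) w = ∑ᶠ i : ℤ, TensorProduct.map (A[[i]]) (B[[n - 1 - i]]) w := by
  rw [tensorField, mkField_ncoeff]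
  rfl

/-- `tensorField` as a bilinear map. -/
def tensorFieldLin : VertexOperator ℂ V →ₗ[ℂ] VertexOperator ℂ W →ₗ[ℂ]
    VertexOperator ℂ (V ⊗[ℂ] W) :=
  LinearMap.mk₂ ℂ tensorField
    (by
      intro A A' B
      apply field_ext
      intro n w
      simp only [map_add, Pi.add_apply, LinearMap.add_apply, tensorField_apply,
        TensorProduct.map_add_left]
      exact finsum_add_distrib (tensor_finite A B n w) (tensor_finite A' B n w))
    (by
      intro c A B
      apply field_ext
      intro n w
      simp only [map_smul, Pi.smul_apply, LinearMap.smul_apply, tensorField_apply,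
        TensorProduct.map_smul_left, smul_finsum])
    (by
      intro A B B'
      apply field_ext
      intro n w
      simp only [map_add, Pi.add_apply, LinearMap.add_apply, tensorField_apply,
        TensorProduct.map_add_right]
      exact finsum_add_distrib (tensor_finite A B n w) (tensor_finite A B' n w))
    (by
      intro c A B
      apply field_ext
      intro n w
      simp only [map_smul, Pi.smul_apply, LinearMap.smul_apply, tensorField_apply,
        TensorProduct.map_smul_right, smul_finsum])

/-- The tensor product of vertex algebras: the vacuum is `|0⟩ ⊗ |0⟩` and
`Y(a ⊗ b, z) = Y(a, z) ⊗ Y(b, z)`. -/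
instance [VertexStructure V] [VertexStructure W] : VertexStructure (V ⊗[ℂ] W) where
  vac := VertexStructure.vac ⊗ₜ VertexStructure.vac
  Y := TensorProduct.lift (tensorFieldLin.compl₁₂ VertexStructure.Y VertexStructure.Y)

theorem nthProd_tmul [VertexStructure V] [VertexStructure W] (a c : V) (b d : W) (n : ℤ) :
    nthProd (a ⊗ₜ[ℂ] b) n (c ⊗ₜ[ℂ] d) =
      ∑ᶠ i : ℤ, nthProd a i c ⊗ₜ[ℂ] nthProd b (n - 1 - i) d := by
  change ((tensorField _ _)[[n]]) _ = _
  rw [tensorField_apply]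
  rfl

end Tensor

section Rectangular

attribute [local instance] LieRing.ofAssociativeRing

/-- The inner product `κ(x, y) = α tr(xy) + tr(x) tr(y)` on `gl(n)`. -/
def glForm (n : ℕ) (α : ℂ) : InvForm (Matrix (Fin n) (Fin n) ℂ) where
  form := LinearMap.mk₂ ℂ (fun x y => α * (x * y).trace + x.trace * y.trace)
    (by intro x x' y; simp only [add_mul, Matrix.trace_add]; ring)
    (by intro c x y; simp only [Matrix.smul_mul, Matrix.trace_smul, smul_eq_mul]; ring)
    (by intro x y y'; simp only [mul_add, Matrix.trace_add]; ring)
    (by intro c x y; simp only [Matrix.mul_smul, Matrix.trace_smul, smul_eq_mul]; ring)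
  isSymm := by
    constructor
    intro x y
    simp only [LinearMap.mk₂_apply]
    rw [Matrix.trace_mul_comm]
    ring
  invariant := by
    intro x y z
    simp only [LinearMap.mk₂_apply, Ring.lie_def, sub_mul, mul_sub, Matrix.trace_sub]
    rw [Matrix.trace_mul_comm x y, Matrix.trace_mul_comm x z, mul_assoc x y z, mul_assoc y x z,
      Matrix.trace_mul_comm x (y * z), mul_assoc y z x]
    ring

/-- The Kronecker delta. -/
def delta {n : ℕ} (i j : Fin n) : ℂ := if i = j then 1 else 0

/-- On matrix units, `κ(e_{ij}, e_{pq}) = δ_{jp} δ_{iq} α + δ_{ij} δ_{pq}`. -/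
theorem glForm_single (n : ℕ) (α : ℂ) (i j p q : Fin n) :
    (glForm n α).form (Matrix.single i j 1) (Matrix.single p q 1) =
      delta j p * delta i q * α + delta i j * delta p q := by
  simp only [glForm, LinearMap.mk₂_apply, delta]
  by_cases h₁ : j = p
  · subst h₁
    by_cases h₂ : i = q <;> by_cases h₃ : i = j <;> by_cases h₄ : j = q <;>
      simp_all [Matrix.trace_single_eq_of_ne, Matrix.trace_single_eq_same]
  · by_cases h₃ : i = j <;> by_cases h₄ : p = q <;>
      simp_all [Matrix.trace_single_eq_of_ne, Matrix.trace_single_eq_same]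

/-- The vertex algebra `V^κ(gl(n))`. -/
abbrev AffGL (n : ℕ) (α : ℂ) : Type := UnivAffine (glForm n α)

/-- The vertex algebra `V^κ(gl(n))^{⊗ 2}`. -/
abbrev AffGL2 (n : ℕ) (α : ℂ) : Type := AffGL n α ⊗[ℂ] AffGL n α

/-- The vector `e_{ij}[m] = e_{ij} t^m |0⟩` of `V^κ(gl(n))`. -/
def unitVec {n : ℕ} (α : ℂ) (i j : Fin n) (m : ℤ) : AffGL n α :=
  UnivAffine.act (glForm n α) (loopElt (glForm n α) (Matrix.single i j 1) m) VertexStructure.vac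

/-- `W^{(1)}_{ij} = e^{(1)}_{ij}[-1] + e^{(2)}_{ij}[-1]`. -/
def W1 {n : ℕ} (α : ℂ) (i j : Fin n) : AffGL2 n α :=
  unitVec α i j (-1) ⊗ₜ VertexStructure.vac + VertexStructure.vac ⊗ₜ unitVec α i j (-1)

/-- `W^{(2)}_{ij} = ∑_u e^{(1)}_{uj}[-1] e^{(2)}_{iu}[-1] - α e^{(1)}_{ij}[-2]`. -/
def W2 {n : ℕ} (α : ℂ) (i j : Fin n) : AffGL2 n α :=
  ∑ u : Fin n, unitVec α u j (-1) ⊗ₜ[ℂ] unitVec α i u (-1) - α • (unitVec α i j (-2) ⊗ₜ[ℂ] VertexStructure.vac)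

/-- The set of all `W^{(1)}_{ij}` and `W^{(2)}_{ij}`. -/
def generators (n : ℕ) (α : ℂ) : Set (AffGL2 n α) :=
  {w | ∃ i j : Fin n, w = W1 α i j ∨ w = W2 α i j}

/-- The rectangular `W`-algebra `W^k(gl(2n), (2^n))`, realized inside `V^κ(gl(n))^{⊗ 2}` with
`α = k + n` as the vertex subalgebra generated by the `W^{(1)}_{ij}` and `W^{(2)}_{ij}`. -/
def rectW (n : ℕ) (k : ℂ) : VertexSubalgebra (AffGL2 n (k + n)) :=
  VertexSubalgebra.generate (generators n (k + n))

/-- The underlying space of `W^k(gl(2n), (2^n))`. -/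
abbrev RectWAlg (n : ℕ) (k : ℂ) : Type := (rectW n k).toSubmodule

/-- `W^{(1)}_{ij}` as an element of `W^k(gl(2n), (2^n))`. -/
def genW1 {n : ℕ} (k : ℂ) (i j : Fin n) : RectWAlg n k :=
  ⟨W1 (k + n) i j, VertexSubalgebra.subset_generate _ ⟨i, j, Or.inl rfl⟩⟩

/-- `W^{(2)}_{ij}` as an element of `W^k(gl(2n), (2^n))`. -/
def genW2 {n : ℕ} (k : ℂ) (i j : Fin n) : RectWAlg n k :=
  ⟨W2 (k + n) i j, VertexSubalgebra.subset_generate _ ⟨i, j, Or.inr rfl⟩⟩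

end Rectangular

end RectW

end

open RectW

/-! The proof combines three things: enough calculus of fields to compute with states of the tensor
square of the affine vertex algebra, the explicit products of the generators, and an independence
statement of Poincaré–Birkhoff–Witt type, which turns equality of products into an embedding.

Calculus. A state `a` is regular when Y(a_(n) b) = Y(a)_(n) Y(b) for all `b` and Y(a) is local with
respect to every field. Two-variable distributions are handled as coefficient families:
multiplication by z - w is `tau`, the n-th product is the residue `famProd`, and applying `tau`
raises n by one. This yields the commutator formula (`sub_eq_sum_famProd`) and Dong's lemma
(`IsLocal.fieldProd`). The states x[-1] and x[-2] are regular. Regularity passes to tensor products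
(`IsRegular.tmul`): once both pairs of fields have been multiplied by a power of z - w that makes
them commute, a product becomes a residue against a derivative of the delta function, and such
residues obey a Leibniz rule. Hence W^(1) and W^(2) are regular.

Products. On a given vector, a mode of W^(2) is a finite sum of products of a current of the first
factor with a current of the second, plus one current from the derivative term (`nthProd_W2`). All
listed products then reduce to linear identities between vectors built from the e_{ij}[-m]
(`rectOPE`).

Strong generation. Give W^(1) degree 1 and W^(2) degree 2. By the commutator formula and the product
list, the commutator of two modes of generators is a combination of modes and of products of two
modes, of total degree lower by at least one (`RectOPE.isWordSystem`). Annihilation modes can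
therefore be pushed to the vacuum, and words in creation modes span the generated subalgebra.
Reordering a word changes it only by words of lower degree, so one word per multiset of letters
suffices.

Independence. Words attached to distinct multisets are linearly independent
(`linearIndependent_words`). The vacuum module is mapped to the enveloping algebra of t^{-1}
gl(n)[t^{-1}] by an explicit induced module structure, and that algebra acts by derivations on
polynomial functions of a loop matrix. Applying a word to the d-th power of the trace of the
constant coefficient, and then setting that coefficient to zero, reads off its degree d symbol. The
symbols of the creation modes of W^(1) and W^(2) are the entries of the coefficients of A + B and
BA, for two power series matrices A and B with independent entries. At the point A = 0, B = 1 the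
differential of (A, B) ↦ (A + B, BA) is (A, B) ↦ (A + B, A), which is invertible, so these symbols
are algebraically independent.

Embedding. The product list involves only α and Kronecker deltas, and (k + 1) + n = k + (n + 1). So
the generators of the small algebra and the generators of the large one with indices at most n obey
the same list, and so do the pairs formed from them in the direct product of the ambient algebras.
The subalgebra generated by the pairs is spanned by words indexed by multisets, and both projections
send these words to independent families. Hence both projections are injective, the first is onto
the small algebra, and the second composed with the inverse of the first is the required
homomorphism (`exists_vertexHom_of_isWordSystem`). -/

noncomputable section

namespace RectW

open scoped TensorProduct VertexOperator

set_option linter.unusedSectionVars false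

/-! ### Two-variable formal distributions, residues and the commutator formula. -/

section Families

variable {E : Type*} [AddCommGroup E] [Module ℂ E]

/-- Multiplication of the two-variable formal distribution `∑ K p q z^{-p-1} w^{-q-1}` by
`z - w`. -/
def tau : Module.End ℂ (ℤ → ℤ → E) where
  toFun K p q := K (p + 1) q - K p (q + 1)
  map_add' K L := by funext p q; simp only [Pi.add_apply]; abel
  map_smul' c K := by funext p q; simp only [Pi.smul_apply, smul_sub, RingHom.id_apply]

theorem tau_apply (K : ℤ → ℤ → E) (p q : ℤ) : tau K p q = K (p + 1) q - K p (q + 1) := rfl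

theorem tau_pow_succ (N : ℕ) (K : ℤ → ℤ → E) : (tau ^ (N + 1)) K = (tau ^ N) (tau K) := by
  rw [pow_succ, Module.End.mul_apply]

/-- `K p q` vanishes for large `q`, uniformly in `p`. -/
def TruncR (K : ℤ → ℤ → E) : Prop := ∃ Q : ℤ, ∀ p q, Q ≤ q → K p q = 0

/-- `K p q` vanishes for large `p`, uniformly in `q`. -/
def TruncL (K : ℤ → ℤ → E) : Prop := ∃ P : ℤ, ∀ p q, P ≤ p → K p q = 0

theorem TruncR.tau {K : ℤ → ℤ → E} (h : TruncR K) : TruncR (tau K) := by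
  obtain ⟨Q, h⟩ := h
  exact ⟨Q, fun p q hq => by rw [tau_apply, h _ _ hq, h _ _ (by omega), sub_zero]⟩

theorem TruncL.tau {K : ℤ → ℤ → E} (h : TruncL K) : TruncL (tau K) := by
  obtain ⟨Q, h⟩ := h
  exact ⟨Q, fun p q hq => by rw [tau_apply, h _ _ hq, h _ _ (by omega), sub_zero]⟩

theorem TruncR.tau_pow {K : ℤ → ℤ → E} (h : TruncR K) (N : ℕ) : TruncR ((RectW.tau ^ N) K) := by
  induction N generalizing K with
  | zero => exact h
  | succ N ih => rw [tau_pow_succ]; exact ih h.tau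

theorem TruncL.tau_pow {K : ℤ → ℤ → E} (h : TruncL K) (N : ℕ) : TruncL ((RectW.tau ^ N) K) := by
  induction N generalizing K with
  | zero => exact h
  | succ N ih => rw [tau_pow_succ]; exact ih h.tau

theorem TruncR.add {K L : ℤ → ℤ → E} (h : TruncR K) (h' : TruncR L) : TruncR (K + L) := by
  obtain ⟨Q, h⟩ := h
  obtain ⟨Q', h'⟩ := h'
  exact ⟨max Q Q', fun p q hq => by
    simp only [Pi.add_apply]; rw [h _ _ (by omega), h' _ _ (by omega), add_zero]⟩

theorem TruncL.add {K L : ℤ → ℤ → E} (h : TruncL K) (h' : TruncL L) : TruncL (K + L) := by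
  obtain ⟨Q, h⟩ := h
  obtain ⟨Q', h'⟩ := h'
  exact ⟨max Q Q', fun p q hq => by
    simp only [Pi.add_apply]; rw [h _ _ (by omega), h' _ _ (by omega), add_zero]⟩

theorem TruncR.smul {K : ℤ → ℤ → E} (h : TruncR K) (c : ℂ) : TruncR (c • K) := by
  obtain ⟨Q, h⟩ := h
  exact ⟨Q, fun p q hq => by simp only [Pi.smul_apply]; rw [h _ _ hq, smul_zero]⟩

theorem TruncL.smul {K : ℤ → ℤ → E} (h : TruncL K) (c : ℂ) : TruncL (c • K) := by
  obtain ⟨Q, h⟩ := h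
  exact ⟨Q, fun p q hq => by simp only [Pi.smul_apply]; rw [h _ _ hq, smul_zero]⟩

theorem bc_zero_right (n : ℤ) : bc n 0 = 1 := by simp [bc]

theorem bc_zero_left (l : ℕ) : bc 0 l = if l = 0 then 1 else 0 := by
  cases l with
  | zero => simp [bc]
  | succ l => simp [bc, Ring.choose_zero_succ]

theorem bc_succ_succ (n : ℤ) (l : ℕ) : bc (n + 1) (l + 1) = bc n (l + 1) - bc n l := by
  simp only [bc, Ring.choose_succ_succ, pow_succ]
  push_cast
  ring

theorem sum_bc_succ (n : ℤ) (f : ℕ → E) (N : ℕ) :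
    ∑ l ∈ Finset.range (N + 1), bc (n + 1) l • f l =
      ∑ l ∈ Finset.range (N + 1), bc n l • f l - ∑ l ∈ Finset.range N, bc n l • f (l + 1) := by
  rw [Finset.sum_range_succ', Finset.sum_range_succ' (fun l => bc n l • f l)]
  simp only [bc_succ_succ, sub_smul, Finset.sum_sub_distrib, bc_zero_right]
  abel

/-- The first half of `famProd`. -/
def famLeft (n : ℤ) (K : ℤ → ℤ → E) (m : ℤ) : E := ∑ᶠ l : ℕ, bc n l • K (n - l) (m + l)

/-- The second half of `famProd`. -/
def famRight (n : ℤ) (L : ℤ → ℤ → E) (m : ℤ) : E :=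
  ∑ᶠ l : ℕ, (bc n l * (-1) ^ n) • L l (n + m - l)

/-- The `m`-th mode of the residue in `z` of `(z - w)^n K(z, w)`, expanded in `|z| > |w|`, minus
`(z - w)^n L(z, w)`, expanded in `|w| > |z|`. -/
def famProd (n : ℤ) (K L : ℤ → ℤ → E) (m : ℤ) : E := famLeft n K m - famRight n L m

theorem famLeft_range {K : ℤ → ℤ → E} (n m : ℤ) {N : ℕ} (h : ∀ l : ℕ, N ≤ l → K (n - l) (m + l) = 0) :
    famLeft n K m = ∑ l ∈ Finset.range N, bc n l • K (n - l) (m + l) :=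
  finsum_eq_range fun l hl => by rw [h l hl, smul_zero]

theorem famRight_range {L : ℤ → ℤ → E} (n m : ℤ) {N : ℕ} (h : ∀ l : ℕ, N ≤ l → L l (n + m - l) = 0) :
    famRight n L m = ∑ l ∈ Finset.range N, (bc n l * (-1) ^ n) • L l (n + m - l) :=
  finsum_eq_range fun l hl => by rw [h l hl, smul_zero]

theorem TruncR.exists_range {K : ℤ → ℤ → E} (h : TruncR K) (n m : ℤ) :
    ∃ N₀ : ℕ, ∀ l : ℕ, N₀ ≤ l → K (n - l) (m + l) = 0 := by
  obtain ⟨Q, h⟩ := h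
  exact ⟨(Q - m).toNat, fun l hl => h _ _ (by omega)⟩

theorem TruncL.exists_range {L : ℤ → ℤ → E} (h : TruncL L) (n m : ℤ) :
    ∃ N₀ : ℕ, ∀ l : ℕ, N₀ ≤ l → L l (n + m - l) = 0 := by
  obtain ⟨Q, h⟩ := h
  exact ⟨Q.toNat, fun l hl => h _ _ (by omega)⟩

theorem famLeft_add {K K' : ℤ → ℤ → E} (h : TruncR K) (h' : TruncR K') (n m : ℤ) :
    famLeft n (K + K') m = famLeft n K m + famLeft n K' m := by
  obtain ⟨N, hN⟩ := h.exists_range n m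
  obtain ⟨N', hN'⟩ := h'.exists_range n m
  rw [famLeft_range (N := N + N'), famLeft_range (N := N + N'), famLeft_range (N := N + N')]
  · simp only [Pi.add_apply, smul_add, Finset.sum_add_distrib]
  · exact fun l hl => hN' _ (by omega)
  · exact fun l hl => hN _ (by omega)
  · intro l hl; simp only [Pi.add_apply]; rw [hN' _ (by omega), hN _ (by omega), add_zero]

theorem famRight_add {K K' : ℤ → ℤ → E} (h : TruncL K) (h' : TruncL K') (n m : ℤ) :
    famRight n (K + K') m = famRight n K m + famRight n K' m := by
  obtain ⟨N, hN⟩ := h.exists_range n m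
  obtain ⟨N', hN'⟩ := h'.exists_range n m
  rw [famRight_range (N := N + N'), famRight_range (N := N + N'), famRight_range (N := N + N')]
  · simp only [Pi.add_apply, smul_add, Finset.sum_add_distrib]
  · exact fun l hl => hN' _ (by omega)
  · exact fun l hl => hN _ (by omega)
  · intro l hl; simp only [Pi.add_apply]; rw [hN' _ (by omega), hN _ (by omega), add_zero]

theorem famProd_add {K K' L L' : ℤ → ℤ → E} (h : TruncR K) (h' : TruncR K') (g : TruncL L)
    (g' : TruncL L') (n m : ℤ) :
    famProd n (K + K') (L + L') m = famProd n K L m + famProd n K' L' m := by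
  rw [famProd, famLeft_add h h', famRight_add g g', famProd, famProd]; abel

theorem famProd_smul (c : ℂ) (K L : ℤ → ℤ → E) (n m : ℤ) :
    famProd n (c • K) (c • L) m = c • famProd n K L m := by
  simp only [famProd, famLeft, famRight, Pi.smul_apply, smul_sub, smul_finsum]
  simp only [smul_comm c]

theorem famProd_zero (n m : ℤ) : famProd n (0 : ℤ → ℤ → E) 0 m = 0 := by
  simp [famProd, famLeft, famRight]

/-- Families that are truncated for the two expansions. -/
theorem famProd_sum {ι : Type*} (s : Finset ι) {K L : ι → ℤ → ℤ → E} (h : ∀ i, TruncR (K i))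
    (g : ∀ i, TruncL (L i)) (n m : ℤ) :
    famProd n (∑ i ∈ s, K i) (∑ i ∈ s, L i) m = ∑ i ∈ s, famProd n (K i) (L i) m ∧
      TruncR (∑ i ∈ s, K i) ∧ TruncL (∑ i ∈ s, L i) := by
  classical
  induction s using Finset.induction_on with
  | empty => exact ⟨by simpa using famProd_zero n m,
      ⟨0, fun _ _ _ => rfl⟩, ⟨0, fun _ _ _ => rfl⟩⟩
  | insert a s ha ih =>
    obtain ⟨h1, h2, h3⟩ := ih
    simp only [Finset.sum_insert ha]
    exact ⟨by rw [famProd_add (h a) h2 (g a) h3, h1], (h a).add h2, (g a).add h3⟩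

/-- A factor z - w can be absorbed into (z - w)^n. In coefficients this is Pascal's rule for the
binomial series, applied separately to the two expansions. Every later reduction from one product
index to another goes through this identity. -/
theorem famProd_tau {K L : ℤ → ℤ → E} (hK : TruncR K) (hL : TruncL L) (n m : ℤ) :
    famProd n (tau K) (tau L) m = famProd (n + 1) K L m := by
  obtain ⟨N₁, h₁⟩ := hK.exists_range (n + 1) m
  obtain ⟨N₂, h₂⟩ := hL.exists_range (n + 1) m
  obtain ⟨N₃, h₃⟩ := hK.tau.exists_range n m
  obtain ⟨N₄, h₄⟩ := hL.tau.exists_range n m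
  set N := N₁ + N₂ + N₃ + N₄ with hN
  -- The expansions of (z - w)^(n+1) are summed over one extra index: `sum_bc_succ` then leaves a
  -- full sum, whose last term vanishes, and a shifted sum of length `N`.
  rw [famProd, famProd, famLeft_range (N := N) _ _ (fun l hl => h₃ l (by omega)),
    famRight_range (N := N) _ _ (fun l hl => h₄ l (by omega)),
    famLeft_range (N := N + 1) _ _ (fun l hl => h₁ l (by omega)),
    famRight_range (N := N + 1) _ _ (fun l hl => h₂ l (by omega))]
  simp only [mul_smul, sum_bc_succ]
  rw [Finset.sum_range_succ (fun l => bc n l • K _ _),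
    Finset.sum_range_succ (fun l => bc n l • _ • L _ _), h₁ N (by omega), h₂ N (by omega)]
  simp only [tau_apply, smul_sub, Finset.sum_sub_distrib, smul_zero, add_zero]
  have hz : (-1 : ℂ) ^ (n + 1) = -(-1) ^ n := by
    rw [zpow_add_one₀ (by norm_num)]; ring
  simp only [hz, neg_smul, smul_neg, Finset.sum_neg_distrib]
  have e1 : ∀ l : ℕ, K (n - l + 1) (m + l) = K (n + 1 - l) (m + l) := fun l => by congr 1; ring
  have e2 : ∀ l : ℕ, K (n + 1 - (l + 1 : ℕ)) (m + (l + 1 : ℕ)) = K (n - l) (m + l + 1) := fun l => by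
    push_cast; congr 1 <;> ring
  have e3 : ∀ l : ℕ, L (l : ℤ) (n + m - l + 1) = L l (n + 1 + m - l) := fun l => by congr 1; ring
  have e4 : ∀ l : ℕ, L (l + 1 : ℕ) (n + 1 + m - (l + 1 : ℕ)) = L (l + 1) (n + m - l) := fun l => by
    push_cast; congr 1; ring
  simp only [e1, e2, e3, e4]
  abel

theorem famProd_tau_pow {K L : ℤ → ℤ → E} (hK : TruncR K) (hL : TruncL L) (n m : ℤ) (N : ℕ) :
    famProd n ((tau ^ N) K) ((tau ^ N) L) m = famProd (n + N) K L m := by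
  induction N generalizing K L with
  | zero => simp
  | succ N ih =>
    rw [tau_pow_succ, tau_pow_succ, ih hK.tau hL.tau, famProd_tau hK hL]
    push_cast
    congr 1
    ring

theorem famProd_zero_index (K L : ℤ → ℤ → E) (m : ℤ) : famProd 0 K L m = K 0 m - L 0 m := by
  have key : ∀ f : ℕ → E, ∑ᶠ l : ℕ, bc 0 l • f l = f 0 := fun f => by
    rw [finsum_eq_single _ 0 (fun l hl => by rw [bc_zero_left, if_neg hl, zero_smul]),
      bc_zero_right, one_smul]
  rw [famProd, famLeft, famRight, key]
  simp only [mul_smul]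
  rw [key]
  simp

/-- For a nonnegative exponent the power of z - w has only one expansion, so just the difference K -
L enters. Removing j factors z - w brings the exponent to 0, where the residue is a single
coefficient. -/
theorem famProd_natCast {K L : ℤ → ℤ → E} (hK : TruncR K) (hL : TruncL L) (j : ℕ) (m : ℤ) :
    famProd j K L m = (tau ^ j) (K - L) 0 m := by
  have := famProd_tau_pow hK hL 0 m j
  rw [zero_add] at this
  rw [← this, famProd_zero_index, map_sub]
  rfl

theorem tau_pow_eq_of_le {K L : ℤ → ℤ → E} {N N' : ℕ} (h : (tau ^ N) K = (tau ^ N) L)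
    (hN : N ≤ N') : (tau ^ N') K = (tau ^ N') L := by
  obtain ⟨d, rfl⟩ := Nat.exists_eq_add_of_le' hN
  rw [pow_add, Module.End.mul_apply, h, Module.End.mul_apply]

theorem famProd_eq_zero {K L : ℤ → ℤ → E} (hK : TruncR K) (hL : TruncL L) {N : ℕ}
    (h : (tau ^ N) K = (tau ^ N) L) {n : ℤ} (hn : N ≤ n) (m : ℤ) : famProd n K L m = 0 := by
  obtain ⟨j, rfl⟩ := Int.eq_ofNat_of_zero_le (show 0 ≤ n by omega)
  have := tau_pow_eq_of_le h (N' := j) (by omega)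
  rw [famProd_natCast hK hL, map_sub, this, sub_self]; rfl

/-- Newton interpolation: along a line m + n = const, `tau` is the forward difference in m, so a
family killed by its N-th power is a polynomial of degree less than N in m. Both sides satisfy
F(m+1, n) = F(m, n+1) + (tau Q)(m, n) and agree at m = 0, hence agree for all integers m. -/
theorem newton_of_tau_pow (N : ℕ) (Q : ℤ → ℤ → E) (h : (tau ^ N) Q = 0) (m n : ℤ) :
    Q m n = ∑ j ∈ Finset.range N, ((Ring.choose m j : ℤ) : ℂ) • (tau ^ j) Q 0 (m + n - j) := by
  induction N generalizing Q m n with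
  | zero => rw [show Q = 0 from h]; simp
  | succ N ih =>
    rw [tau_pow_succ] at h
    set R : ℤ → ℤ → E := fun m n =>
      ∑ j ∈ Finset.range (N + 1), ((Ring.choose m j : ℤ) : ℂ) • (tau ^ j) Q 0 (m + n - j) with hR
    have hrec : ∀ m n, R (m + 1) n = R m (n + 1) + tau Q m n := by
      intro m n
      rw [ih (tau Q) h m n]
      simp only [hR]
      rw [Finset.sum_range_succ', Finset.sum_range_succ']
      simp only [Ring.choose_succ_succ, ← tau_pow_succ, Int.cast_add, add_smul,
        Finset.sum_add_distrib, Ring.choose_zero_right]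
      have e1 : ∀ j : ℕ, m + 1 + n - (j + 1 : ℕ) = m + n - j := fun j => by push_cast; ring
      have e2 : ∀ j : ℕ, m + (n + 1) - (j + 1 : ℕ) = m + n - j := fun j => by push_cast; ring
      have e3 : m + 1 + n - (0 : ℕ) = m + (n + 1) - (0 : ℕ) := by push_cast; ring
      simp only [e1, e2, e3]
      abel
    have hQ : ∀ m n, Q (m + 1) n = Q m (n + 1) + tau Q m n := fun m n => by rw [tau_apply]; abel
    have h0 : ∀ n, Q 0 n = R 0 n := by
      intro n
      simp only [hR]
      rw [Finset.sum_range_succ', Finset.sum_eq_zero]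
      · simp
      · intro j _
        simp [Ring.choose_zero_succ]
    change Q m n = R m n
    induction m using Int.induction_on generalizing n with
    | zero => exact h0 n
    | succ i hi => rw [hQ, hrec, hi]
    | pred i hi =>
      have h1 := hQ (-i - 1) (n - 1)
      have h2 := hrec (-i - 1) (n - 1)
      simp only [sub_add_cancel] at h1 h2
      rw [hi, h2] at h1
      exact (add_right_cancel h1).symm

/-- The commutator formula for a pair of families that agree after multiplication by a power of
`z - w`. -/
theorem sub_eq_sum_famProd {K L : ℤ → ℤ → E} (hK : TruncR K) (hL : TruncL L) {N : ℕ}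
    (h : (tau ^ N) K = (tau ^ N) L) (m n : ℤ) :
    K m n - L m n = ∑ j ∈ Finset.range N, ((Ring.choose m j : ℤ) : ℂ) • famProd j K L (m + n - j) := by
  have := newton_of_tau_pow N (K - L) (by rw [map_sub, h, sub_self]) m n
  simp only [famProd_natCast hK hL]
  exact this

end Families

/-! ### Residues against derivatives of the delta function. -/

section Delta

variable {E : Type*} [AddCommGroup E] [Module ℂ E]

theorem bc_neg (j l : ℕ) : bc (-1 - j) l = ((l + j).choose j : ℂ) := by
  induction j generalizing l with
  | zero =>
    induction l with
    | zero => simp [bc]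
    | succ l ih =>
      have := bc_succ_succ (-1) l
      rw [show (-1 : ℤ) + 1 = 0 by norm_num, bc_zero_left] at this
      simp only [Nat.cast_zero, sub_zero] at ih ⊢
      simp only [Nat.add_eq_zero_iff, one_ne_zero, and_false, if_false] at this
      rw [← sub_eq_zero.1 this.symm] at ih
      simpa using ih
  | succ j ih =>
    induction l with
    | zero => simp [bc]
    | succ l ihl =>
      have := bc_succ_succ (-1 - (j + 1 : ℕ)) l
      rw [show (-1 : ℤ) - (j + 1 : ℕ) + 1 = -1 - j by push_cast; ring, ih, ihl] at this
      have h2 : bc (-1 - (j + 1 : ℕ)) (l + 1) =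
          ((l + 1 + j).choose j : ℂ) + ((l + (j + 1)).choose (j + 1) : ℂ) := by
        linear_combination -this
      rw [h2, show l + 1 + (j + 1) = (l + j + 1) + 1 by ring, Nat.choose_succ_succ,
        show l + 1 + j = l + j + 1 by ring, show l + (j + 1) = l + j + 1 by ring]
      push_cast
      ring

theorem choose_neg_sub_one (j l : ℕ) :
    ((Ring.choose (-1 - l : ℤ) j : ℤ) : ℂ) = (-1) ^ j * ((l + j).choose j : ℂ) := by
  have h := bc_neg l j
  rw [bc] at h
  have h2 : ((-1 : ℂ) ^ j) * (-1) ^ j = 1 := by rw [← mul_pow]; simp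
  have h3 : ((j + l).choose l : ℂ) = (l + j).choose j := by
    rw [add_comm j l, Nat.choose_symm_add]
  rw [← h3, ← h, ← mul_assoc, h2, one_mul]

/-- The residue of `G(z, w)` against the difference of the two expansions of `(z - w)^{-1-j}`. -/
theorem famProd_neg {G : ℤ → ℤ → E} (hR : TruncR G) (hL : TruncL G) (j : ℕ) (m : ℤ) :
    famProd (-1 - j) G G m =
      ∑ᶠ p : ℤ, ((Ring.choose p j : ℤ) : ℂ) • G (-p - 1) (m + p - j) := by
  obtain ⟨N₁, h₁⟩ := hR.exists_range (-1 - j) m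
  obtain ⟨N₂, h₂⟩ := hL.exists_range (-1 - j) m
  set N := N₁ + N₂ with hN
  rw [famProd, famLeft_range (N := N) _ _ (fun l hl => h₁ l (by omega)),
    famRight_range (N := N) _ _ (fun l hl => h₂ l (by omega))]
  -- The expansion in |z| > |w| supplies the exponents p = l + j and the other one supplies p = -1 -
  -- l. The remaining exponents 0 ≤ p < j have binomial coefficient zero.
  obtain ⟨f, hf⟩ : ∃ f : ℕ ↪ ℤ, ∀ l, f l = l + j :=
    ⟨⟨fun l => l + j, fun a b h => by simpa using h⟩, fun _ => rfl⟩
  obtain ⟨g, hg⟩ : ∃ g : ℕ ↪ ℤ, ∀ l, g l = -1 - l :=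
    ⟨⟨fun l => -1 - l, fun a b h => by simpa using h⟩, fun _ => rfl⟩
  have hdisj : Disjoint ((Finset.range N).map f) ((Finset.range N).map g) := by
    rw [Finset.disjoint_left]
    intro x hx hy
    simp only [Finset.mem_map, Finset.mem_range, hf, hg] at hx hy
    obtain ⟨a, -, rfl⟩ := hx
    obtain ⟨b, -, hb⟩ := hy
    omega
  rw [finsum_eq_sum_of_support_subset (s := (Finset.range N).map f ∪ (Finset.range N).map g),
    Finset.sum_union hdisj, Finset.sum_map, Finset.sum_map, sub_eq_add_neg,
    ← Finset.sum_neg_distrib]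
  · congr 1
    · apply Finset.sum_congr rfl
      intro l _
      rw [hf]
      rw [bc_neg, ← Nat.cast_add, Ring.choose_natCast]
      congr 2
      · push_cast; ring
      · push_cast; ring
    · apply Finset.sum_congr rfl
      intro l _
      rw [hg]
      rw [choose_neg_sub_one, bc_neg, ← neg_smul]
      have hz : -((-1 : ℂ) ^ (-1 - (j : ℤ))) = (-1) ^ j := by
        rw [zpow_sub₀ (by norm_num), zpow_natCast]
        rcases Nat.even_or_odd j with h | h <;> simp [h.neg_one_pow]
      congr 2
      · rw [← mul_neg, hz, mul_comm]
      · ring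
      · ring
  · intro p hp
    rw [Function.mem_support] at hp
    simp only [Finset.coe_union, Finset.coe_map, Set.mem_union, Set.mem_image, Finset.coe_range,
      Set.mem_Iio, hf, hg]
    by_cases hp0 : 0 ≤ p
    · left
      obtain ⟨a, rfl⟩ := Int.eq_ofNat_of_zero_le hp0
      have haj : j ≤ a := by
        by_contra hc
        apply hp
        rw [Ring.choose_natCast, Nat.choose_eq_zero_of_lt (by omega)]
        simp
      refine ⟨a - j, ?_, by omega⟩
      by_contra hc
      apply hp
      have := h₁ (a - j) (by omega)
      rw [show (-1 : ℤ) - j - (a - j : ℕ) = -a - 1 by omega,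
        show m + ((a - j : ℕ) : ℤ) = m + a - j by omega] at this
      rw [this, smul_zero]
    · right
      refine ⟨(-1 - p).toNat, ?_, by omega⟩
      by_contra hc
      apply hp
      have := h₂ (-1 - p).toNat (by omega)
      rw [show (((-1 - p).toNat : ℕ) : ℤ) = -p - 1 by omega,
        show -1 - (j : ℤ) + m - (-p - 1) = m + p - j by ring] at this
      rw [this, smul_zero]

end Delta

/-! ### Locality of fields. -/

section Local

variable {V : Type*} [AddCommGroup V] [Module ℂ V]

/-- `A(z) B(w) v`. -/
def prodFam (A B : VertexOperator ℂ V) (v : V) : ℤ → ℤ → V := fun p q => (A[[p]]) ((B[[q]]) v)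

/-- `B(w) A(z) v`. -/
def prodFamOp (A B : VertexOperator ℂ V) (v : V) : ℤ → ℤ → V := fun p q => (B[[q]]) ((A[[p]]) v)

theorem truncR_prodFam (A B : VertexOperator ℂ V) (v : V) : TruncR (prodFam A B v) := by
  obtain ⟨N, h⟩ := ncoeff_eventually_zero B v
  exact ⟨N, fun p q hq => by rw [prodFam, h _ hq, map_zero]⟩

theorem truncL_prodFamOp (A B : VertexOperator ℂ V) (v : V) : TruncL (prodFamOp A B v) := by
  obtain ⟨N, h⟩ := ncoeff_eventually_zero A v
  exact ⟨N, fun p q hq => by rw [prodFamOp, h _ hq, map_zero]⟩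

theorem fieldProd_ncoeff (A B : VertexOperator ℂ V) (n m : ℤ) (v : V) :
    ((fieldProd A n B)[[m]]) v = famProd n (prodFam A B v) (prodFamOp A B v) m := by
  rw [fieldProd, map_sub, Pi.sub_apply, LinearMap.sub_apply, leftProd_apply, rightProd_apply]
  rfl

/-- Locality: `(z - w)^N [A(z), B(w)] = 0`. -/
def LocalOrder (N : ℕ) (A B : VertexOperator ℂ V) : Prop :=
  ∀ v, (tau ^ N) (prodFam A B v) = (tau ^ N) (prodFamOp A B v)

/-- Mutual locality of two fields. -/
def IsLocal (A B : VertexOperator ℂ V) : Prop := ∃ N, LocalOrder N A B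

theorem LocalOrder.mono {A B : VertexOperator ℂ V} {N N' : ℕ} (h : LocalOrder N A B)
    (hN : N ≤ N') : LocalOrder N' A B :=
  fun v => tau_pow_eq_of_le (h v) hN

theorem IsLocal.add {A B C : VertexOperator ℂ V} (h : IsLocal A B) (h' : IsLocal A C) :
    IsLocal A (B + C) := by
  obtain ⟨N, h⟩ := h
  obtain ⟨N', h'⟩ := h'
  refine ⟨N + N', fun v => ?_⟩
  have e1 : prodFam A (B + C) v = prodFam A B v + prodFam A C v := by
    funext p q; simp [prodFam]
  have e2 : prodFamOp A (B + C) v = prodFamOp A B v + prodFamOp A C v := by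
    funext p q; simp [prodFamOp]
  rw [e1, e2, map_add, map_add, h.mono (by omega) v, h'.mono (by omega) v]

theorem IsLocal.smul {A B : VertexOperator ℂ V} (h : IsLocal A B) (c : ℂ) :
    IsLocal A (c • B) := by
  obtain ⟨N, h⟩ := h
  refine ⟨N, fun v => ?_⟩
  have e1 : prodFam A (c • B) v = c • prodFam A B v := by
    funext p q; simp [prodFam]
  have e2 : prodFamOp A (c • B) v = c • prodFamOp A B v := by
    funext p q; simp [prodFamOp]
  rw [e1, e2, map_smul, map_smul, h v]

/-- Exchanging the two variables changes the sign of z - w. This is what makes locality symmetric.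
-/
theorem tau_pow_swap {E : Type*} [AddCommGroup E] [Module ℂ E] (N : ℕ) (K : ℤ → ℤ → E) :
    (tau ^ N) (fun p q => K q p) = fun p q => (-1 : ℂ) ^ N • (tau ^ N) K q p := by
  induction N generalizing K with
  | zero => simp
  | succ N ih =>
    rw [tau_pow_succ, tau_pow_succ]
    have : tau (fun p q => K q p) = -(fun p q => tau K q p) := by
      funext p q; simp [tau_apply]
    rw [this, map_neg, ih]
    funext p q
    simp [pow_succ]

theorem IsLocal.symm {A B : VertexOperator ℂ V} (h : IsLocal A B) : IsLocal B A := by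
  obtain ⟨N, h⟩ := h
  refine ⟨N, fun v => ?_⟩
  have e1 : prodFam B A v = fun p q => prodFamOp A B v q p := rfl
  have e2 : prodFamOp B A v = fun p q => prodFam A B v q p := rfl
  rw [e1, e2, tau_pow_swap N (prodFamOp A B v), tau_pow_swap N (prodFam A B v), h v]

theorem tau_pow_map {E F : Type*} [AddCommGroup E] [Module ℂ E] [AddCommGroup F] [Module ℂ F]
    (f : E →ₗ[ℂ] F) (N : ℕ) (K : ℤ → ℤ → E) :
    (tau ^ N) (fun p q => f (K p q)) = fun p q => f ((tau ^ N) K p q) := by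
  induction N generalizing K with
  | zero => rfl
  | succ N ih =>
    rw [tau_pow_succ, tau_pow_succ, ← ih]
    congr 1
    funext p q
    simp [tau_apply]

end Local

/-! ### Three-variable distributions and Dong's lemma. -/

section Dong

variable {E : Type*} [AddCommGroup E] [Module ℂ E]

/-- Multiplication by `x - z` of a formal distribution in `x, z, w`. -/
def tau12 : Module.End ℂ (ℤ → ℤ → ℤ → E) where
  toFun H m p q := H (m + 1) p q - H m (p + 1) q
  map_add' K L := by funext m p q; simp only [Pi.add_apply]; abel
  map_smul' c K := by funext m p q; simp only [Pi.smul_apply, smul_sub, RingHom.id_apply]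

/-- Multiplication by `x - w` of a formal distribution in `x, z, w`. -/
def tau13 : Module.End ℂ (ℤ → ℤ → ℤ → E) where
  toFun H m p q := H (m + 1) p q - H m p (q + 1)
  map_add' K L := by funext m p q; simp only [Pi.add_apply]; abel
  map_smul' c K := by funext m p q; simp only [Pi.smul_apply, smul_sub, RingHom.id_apply]

/-- Multiplication by `z - w` of a formal distribution in `x, z, w`. -/
def tau23 : Module.End ℂ (ℤ → ℤ → ℤ → E) where
  toFun H m := tau (H m)
  map_add' K L := by funext m; simp only [Pi.add_apply, map_add]
  map_smul' c K := by funext m; simp only [Pi.smul_apply, map_smul, RingHom.id_apply]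

theorem tau12_apply (H : ℤ → ℤ → ℤ → E) (m p q : ℤ) :
    tau12 H m p q = H (m + 1) p q - H m (p + 1) q := rfl

theorem tau13_apply (H : ℤ → ℤ → ℤ → E) (m p q : ℤ) :
    tau13 H m p q = H (m + 1) p q - H m p (q + 1) := rfl

theorem tau23_apply (H : ℤ → ℤ → ℤ → E) (m : ℤ) : tau23 H m = tau (H m) := rfl

theorem tau13_eq : (tau13 : Module.End ℂ (ℤ → ℤ → ℤ → E)) = tau12 + tau23 := by
  ext H : 1
  funext m p q
  simp only [LinearMap.add_apply, Pi.add_apply, tau12_apply, tau13_apply, tau23_apply, tau_apply]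
  abel

theorem commute_tau12_tau23 : Commute (tau12 : Module.End ℂ (ℤ → ℤ → ℤ → E)) tau23 := by
  ext H : 1
  funext m p q
  simp only [Module.End.mul_apply, tau12_apply, tau23_apply, tau_apply]
  abel

theorem commute_tau12_tau13 : Commute (tau12 : Module.End ℂ (ℤ → ℤ → ℤ → E)) tau13 := by
  rw [tau13_eq]
  exact (Commute.refl _).add_right commute_tau12_tau23

theorem commute_tau23_tau13 : Commute (tau23 : Module.End ℂ (ℤ → ℤ → ℤ → E)) tau13 := by
  rw [tau13_eq]
  exact commute_tau12_tau23.symm.add_right (Commute.refl _)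

theorem tau23_pow_apply (N : ℕ) (H : ℤ → ℤ → ℤ → E) (m : ℤ) :
    (tau23 ^ N) H m = (tau ^ N) (H m) := by
  induction N generalizing H with
  | zero => rfl
  | succ N ih => rw [pow_succ, Module.End.mul_apply, ih, tau_pow_succ]; rfl

theorem tau12_pow_apply (N : ℕ) (H : ℤ → ℤ → ℤ → E) (m p q : ℤ) :
    (tau12 ^ N) H m p q = (tau ^ N) (fun m p => H m p q) m p := by
  induction N generalizing H with
  | zero => rfl
  | succ N ih => rw [pow_succ, Module.End.mul_apply, ih, tau_pow_succ]; rfl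

theorem tau13_pow_apply (N : ℕ) (H : ℤ → ℤ → ℤ → E) (m p q : ℤ) :
    (tau13 ^ N) H m p q = (tau ^ N) (fun m q => H m p q) m q := by
  induction N generalizing H with
  | zero => rfl
  | succ N ih => rw [pow_succ, Module.End.mul_apply, ih, tau_pow_succ]; rfl

theorem TruncR.shift {K : ℤ → ℤ → E} (h : TruncR K) : TruncR (fun p q => K p (q + 1)) := by
  obtain ⟨Q, h⟩ := h
  exact ⟨Q, fun p q hq => h _ _ (by omega)⟩

theorem TruncL.shift {K : ℤ → ℤ → E} (h : TruncL K) : TruncL (fun p q => K p (q + 1)) := by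
  obtain ⟨Q, h⟩ := h
  exact ⟨Q, fun p q hq => h _ _ (by omega)⟩

/-- The residue is taken in z, so multiplication by w passes through it and merely shifts the mode.
-/
theorem famProd_shift (n : ℤ) (K L : ℤ → ℤ → E) (m : ℤ) :
    famProd n (fun p q => K p (q + 1)) (fun p q => L p (q + 1)) m = famProd n K L (m + 1) := by
  have e1 : ∀ l : ℤ, m + l + 1 = m + 1 + l := fun l => by ring
  have e2 : ∀ l : ℤ, n + m - l + 1 = n + (m + 1) - l := fun l => by ring
  simp only [famProd, famLeft, famRight, e1, e2]

theorem truncR_tau13 {K : ℤ → ℤ → ℤ → E} (h : ∀ m, TruncR (K m)) (m : ℤ) :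
    TruncR (tau13 K m) := by
  have := (h (m + 1)).add ((h m).shift.smul (-1))
  convert this using 1
  funext p q
  simp [tau13_apply, sub_eq_add_neg]

theorem truncL_tau13 {K : ℤ → ℤ → ℤ → E} (h : ∀ m, TruncL (K m)) (m : ℤ) :
    TruncL (tau13 K m) := by
  have := (h (m + 1)).add ((h m).shift.smul (-1))
  convert this using 1
  funext p q
  simp [tau13_apply, sub_eq_add_neg]

theorem truncR_tau12 {K : ℤ → ℤ → ℤ → E} (h : ∀ m, TruncR (K m)) (m : ℤ) :
    TruncR (tau12 K m) := by
  obtain ⟨Q, hQ⟩ := h m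
  obtain ⟨Q', hQ'⟩ := h (m + 1)
  exact ⟨max Q Q', fun p q hq => by
    rw [tau12_apply, hQ _ _ (by omega), hQ' _ _ (by omega), sub_zero]⟩

theorem truncL_tau12 {K : ℤ → ℤ → ℤ → E} (h : ∀ m, TruncL (K m)) (m : ℤ) :
    TruncL (tau12 K m) := by
  obtain ⟨Q, hQ⟩ := h m
  obtain ⟨Q', hQ'⟩ := h (m + 1)
  exact ⟨max Q Q', fun p q hq => by
    rw [tau12_apply, hQ _ _ (by omega), hQ' _ _ (by omega), sub_zero]⟩

theorem pow_invariant {F : Type*} [AddCommGroup F] [Module ℂ F] {p : F → Prop}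
    {T : Module.End ℂ F} (h : ∀ x, p x → p (T x)) (N : ℕ) {x : F} (hx : p x) : p ((T ^ N) x) := by
  induction N generalizing x with
  | zero => exact hx
  | succ N ih => rw [pow_succ, Module.End.mul_apply]; exact ih (h x hx)

/-- The factor x - w does not involve z and therefore commutes with the residue in z. This moves
locality of x against w inside the residue that defines the product. -/
theorem tau_pow_famProd {K L : ℤ → ℤ → ℤ → E} (hK : ∀ m, TruncR (K m)) (hL : ∀ m, TruncL (L m))
    (n : ℤ) (M : ℕ) :
    (tau ^ M) (fun m r => famProd n (K m) (L m) r) =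
      fun m r => famProd n ((tau13 ^ M) K m) ((tau13 ^ M) L m) r := by
  induction M generalizing K L with
  | zero => rfl
  | succ M ih =>
    rw [tau_pow_succ, pow_succ, Module.End.mul_apply, Module.End.mul_apply,
      ← ih (truncR_tau13 hK) (truncL_tau13 hL)]
    congr 1
    funext m r
    rw [tau_apply, ← famProd_shift]
    have e : ∀ K : ℤ → ℤ → ℤ → E,
        tau13 K m = K (m + 1) + (-1 : ℂ) • (fun p q => K m p (q + 1)) := fun K => by
      funext p q
      simp [tau13_apply, sub_eq_add_neg]
    rw [e, e, famProd_add (hK _) ((hK m).shift.smul _) (hL _) ((hL m).shift.smul _), famProd_smul,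
      neg_one_smul, sub_eq_add_neg]

/-- Dong's lemma, for a pair of three-variable formal distributions. -/
theorem dong_families {K L : ℤ → ℤ → ℤ → E} (hK : ∀ m, TruncR (K m)) (hL : ∀ m, TruncL (L m))
    {N : ℕ} (h₁ : (tau13 ^ N) ((tau12 ^ N) K) = 0) (h₂ : (tau13 ^ N) ((tau12 ^ N) L) = 0)
    (h₃ : (tau23 ^ N) K = (tau23 ^ N) L) (n : ℤ) :
    (tau ^ (N + (2 * N + n.natAbs))) (fun m r => famProd n (K m) (L m) r) = 0 := by
  rw [tau_pow_famProd hK hL]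
  -- Chosen so that M' - s > N + |n| whenever s < N, which gives n + (M' - s) ≥ N.
  set M' := 2 * N + n.natAbs with hM'
  -- Write (x - w)^(N + M') as (x - w)^N ((x - z) + (z - w))^M' and expand the second factor
  -- binomially.
  have expand : ∀ H : ℤ → ℤ → ℤ → E, (tau13 ^ (N + M')) H = ∑ s ∈ Finset.range (M' + 1),
      (tau23 ^ (M' - s)) ((M'.choose s : ℂ) • (tau13 ^ N) ((tau12 ^ s) H)) := by
    intro H
    have hp := commute_tau12_tau23 (E := E) |>.add_pow M'
    rw [← tau13_eq] at hp
    rw [pow_add, hp, Module.End.mul_apply]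
    simp only [LinearMap.sum_apply, map_sum]
    apply Finset.sum_congr rfl
    intro s _
    have c1 : Commute (tau12 ^ s : Module.End ℂ (ℤ → ℤ → ℤ → E)) (tau23 ^ (M' - s)) :=
      commute_tau12_tau23.pow_pow _ _
    have c2 : Commute (tau23 ^ (M' - s) : Module.End ℂ (ℤ → ℤ → ℤ → E)) (tau13 ^ N) :=
      commute_tau23_tau13.pow_pow _ _
    have e : tau13 ^ N * (tau12 ^ s * tau23 ^ (M' - s) *
        (M'.choose s : Module.End ℂ (ℤ → ℤ → ℤ → E))) =
        tau23 ^ (M' - s) * ((M'.choose s : Module.End ℂ (ℤ → ℤ → ℤ → E)) *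
          (tau13 ^ N * tau12 ^ s)) := by
      rw [← (Nat.cast_commute (M'.choose s) (tau12 ^ s * tau23 ^ (M' - s) : Module.End ℂ
        (ℤ → ℤ → ℤ → E))).eq, c1.eq, ← mul_assoc, ← (Nat.cast_commute _ _).eq, ← mul_assoc (tau23 ^ _),
        ← (Nat.cast_commute _ (tau23 ^ (M' - s) : Module.End ℂ (ℤ → ℤ → ℤ → E))).eq]
      simp only [mul_assoc]
      rw [← mul_assoc (tau13 ^ N), ← c2.eq, mul_assoc]
    have := congrArg (fun T => T H) e
    simp only [Module.End.mul_apply, Module.End.natCast_apply] at this ⊢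
    rw [this, Nat.cast_smul_eq_nsmul]
  have trR : ∀ s, ∀ m, TruncR ((tau13 ^ N) ((tau12 ^ s) K) m) := fun s =>
    pow_invariant (p := fun H : ℤ → ℤ → ℤ → E => ∀ m, TruncR (H m)) (fun _ h => truncR_tau13 h) N
      (pow_invariant (p := fun H : ℤ → ℤ → ℤ → E => ∀ m, TruncR (H m))
        (fun _ h => truncR_tau12 h) s hK)
  have trL : ∀ s, ∀ m, TruncL ((tau13 ^ N) ((tau12 ^ s) L) m) := fun s =>
    pow_invariant (p := fun H : ℤ → ℤ → ℤ → E => ∀ m, TruncL (H m)) (fun _ h => truncL_tau13 h) N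
      (pow_invariant (p := fun H : ℤ → ℤ → ℤ → E => ∀ m, TruncL (H m))
        (fun _ h => truncL_tau12 h) s hL)
  funext m r
  rw [expand, expand, Finset.sum_apply, Finset.sum_apply]
  simp only [tau23_pow_apply, Pi.smul_apply _ ((tau13 ^ N) _)]
  have key := famProd_sum (Finset.range (M' + 1))
    (K := fun s => (tau ^ (M' - s)) ((M'.choose s : ℂ) • (tau13 ^ N) ((tau12 ^ s) K) m))
    (L := fun s => (tau ^ (M' - s)) ((M'.choose s : ℂ) • (tau13 ^ N) ((tau12 ^ s) L) m))
    (fun s => ((trR s m).smul _).tau_pow _) (fun s => ((trL s m).smul _).tau_pow _) n r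
  refine key.1.trans (Finset.sum_eq_zero fun s hs => ?_)
  rw [Finset.mem_range] at hs
  rw [famProd_tau_pow ((trR s m).smul _) ((trL s m).smul _), famProd_smul]
  have comm : ∀ (a : ℕ) (H : ℤ → ℤ → ℤ → E),
      (tau13 ^ N) ((tau12 ^ (a + N)) H) = (tau12 ^ a) ((tau13 ^ N) ((tau12 ^ N) H)) := by
    intro a H
    simp only [← Module.End.mul_apply]
    rw [pow_add, ← mul_assoc, ← mul_assoc,
      ((commute_tau12_tau13 (E := E)).pow_pow a N).eq]
  -- Terms with at least N factors x - z vanish by the first two hypotheses. In the others, the many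
  -- factors z - w raise the product index to at least N, where locality of the pair in z and w
  -- makes the residue zero.
  by_cases hsN : N ≤ s
  · obtain ⟨a, rfl⟩ := Nat.exists_eq_add_of_le' hsN
    rw [comm, comm, h₁, h₂, map_zero]
    change _ • famProd _ 0 0 r = 0
    rw [famProd_zero, smul_zero]
  · rw [famProd_eq_zero (N := N) (trR s m) (trL s m) ?_ (by omega), smul_zero]
    rw [← tau23_pow_apply, ← tau23_pow_apply]
    have c : ∀ H : ℤ → ℤ → ℤ → E, (tau23 ^ N) ((tau13 ^ N) ((tau12 ^ s) H)) =
        (tau13 ^ N) ((tau12 ^ s) ((tau23 ^ N) H)) := by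
      intro H
      simp only [← Module.End.mul_apply]
      rw [← mul_assoc, ((commute_tau23_tau13 (E := E)).pow_pow N N).eq, mul_assoc,
        ← ((commute_tau12_tau23 (E := E)).pow_pow s N).eq]
    rw [c, c, h₃]

variable {V : Type*} [AddCommGroup V] [Module ℂ V]

/-- Dong's lemma. -/
theorem IsLocal.fieldProd {A B C : VertexOperator ℂ V} (hAB : IsLocal A B) (hAC : IsLocal A C)
    (hBC : IsLocal B C) (n : ℤ) : IsLocal A (fieldProd B n C) := by
  obtain ⟨N₁, hAB⟩ := hAB
  obtain ⟨N₂, hAC⟩ := hAC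
  obtain ⟨N₃, hBC⟩ := hBC
  set N := N₁ + N₂ + N₃
  replace hAB := hAB.mono (show N₁ ≤ N by omega)
  replace hAC := hAC.mono (show N₂ ≤ N by omega)
  replace hBC := hBC.mono (show N₃ ≤ N by omega)
  refine ⟨N + (2 * N + n.natAbs), fun v => ?_⟩
  have mapsub : ∀ (T : Module.End ℂ (ℤ → ℤ → V)) (x y : ℤ → ℤ → V), T (x - y) = 0 → T x = T y :=
    fun T x y h => by rwa [map_sub, sub_eq_zero] at h
  apply mapsub
  -- `K` and `L` collect the coefficients of [A(x), B(z)C(w)]v and [A(x), C(w)B(z)]v. Their n-th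
  -- residue in z is the commutator of A with the n-th product of B and C.
  let K : ℤ → ℤ → ℤ → V := fun m p q =>
    (A[[m]]) ((B[[p]]) ((C[[q]]) v)) - (B[[p]]) ((C[[q]]) ((A[[m]]) v))
  let L : ℤ → ℤ → ℤ → V := fun m p q =>
    (A[[m]]) ((C[[q]]) ((B[[p]]) v)) - (C[[q]]) ((B[[p]]) ((A[[m]]) v))
  have hK1 : ∀ m, TruncR (fun p q => (A[[m]]) ((B[[p]]) ((C[[q]]) v))) := fun m => by
    obtain ⟨Q, h⟩ := truncR_prodFam B C v
    exact ⟨Q, fun p q hq => by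
      change (A[[m]]) (prodFam B C v p q) = 0
      rw [h p q hq, map_zero]⟩
  have hL1 : ∀ m, TruncL (fun p q => (A[[m]]) ((C[[q]]) ((B[[p]]) v))) := fun m => by
    obtain ⟨Q, h⟩ := truncL_prodFamOp B C v
    exact ⟨Q, fun p q hq => by
      change (A[[m]]) (prodFamOp B C v p q) = 0
      rw [h p q hq, map_zero]⟩
  have hK : ∀ m, TruncR (K m) := fun m => by
    have := (hK1 m).add ((truncR_prodFam B C ((A[[m]]) v)).smul (-1))
    convert this using 1
    funext p q
    simp [K, prodFam, sub_eq_add_neg]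
  have hL : ∀ m, TruncL (L m) := fun m => by
    have := (hL1 m).add ((truncL_prodFamOp B C ((A[[m]]) v)).smul (-1))
    convert this using 1
    funext p q
    simp [L, prodFamOp, sub_eq_add_neg]
  have hD : prodFam A (RectW.fieldProd B n C) v - prodFamOp A (RectW.fieldProd B n C) v =
      fun m r => famProd n (K m) (L m) r := by
    funext m r
    have e1 : K m = (fun p q => (A[[m]]) ((B[[p]]) ((C[[q]]) v))) +
        (-1 : ℂ) • prodFam B C ((A[[m]]) v) := by
      funext p q; simp [K, prodFam, sub_eq_add_neg]
    have e2 : L m = (fun p q => (A[[m]]) ((C[[q]]) ((B[[p]]) v))) +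
        (-1 : ℂ) • prodFamOp B C ((A[[m]]) v) := by
      funext p q; simp [L, prodFamOp, sub_eq_add_neg]
    rw [e1, e2, famProd_add (hK1 m) ((truncR_prodFam _ _ _).smul _) (hL1 m)
      ((truncL_prodFamOp _ _ _).smul _), famProd_smul, neg_one_smul, ← sub_eq_add_neg,
      ← fieldProd_ncoeff]
    refine congrArg (fun x => x - ((RectW.fieldProd B n C)[[r]]) ((A[[m]]) v)) ?_
    obtain ⟨N₁, h₁⟩ := (truncR_prodFam B C v).exists_range n r
    obtain ⟨N₂, h₂⟩ := (truncL_prodFamOp B C v).exists_range n r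
    obtain ⟨N₃, h₃⟩ := (hK1 m).exists_range n r
    obtain ⟨N₄, h₄⟩ := (hL1 m).exists_range n r
    rw [prodFam, fieldProd_ncoeff, famProd, famProd, famLeft_range _ _ h₁, famRight_range _ _ h₂,
      famLeft_range (N := N₁) _ _ (fun l hl => by
        change (A[[m]]) (prodFam B C v _ _) = 0; rw [h₁ l hl, map_zero]),
      famRight_range (N := N₂) _ _ (fun l hl => by
        change (A[[m]]) (prodFamOp B C v _ _) = 0; rw [h₂ l hl, map_zero])]
    simp only [map_sub, map_sum, map_smul, prodFam, prodFamOp]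
  rw [hD]
  have c : ∀ H : ℤ → ℤ → ℤ → V, (tau13 ^ N) ((tau12 ^ N) H) = (tau12 ^ N) ((tau13 ^ N) H) := by
    intro H
    simp only [← Module.End.mul_apply]
    rw [((commute_tau12_tau13 (E := V)).pow_pow N N).eq]
  apply dong_families hK hL
  -- Leibniz: [A, BC] = [A, B]C + B[A, C]. The first term is killed by (x - z)^N and the second by
  -- (x - w)^N.
  · have : K = (fun m p q => (prodFam A B ((C[[q]]) v) - prodFamOp A B ((C[[q]]) v)) m p) +
        fun m p q => (B[[p]]) ((prodFam A C v - prodFamOp A C v) m q) := by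
      funext m p q; simp [K, prodFam, prodFamOp]
    rw [this, map_add, map_add, c (fun m p q => (B[[p]]) _)]
    have z1 : (tau12 ^ N) (fun m p q =>
        (prodFam A B ((C[[q]]) v) - prodFamOp A B ((C[[q]]) v)) m p) = 0 := by
      funext m p q
      rw [tau12_pow_apply]
      change (tau ^ N) (prodFam A B ((C[[q]]) v) - prodFamOp A B ((C[[q]]) v)) m p = 0
      rw [map_sub, hAB, sub_self]; rfl
    have z2 : (tau13 ^ N) (fun m p q =>
        (B[[p]]) ((prodFam A C v - prodFamOp A C v) m q)) = 0 := by
      funext m p q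
      rw [tau13_pow_apply, tau_pow_map, map_sub, hAC, sub_self]
      exact map_zero _
    rw [z1, z2, map_zero, map_zero, add_zero]
  · have : L = (fun m p q => (prodFam A C ((B[[p]]) v) - prodFamOp A C ((B[[p]]) v)) m q) +
        fun m p q => (C[[q]]) ((prodFam A B v - prodFamOp A B v) m p) := by
      funext m p q; simp [L, prodFam, prodFamOp]
    rw [this, map_add, map_add, c (fun m p q => (prodFam A C ((B[[p]]) v) - prodFamOp A C ((B[[p]]) v)) m q)]
    have z1 : (tau13 ^ N) (fun m p q =>
        (prodFam A C ((B[[p]]) v) - prodFamOp A C ((B[[p]]) v)) m q) = 0 := by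
      funext m p q
      rw [tau13_pow_apply]
      change (tau ^ N) (prodFam A C ((B[[p]]) v) - prodFamOp A C ((B[[p]]) v)) m q = 0
      rw [map_sub, hAC, sub_self]; rfl
    have z2 : (tau12 ^ N) (fun m p q =>
        (C[[q]]) ((prodFam A B v - prodFamOp A B v) m p)) = 0 := by
      funext m p q
      rw [tau12_pow_apply, tau_pow_map, map_sub, hAB, sub_self]
      exact map_zero _
    rw [z1, z2, map_zero, map_zero, add_zero]
  -- After multiplication by (z - w)^N the order of B and C is immaterial, both inside the mode of A
  -- and after it.
  · funext m
    rw [tau23_pow_apply, tau23_pow_apply]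
    have e1 : K m = (fun p q => (A[[m]]) (prodFam B C v p q)) - prodFam B C ((A[[m]]) v) := rfl
    have e2 : L m = (fun p q => (A[[m]]) (prodFamOp B C v p q)) - prodFamOp B C ((A[[m]]) v) := rfl
    rw [e1, e2, map_sub, map_sub, tau_pow_map, tau_pow_map, hBC, hBC]

end Dong

/-! ### Products with the identity field and derivatives of fields. -/

section Identity

variable {V : Type*} [AddCommGroup V] [Module ℂ V]

theorem idField_ncoeff (m : ℤ) (v : V) : ((idField V)[[m]]) v = if m = -1 then v else 0 := by
  rw [idField, mkField_ncoeff]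
  split_ifs <;> rfl

theorem prodFam_idField_right (A : VertexOperator ℂ V) (v : V) :
    prodFamOp A (idField V) v = prodFam A (idField V) v := by
  funext p q
  simp only [prodFam, prodFamOp, idField_ncoeff]
  split_ifs <;> simp

theorem prodFam_idField_left (B : VertexOperator ℂ V) (v : V) :
    prodFamOp (idField V) B v = prodFam (idField V) B v := by
  funext p q
  simp only [prodFam, prodFamOp, idField_ncoeff]
  split_ifs <;> simp

theorem isLocal_idField (A : VertexOperator ℂ V) : IsLocal A (idField V) :=
  ⟨0, fun v => by rw [prodFam_idField_right]⟩

/-- Since Id commutes with A, both expansions are applied to the same distribution, and the product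
is a residue against a derivative of the delta function. The outcome is the j-th divided derivative
of A; the binomial coefficient equals (-1)^j binom(m, j). -/
theorem fieldProd_neg_idField (A : VertexOperator ℂ V) (j : ℕ) (m : ℤ) (v : V) :
    ((fieldProd A (-1 - j) (idField V))[[m]]) v =
      ((Ring.choose (j - m - 1) j : ℤ) : ℂ) • (A[[m - j]]) v := by
  have hL := truncL_prodFamOp A (idField V) v
  rw [prodFam_idField_right] at hL
  rw [fieldProd_ncoeff, prodFam_idField_right, famProd_neg (truncR_prodFam _ _ _) hL,
    finsum_eq_single _ (j - m - 1)]
  · simp only [prodFam, idField_ncoeff]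
    rw [if_pos (by ring), show -((j : ℤ) - m - 1) - 1 = m - j by ring]
  · intro p hp
    simp only [prodFam, idField_ncoeff]
    rw [if_neg (by omega), map_zero, smul_zero]

theorem fieldProd_neg_one_idField (A : VertexOperator ℂ V) :
    fieldProd A (-1) (idField V) = A := by
  apply field_ext
  intro m v
  simpa using fieldProd_neg_idField A 0 m v

theorem fieldProd_neg_two_idField (A : VertexOperator ℂ V) (m : ℤ) (v : V) :
    ((fieldProd A (-2) (idField V))[[m]]) v = (-(m : ℂ)) • (A[[m - 1]]) v := by
  have := fieldProd_neg_idField A 1 m v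
  norm_num at this
  rw [this, neg_smul]

theorem idField_fieldProd (B : VertexOperator ℂ V) (n : ℤ) :
    fieldProd (idField V) n B = if n = -1 then B else 0 := by
  apply field_ext
  intro m v
  have hL := truncL_prodFamOp (idField V) B v
  rw [prodFam_idField_left] at hL
  rw [fieldProd_ncoeff, prodFam_idField_left]
  by_cases hn : 0 ≤ n
  · rw [famProd_eq_zero (N := 0) (truncR_prodFam _ _ _) hL rfl (by omega), if_neg (by omega)]
    simp
  · obtain ⟨j, hj⟩ := Int.eq_ofNat_of_zero_le (show 0 ≤ -1 - n by omega)
    obtain rfl : n = -1 - j := by omega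
    rw [famProd_neg (truncR_prodFam _ _ _) hL, finsum_eq_single _ 0]
    · simp only [prodFam, idField_ncoeff]
      cases j with
      | zero => simp
      | succ j =>
        rw [Ring.choose_zero_succ, if_neg (c := (-1 : ℤ) - (j + 1 : ℕ) = -1) (by omega)]
        simp
    · intro p hp
      simp only [prodFam, idField_ncoeff]
      rw [if_neg (by omega), smul_zero]

theorem bc_succ_mul (n : ℤ) (l : ℕ) : bc n (l + 1) * (l + 1) = -(n * bc (n - 1) l) := by
  have h1 := bc_mul_sub n (l + 1)
  have h2 := bc_succ_succ (n - 1) l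
  rw [sub_add_cancel] at h2
  push_cast at h1
  linear_combination -h1 + (n : ℂ) * h2

/-- The modes of the derivative carry a factor -p. The absorption identities `bc_mul_sub` and
`bc_succ_mul` merge it with the binomial coefficients of the first and second expansion
respectively. -/
theorem fieldProd_deriv (A B : VertexOperator ℂ V) (n : ℤ) :
    fieldProd (fieldProd A (-2) (idField V)) n B = (-(n : ℂ)) • fieldProd A (n - 1) B := by
  apply field_ext
  intro m v
  rw [map_smul, Pi.smul_apply, LinearMap.smul_apply, fieldProd_ncoeff, fieldProd_ncoeff]
  have e1 : prodFam (fieldProd A (-2) (idField V)) B v =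
      fun (p q : ℤ) => (-(p : ℂ)) • prodFam A B v (p - 1) q := by
    funext p q; exact fieldProd_neg_two_idField _ _ _
  have e2 : prodFamOp (fieldProd A (-2) (idField V)) B v =
      fun (p q : ℤ) => (-(p : ℂ)) • prodFamOp A B v (p - 1) q := by
    funext p q
    simp only [prodFamOp, fieldProd_neg_two_idField, map_smul]
  have hR := truncR_prodFam (fieldProd A (-2) (idField V)) B v
  have hL := truncL_prodFamOp (fieldProd A (-2) (idField V)) B v
  rw [e1] at hR ⊢
  rw [e2] at hL ⊢
  obtain ⟨N₁, h₁⟩ := hR.exists_range n m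
  obtain ⟨N₂, h₂⟩ := hL.exists_range n m
  obtain ⟨N₃, h₃⟩ := (truncR_prodFam A B v).exists_range (n - 1) m
  obtain ⟨N₄, h₄⟩ := (truncL_prodFamOp A B v).exists_range (n - 1) m
  set N := N₁ + N₂ + N₃ + N₄
  -- In the second expansion the term l = 0 carries the factor -l = 0. It is split off, and the
  -- other terms are shifted by one, which is why that range is longer.
  rw [famProd, famProd, famLeft_range (N := N) _ _ (fun l hl => h₁ l (by omega)),
    famRight_range (N := N + 1) _ _ (fun l hl => h₂ l (by omega)),
    famLeft_range (N := N) _ _ (fun l hl => h₃ l (by omega)),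
    famRight_range (N := N) _ _ (fun l hl => h₄ l (by omega)), Finset.sum_range_succ', smul_sub,
    Finset.smul_sum, Finset.smul_sum]
  simp only [smul_smul, Int.cast_natCast, Nat.cast_zero, Int.cast_zero, neg_zero, zero_smul, smul_zero, add_zero]
  congr 1
  · apply Finset.sum_congr rfl
    intro l _
    rw [show n - 1 - (l : ℤ) = n - l - 1 by ring]
    congr 1
    push_cast
    linear_combination -bc_mul_sub n l
  · apply Finset.sum_congr rfl
    intro l _
    rw [show ((l + 1 : ℕ) : ℤ) - 1 = l by push_cast; ring,
      show n + m - ((l + 1 : ℕ) : ℤ) = n - 1 + m - l by push_cast; ring]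
    congr 1
    have : (-1 : ℂ) ^ n = -(-1) ^ (n - 1) := by
      rw [zpow_sub_one₀ (by norm_num)]; norm_num
    rw [this]
    push_cast
    linear_combination ((-1 : ℂ) ^ (n - 1)) * bc_succ_mul n l

end Identity

/-! ### Regular states: associativity together with locality. -/

section Regular

variable {V : Type*} [AddCommGroup V] [Module ℂ V] [VertexStructure V]

/-- A state `a` for which the associativity formula `Y(a_{(n)} b) = Y(a)_{(n)} Y(b)` holds and whose
field is local with respect to all fields `Y(b)`. -/
structure IsRegular (a : V) : Prop where
  assoc : ∀ (n : ℤ) (b : V), VertexStructure.Y (nthProd a n b) =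
    fieldProd (VertexStructure.Y a) n (VertexStructure.Y b)
  isLocal : ∀ b : V, IsLocal (VertexStructure.Y a) (VertexStructure.Y b)

theorem IsRegular.zero : IsRegular (0 : V) where
  assoc n b := by
    have h : nthProd 0 n b = (0 : V) := by simp [nthProd]
    have := LinearMap.map_zero₂ (fieldProdLin n) (VertexStructure.Y b)
    rw [h, map_zero]
    exact this.symm
  isLocal b := ⟨0, fun v => by funext p q; simp [prodFam, prodFamOp]⟩

theorem IsRegular.add {a b : V} (ha : IsRegular a) (hb : IsRegular b) : IsRegular (a + b) where
  assoc n c := by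
    have h : nthProd (a + b) n c = nthProd a n c + nthProd b n c := by simp [nthProd]
    have := LinearMap.map_add₂ (fieldProdLin n) (VertexStructure.Y a) (VertexStructure.Y b)
      (VertexStructure.Y c)
    rw [h, map_add, map_add, ha.assoc, hb.assoc]
    exact this.symm
  isLocal c := by
    rw [map_add]
    exact ((ha.isLocal c).symm.add (hb.isLocal c).symm).symm

theorem IsRegular.smul {a : V} (ha : IsRegular a) (r : ℂ) : IsRegular (r • a) where
  assoc n c := by
    have h : nthProd (r • a) n c = r • nthProd a n c := by simp [nthProd]
    have := LinearMap.map_smul₂ (fieldProdLin n) r (VertexStructure.Y a) (VertexStructure.Y c)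
    rw [h, map_smul, map_smul, ha.assoc]
    exact this.symm
  isLocal c := by
    rw [map_smul]
    exact ((ha.isLocal c).symm.smul r).symm

theorem IsRegular.sum {ι : Type*} (s : Finset ι) {a : ι → V} (h : ∀ i, IsRegular (a i)) :
    IsRegular (∑ i ∈ s, a i) := by
  classical
  induction s using Finset.induction_on with
  | empty => exact IsRegular.zero
  | insert i s hi ih => rw [Finset.sum_insert hi]; exact (h i).add ih

theorem IsRegular.sub {a b : V} (ha : IsRegular a) (hb : IsRegular b) : IsRegular (a - b) := by
  have := ha.add (hb.smul (-1))
  rwa [neg_one_smul, ← sub_eq_add_neg] at this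

end Regular

/-! ### Locality in the universal affine vertex algebra. -/

namespace UnivAffine

variable {g : Type*} [LieRing g] [LieAlgebra ℂ g] (κ : InvForm g)

/-- The vector `x[m] = x t^m |0⟩`. -/
def vec (x : g) (m : ℤ) : UnivAffine κ := act κ (loopElt κ x m) (vacuum κ)

theorem Y_vac : VertexStructure.Y (VertexStructure.vac : UnivAffine κ) = idField _ :=
  stateField_vacuum κ

theorem Y_act (x : g) (m : ℤ) (v : UnivAffine κ) :
    VertexStructure.Y (act κ (loopElt κ x m) v) =
      fieldProd (current κ x) m (VertexStructure.Y v) :=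
  stateField_act κ x m v

theorem Y_vec (x : g) (m : ℤ) : VertexStructure.Y (vec κ x m) =
    fieldProd (current κ x) m (idField _) := by
  rw [vec, Y_act]; congr 1; exact Y_vac κ

theorem Y_vec_neg_one (x : g) : VertexStructure.Y (vec κ x (-1)) = current κ x := by
  rw [Y_vec, fieldProd_neg_one_idField]

theorem nthProd_vac (m : ℤ) (v : UnivAffine κ) :
    nthProd VertexStructure.vac m v = if m = -1 then v else 0 := by
  rw [nthProd, Y_vac, idField_ncoeff]

theorem nthProd_vec_neg_one (x : g) (m : ℤ) (v : UnivAffine κ) :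
    nthProd (vec κ x (-1)) m v = act κ (loopElt κ x m) v := by
  rw [nthProd, Y_vec_neg_one, current_ncoeff]

theorem nthProd_vec_neg_two (x : g) (m : ℤ) (v : UnivAffine κ) :
    nthProd (vec κ x (-2)) m v = (-(m : ℂ)) • act κ (loopElt κ x (m - 1)) v := by
  rw [nthProd, Y_vec, fieldProd_neg_two_idField, current_ncoeff]

/-- Along m + n = const the commutator is constant apart from a central term linear in m, so its
second difference vanishes and (z - w)^2 suffices. -/
theorem isLocal_current (x y : g) : IsLocal (current κ x) (current κ y) := by
  refine ⟨2, fun v => ?_⟩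
  have key : prodFam (current κ x) (current κ y) v - prodFamOp (current κ x) (current κ y) v =
      fun m n => act κ (loopElt κ ⁅x, y⁆ (m + n)) v +
        (if m + n = 0 then (m : ℂ) * κ.form x y else 0) • v := by
    funext m n
    simp only [Pi.sub_apply, prodFam, prodFamOp, current_ncoeff]
    exact act_loop_comm κ x y m n v
  rw [← sub_eq_zero, ← map_sub, key, pow_two, Module.End.mul_apply]
  funext m n
  simp only [tau_apply]
  rw [show m + 1 + 1 + n = m + n + 2 by ring, show m + 1 + (n + 1) = m + n + 2 by ring,
    show m + (n + 1 + 1) = m + n + 2 by ring]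
  by_cases h : m + n + 2 = 0
  · simp only [if_pos h]
    push_cast
    simp only [Pi.zero_apply]
    module
  · simp only [if_neg h]
    simp

/-- The vacuum module is spanned by iterated actions of loop elements on the vacuum, and each such
action replaces the field by its product with a current. Dong's lemma carries locality through every
step. -/
theorem isLocal_current_Y (x : g) (v : UnivAffine κ) :
    IsLocal (current κ x) (VertexStructure.Y v) := by
  induction v using UnivAffine.induction generalizing x with
  | vac => exact (Y_vac κ).symm ▸ isLocal_idField _
  | add v w hv hw => rw [map_add]; exact (hv x).add (hw x)
  | smul a v hv => rw [map_smul]; exact (hv x).smul a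
  | act_mem y m v hv =>
    rw [Y_act]
    exact (isLocal_current κ x y).fieldProd (hv x) (hv y) m

end UnivAffine

/-! ### Tensor products of distributions and the Leibniz rule for residues. -/

section Conv

variable {E F : Type*} [AddCommGroup E] [Module ℂ E] [AddCommGroup F] [Module ℂ F]

/-- The summands of `conv`. -/
def convTerm (K : ℤ → ℤ → E) (L : ℤ → ℤ → F) (p q : ℤ) (x : ℤ × ℤ) : E ⊗[ℂ] F :=
  K x.1 x.2 ⊗ₜ L (p - 1 - x.1) (q - 1 - x.2)

/-- The tensor product of two formal distributions in two variables. -/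
def conv (K : ℤ → ℤ → E) (L : ℤ → ℤ → F) (p q : ℤ) : E ⊗[ℂ] F := ∑ᶠ x, convTerm K L p q x

/-- Formal distributions of the type of `A(z) B(w) v`. -/
def IsRightType (K : ℤ → ℤ → E) : Prop := TruncR K ∧ ∀ q, ∃ P, ∀ p, P ≤ p → K p q = 0

/-- Formal distributions of the type of `B(w) A(z) v`. -/
def IsLeftType (K : ℤ → ℤ → E) : Prop := TruncL K ∧ ∀ p, ∃ Q, ∀ q, Q ≤ q → K p q = 0

theorem IsRightType.tau {K : ℤ → ℤ → E} (h : IsRightType K) : IsRightType (RectW.tau K) := by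
  refine ⟨h.1.tau, fun q => ?_⟩
  obtain ⟨P, hP⟩ := h.2 q
  obtain ⟨P', hP'⟩ := h.2 (q + 1)
  exact ⟨max P P', fun p hp => by rw [tau_apply, hP _ (by omega), hP' _ (by omega), sub_zero]⟩

theorem IsLeftType.tau {K : ℤ → ℤ → E} (h : IsLeftType K) : IsLeftType (RectW.tau K) := by
  refine ⟨h.1.tau, fun q => ?_⟩
  obtain ⟨P, hP⟩ := h.2 q
  obtain ⟨P', hP'⟩ := h.2 (q + 1)
  exact ⟨max P P', fun p hp => by rw [tau_apply, hP _ (by omega), hP' _ (by omega), sub_zero]⟩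

/-- The uniform truncation of both families confines the second index to an interval; for each value
there, the pointwise truncation confines the first index. -/
theorem IsRightType.finite {K : ℤ → ℤ → E} {L : ℤ → ℤ → F} (hK : IsRightType K)
    (hL : IsRightType L) (p q : ℤ) : (convTerm K L p q).HasFiniteSupport := by
  obtain ⟨⟨Q, hQ⟩, hP⟩ := hK
  obtain ⟨⟨Q', hQ'⟩, hP'⟩ := hL
  choose P hP using hP
  choose P' hP' using hP'
  have hfin : (⋃ s ∈ Set.Icc (q - 1 - Q') Q,
      (fun r => (r, s)) '' Set.Icc (p - 1 - P' (q - 1 - s)) (P s)).Finite :=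
    (Set.finite_Icc _ _).biUnion fun s _ => (Set.finite_Icc _ _).image _
  refine hfin.subset fun x hx => ?_
  rw [Function.mem_support, convTerm] at hx
  simp only [Set.mem_iUnion, Set.mem_image, Set.mem_Icc]
  refine ⟨x.2, ⟨?_, ?_⟩, x.1, ⟨?_, ?_⟩, rfl⟩ <;> by_contra hc <;> apply hx
  · rw [hQ' _ _ (by omega), TensorProduct.tmul_zero]
  · rw [hQ _ _ (by omega), TensorProduct.zero_tmul]
  · rw [hP' _ _ (by omega), TensorProduct.tmul_zero]
  · rw [hP _ _ (by omega), TensorProduct.zero_tmul]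

theorem IsLeftType.finite {K : ℤ → ℤ → E} {L : ℤ → ℤ → F} (hK : IsLeftType K)
    (hL : IsLeftType L) (p q : ℤ) : (convTerm K L p q).HasFiniteSupport := by
  obtain ⟨⟨Q, hQ⟩, hP⟩ := hK
  obtain ⟨⟨Q', hQ'⟩, hP'⟩ := hL
  choose P hP using hP
  choose P' hP' using hP'
  have hfin : (⋃ s ∈ Set.Icc (p - 1 - Q') Q,
      (fun r => (s, r)) '' Set.Icc (q - 1 - P' (p - 1 - s)) (P s)).Finite :=
    (Set.finite_Icc _ _).biUnion fun s _ => (Set.finite_Icc _ _).image _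
  refine hfin.subset fun x hx => ?_
  rw [Function.mem_support, convTerm] at hx
  simp only [Set.mem_iUnion, Set.mem_image, Set.mem_Icc]
  refine ⟨x.1, ⟨?_, ?_⟩, x.2, ⟨?_, ?_⟩, rfl⟩ <;> by_contra hc <;> apply hx
  · rw [hQ' _ _ (by omega), TensorProduct.tmul_zero]
  · rw [hQ _ _ (by omega), TensorProduct.zero_tmul]
  · rw [hP' _ _ (by omega), TensorProduct.tmul_zero]
  · rw [hP _ _ (by omega), TensorProduct.zero_tmul]

theorem tau_conv_right {K : ℤ → ℤ → E} {L : ℤ → ℤ → F}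
    (h : ∀ p q, (convTerm K L p q).HasFiniteSupport) : tau (conv K L) = conv K (tau L) := by
  funext p q
  rw [tau_apply, conv, conv, conv, ← finsum_sub_distrib (h _ _) (h _ _)]
  apply finsum_congr
  intro x
  rw [convTerm, convTerm, convTerm, tau_apply, TensorProduct.tmul_sub,
    show p + 1 - 1 - x.1 = p - 1 - x.1 + 1 by ring, show q + 1 - 1 - x.2 = q - 1 - x.2 + 1 by ring]

theorem tau_conv_left {K : ℤ → ℤ → E} {L : ℤ → ℤ → F}
    (h : ∀ p q, (convTerm K L p q).HasFiniteSupport) : tau (conv K L) = conv (tau K) L := by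
  funext p q
  let e₁ : ℤ × ℤ ≃ ℤ × ℤ := (Equiv.addRight (1 : ℤ)).prodCongr (Equiv.refl ℤ)
  let e₂ : ℤ × ℤ ≃ ℤ × ℤ := (Equiv.refl ℤ).prodCongr (Equiv.addRight (1 : ℤ))
  rw [tau_apply, conv, conv, conv, ← finsum_comp_equiv e₁ (f := convTerm K L (p + 1) q),
    ← finsum_comp_equiv e₂ (f := convTerm K L p (q + 1)), ← finsum_sub_distrib]
  · apply finsum_congr
    intro x
    simp only [convTerm, tau_apply, TensorProduct.sub_tmul, e₁, e₂, Equiv.prodCongr_apply,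
      Equiv.coe_addRight, Prod.map, Equiv.refl_apply]
    rw [show p + 1 - 1 - (x.1 + 1) = p - 1 - x.1 by ring,
      show q + 1 - 1 - (x.2 + 1) = q - 1 - x.2 by ring]
  · exact (h (p + 1) q).preimage e₁.injective.injOn
  · exact (h p (q + 1)).preimage e₂.injective.injOn

/-- A factor z - w may be attached to either tensor factor, because the shifts of the two indices
can be moved from one to the other by reindexing. Each factor can thus receive exactly the power
that makes its own pair of fields commute. -/
theorem tau_pow_conv {K : ℤ → ℤ → E} {L : ℤ → ℤ → F}
    (h : ∀ i j p q, (convTerm ((tau ^ i) K) ((tau ^ j) L) p q).HasFiniteSupport) (N₁ N₂ : ℕ) :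
    (tau ^ (N₁ + N₂)) (conv K L) = conv ((tau ^ N₁) K) ((tau ^ N₂) L) := by
  have h1 : ∀ N, (tau ^ N) (conv K L) = conv ((tau ^ N) K) L := by
    intro N
    induction N with
    | zero => rfl
    | succ N ih =>
      rw [pow_succ', Module.End.mul_apply, ih, tau_conv_left (K := (tau ^ N) K) (L := L) (h N 0), pow_succ',
        Module.End.mul_apply]
  have h2 : ∀ N, (tau ^ N) (conv ((tau ^ N₁) K) L) = conv ((tau ^ N₁) K) ((tau ^ N) L) := by
    intro N
    induction N with
    | zero => rfl
    | succ N ih =>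
      rw [pow_succ', Module.End.mul_apply, ih, tau_conv_right (h N₁ N), pow_succ',
        Module.End.mul_apply]
  rw [add_comm, pow_add, Module.End.mul_apply, h1, h2]

theorem tmul_finsum_finsum {f : ℤ → E} {g : ℤ → F} (hf : f.HasFiniteSupport)
    (hg : g.HasFiniteSupport) :
    (∑ᶠ i, f i) ⊗ₜ[ℂ] (∑ᶠ j, g j) = ∑ᶠ i, ∑ᶠ j, f i ⊗ₜ[ℂ] g j := by
  have h1 := map_finsum ((TensorProduct.mk ℂ E F).flip (∑ᶠ j, g j)) hf
  simp only [LinearMap.flip_apply, TensorProduct.mk_apply] at h1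
  rw [h1]
  apply finsum_congr
  intro i
  exact map_finsum (TensorProduct.mk ℂ E F (f i)) hg

theorem choose_vandermonde (p q : ℤ) (j : ℕ) :
    ((Ring.choose (p + q) j : ℤ) : ℂ) = ∑ x ∈ Finset.HasAntidiagonal.antidiagonal j,
      ((Ring.choose p x.1 : ℤ) : ℂ) * ((Ring.choose q x.2 : ℤ) : ℂ) := by
  rw [Ring.add_choose_eq j (Commute.all p q)]
  push_cast
  rfl

/-- The Leibniz rule for residues of tensor products. -/
theorem famProd_neg_conv {G : ℤ → ℤ → E} {H : ℤ → ℤ → F} (hGR : TruncR G) (hGL : TruncL G)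
    (hHR : TruncR H) (hHL : TruncL H) (hR : TruncR (conv G H)) (hL : TruncL (conv G H))
    (j : ℕ) (m : ℤ) :
    famProd (-1 - j) (conv G H) (conv G H) m = ∑ x ∈ Finset.HasAntidiagonal.antidiagonal j,
      ∑ᶠ a : ℤ, famProd (-1 - x.1) G G a ⊗ₜ[ℂ] famProd (-1 - x.2) H H (m - 1 - a) := by
  obtain ⟨P₁, hP₁⟩ := id hGL
  obtain ⟨Q₁, hQ₁⟩ := id hGR
  obtain ⟨P₂, hP₂⟩ := id hHL
  obtain ⟨Q₂, hQ₂⟩ := id hHR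
  -- The coordinates are the second index of `G` and the exponents p₁, p₂ of z in `G` and `H`; the
  -- second index of `H` is then forced. The truncations bound p₁ and p₂ below and the first
  -- coordinate above, and the bound on the forced index confines all three.
  let t : ℤ × ℤ × ℤ → E ⊗[ℂ] F := fun y =>
    G (-y.2.1 - 1) y.1 ⊗ₜ H (-y.2.2 - 1) (m - 1 - j + y.2.1 + y.2.2 - y.1)
  have ht : t.HasFiniteSupport := by
    set B : ℤ := |P₁| + |P₂| + |Q₁| + |Q₂| + |m| + j + 10
    refine ((Set.finite_Icc (-(10 * B)) (10 * B)).prod ((Set.finite_Icc (-(10 * B)) (10 * B)).prod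
      (Set.finite_Icc (-(10 * B)) (10 * B)))).subset fun y hy => ?_
    rw [Function.mem_support] at hy
    have h1 : -y.2.1 - 1 < P₁ := by
      by_contra hc; apply hy; simp only [t]; rw [hP₁ _ _ (by omega), TensorProduct.zero_tmul]
    have h2 : y.1 < Q₁ := by
      by_contra hc; apply hy; simp only [t]; rw [hQ₁ _ _ (by omega), TensorProduct.zero_tmul]
    have h3 : -y.2.2 - 1 < P₂ := by
      by_contra hc; apply hy; simp only [t]; rw [hP₂ _ _ (by omega), TensorProduct.tmul_zero]
    have h4 : m - 1 - j + y.2.1 + y.2.2 - y.1 < Q₂ := by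
      by_contra hc; apply hy; simp only [t]; rw [hQ₂ _ _ (by omega), TensorProduct.tmul_zero]
    simp only [Set.mem_prod, Set.mem_Icc]
    have a1 := abs_nonneg P₁; have a2 := abs_nonneg P₂; have a3 := abs_nonneg Q₁
    have a4 := abs_nonneg Q₂; have a5 := abs_nonneg m
    have b1 := le_abs_self P₁; have b2 := le_abs_self P₂; have b3 := le_abs_self Q₁
    have b4 := le_abs_self Q₂; have b5 := le_abs_self m
    have c5 := neg_abs_le m
    refine ⟨⟨?_, ?_⟩, ⟨?_, ?_⟩, ?_, ?_⟩ <;> omega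
  have hts : ∀ c : ℤ × ℤ × ℤ → ℂ, (fun y => c y • t y).HasFiniteSupport := fun c =>
    ht.subset fun y hy => by
      rw [Function.mem_support] at hy ⊢
      intro h; apply hy; rw [h, smul_zero]
  have lhs : famProd (-1 - j) (conv G H) (conv G H) m =
      ∑ᶠ y : ℤ × ℤ × ℤ, ((Ring.choose (y.2.1 + y.2.2) j : ℤ) : ℂ) • t y := by
    rw [famProd_neg hR hL]
    let f : ℤ × ℤ × ℤ → E ⊗[ℂ] F := fun z =>
      ((Ring.choose z.1 j : ℤ) : ℂ) • convTerm G H (-z.1 - 1) (m + z.1 - j) z.2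
    -- The exponent of z in the tensor product is p = p₁ + p₂, and the index pair of `G` in the
    -- convolution is (-p₁ - 1, y.1).
    let e : ℤ × ℤ × ℤ ≃ ℤ × ℤ × ℤ :=
      { toFun := fun y => (y.2.1 + y.2.2, -y.2.1 - 1, y.1)
        invFun := fun z => (z.2.2, -z.2.1 - 1, z.1 + z.2.1 + 1)
        left_inv := fun y => by ext <;> simp <;> ring
        right_inv := fun y => by ext <;> simp }
    have hfe : ∀ y, f (e y) = ((Ring.choose (y.2.1 + y.2.2) j : ℤ) : ℂ) • t y := by
      intro y
      simp only [f, e, t, convTerm, Equiv.coe_fn_mk]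
      rw [show -(y.2.1 + y.2.2) - 1 - 1 - (-y.2.1 - 1) = -y.2.2 - 1 by ring,
        show m + (y.2.1 + y.2.2) - j - 1 - y.1 = m - 1 - j + y.2.1 + y.2.2 - y.1 by ring]
    have hf : f.HasFiniteSupport := by
      have := hts (fun y => ((Ring.choose (y.2.1 + y.2.2) j : ℤ) : ℂ))
      simp only [← hfe] at this
      have h2 := this.preimage e.symm.injective.injOn
      refine Set.Finite.subset h2 fun z hz => ?_
      rw [Function.mem_support] at hz
      change f (e (e.symm z)) ≠ 0
      rwa [Equiv.apply_symm_apply]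
    rw [← finsum_congr hfe, finsum_comp_equiv e, finsum_curry f hf]
    apply finsum_congr
    intro p
    rw [conv, smul_finsum]
  have rhs : ∀ x ∈ Finset.HasAntidiagonal.antidiagonal j,
      ∑ᶠ a : ℤ, famProd (-1 - x.1) G G a ⊗ₜ[ℂ] famProd (-1 - x.2) H H (m - 1 - a) =
      ∑ᶠ y : ℤ × ℤ × ℤ,
        (((Ring.choose y.2.1 x.1 : ℤ) : ℂ) * ((Ring.choose y.2.2 x.2 : ℤ) : ℂ)) • t y := by
    intro x hx
    rw [Finset.HasAntidiagonal.mem_antidiagonal] at hx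
    -- Here the first coordinate is the mode `a` of the first residue, whose summand in p₁ has
    -- second index a + p₁ - x.1.
    let e : ℤ × ℤ × ℤ ≃ ℤ × ℤ × ℤ :=
      { toFun := fun y => (y.1 + y.2.1 - x.1, y.2.1, y.2.2)
        invFun := fun z => (z.1 - z.2.1 + x.1, z.2.1, z.2.2)
        left_inv := fun y => by ext <;> simp <;> ring
        right_inv := fun y => by ext <;> simp <;> ring }
    let c : ℤ × ℤ × ℤ → ℂ := fun y =>
      ((Ring.choose y.2.1 x.1 : ℤ) : ℂ) * ((Ring.choose y.2.2 x.2 : ℤ) : ℂ)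
    have hfe : (fun y => c (e y) • t (e y)).HasFiniteSupport :=
      Set.Finite.preimage e.injective.injOn (hts c)
    rw [← finsum_comp_equiv e (f := fun y => c y • t y), finsum_curry₃ _ hfe]
    apply finsum_congr
    intro a
    rw [famProd_neg hGR hGL, famProd_neg hHR hHL, tmul_finsum_finsum]
    · apply finsum_congr
      intro p₁
      apply finsum_congr
      intro p₂
      simp only [c, e, t, Equiv.coe_fn_mk]
      rw [TensorProduct.tmul_smul, ← TensorProduct.smul_tmul', smul_smul, mul_comm]
      congr 3
      push_cast [← hx]
      ring
    · refine (Set.finite_Icc (-P₁ - 1) (Q₁ - a + x.1)).subset fun p hp => ?_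
      rw [Function.mem_support] at hp
      rw [Set.mem_Icc]
      constructor <;> by_contra hc <;> apply hp
      · rw [hP₁ _ _ (by omega), smul_zero]
      · rw [hQ₁ _ _ (by omega), smul_zero]
    · refine (Set.finite_Icc (-P₂ - 1) (Q₂ - (m - 1 - a) + x.2)).subset fun p hp => ?_
      rw [Function.mem_support] at hp
      rw [Set.mem_Icc]
      constructor <;> by_contra hc <;> apply hp
      · rw [hP₂ _ _ (by omega), smul_zero]
      · rw [hQ₂ _ _ (by omega), smul_zero]
  -- Both sides are now sums of the same vectors `t y`; their coefficients agree by Vandermonde's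
  -- identity for binom(p₁ + p₂, j).
  rw [lhs, Finset.sum_congr rfl rhs, ← finsum_sum_comm _ _ (fun x _ => hts _)]
  apply finsum_congr
  intro y
  rw [choose_vandermonde, Finset.sum_smul]

end Conv

/-! ### Products of fields on a tensor product and regularity of pure tensors. -/

section TensorFields

variable {V W : Type*} [AddCommGroup V] [Module ℂ V] [AddCommGroup W] [Module ℂ W]

theorem isRightType_prodFam (A B : VertexOperator ℂ V) (v : V) : IsRightType (prodFam A B v) := by
  refine ⟨truncR_prodFam A B v, fun q => ?_⟩
  obtain ⟨N, h⟩ := ncoeff_eventually_zero A ((B[[q]]) v)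
  exact ⟨N, h⟩

theorem isLeftType_prodFamOp (A B : VertexOperator ℂ V) (v : V) :
    IsLeftType (prodFamOp A B v) := by
  refine ⟨truncL_prodFamOp A B v, fun q => ?_⟩
  obtain ⟨N, h⟩ := ncoeff_eventually_zero B ((A[[q]]) v)
  exact ⟨N, h⟩

theorem tensorField_tmul (A : VertexOperator ℂ V) (B : VertexOperator ℂ W) (n : ℤ) (v : V) (w : W) :
    ((tensorField A B)[[n]]) (v ⊗ₜ w) = ∑ᶠ i : ℤ, (A[[i]]) v ⊗ₜ[ℂ] (B[[n - 1 - i]]) w := by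
  rw [tensorField_apply]; rfl

theorem finite_tensorField_tmul (A : VertexOperator ℂ V) (B : VertexOperator ℂ W) (n : ℤ) (v : V)
    (w : W) : (fun i : ℤ => (A[[i]]) v ⊗ₜ[ℂ] (B[[n - 1 - i]]) w).HasFiniteSupport :=
  tensor_finite A B n (v ⊗ₜ w)

theorem prodFam_tensorField (A C : VertexOperator ℂ V) (B D : VertexOperator ℂ W) (v : V) (w : W) :
    prodFam (tensorField A B) (tensorField C D) (v ⊗ₜ w) =
      conv (prodFam A C v) (prodFam B D w) := by
  funext p q
  have hfin := (isRightType_prodFam A C v).finite (isRightType_prodFam B D w) p q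
  have hfin' := hfin.preimage (Equiv.prodComm ℤ ℤ).injective.injOn
  rw [conv, prodFam, tensorField_tmul, map_finsum _ (finite_tensorField_tmul C D q v w),
    ← finsum_comp_equiv (Equiv.prodComm ℤ ℤ), finsum_curry _ hfin']
  apply finsum_congr
  intro s
  rw [tensorField_tmul]
  rfl

theorem prodFamOp_tensorField (A C : VertexOperator ℂ V) (B D : VertexOperator ℂ W) (v : V)
    (w : W) : prodFamOp (tensorField A B) (tensorField C D) (v ⊗ₜ w) =
      conv (prodFamOp A C v) (prodFamOp B D w) := by
  funext p q
  have hfin := (isLeftType_prodFamOp A C v).finite (isLeftType_prodFamOp B D w) p q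
  rw [conv, prodFamOp, tensorField_tmul, map_finsum _ (finite_tensorField_tmul A B p v w),
    finsum_curry _ hfin]
  apply finsum_congr
  intro s
  rw [tensorField_tmul]
  rfl

theorem finite_conv_prodFam (A C : VertexOperator ℂ V) (B D : VertexOperator ℂ W) (v : V) (w : W)
    (i j : ℕ) (p q : ℤ) : (convTerm ((tau ^ i) (prodFam A C v)) ((tau ^ j) (prodFam B D w)) p
      q).HasFiniteSupport :=
  IsRightType.finite (pow_invariant (p := IsRightType) (fun _ h => h.tau) i
    (isRightType_prodFam A C v)) (pow_invariant (p := IsRightType) (fun _ h => h.tau) j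
    (isRightType_prodFam B D w)) p q

theorem finite_conv_prodFamOp (A C : VertexOperator ℂ V) (B D : VertexOperator ℂ W) (v : V) (w : W)
    (i j : ℕ) (p q : ℤ) : (convTerm ((tau ^ i) (prodFamOp A C v)) ((tau ^ j) (prodFamOp B D w)) p
      q).HasFiniteSupport :=
  IsLeftType.finite (pow_invariant (p := IsLeftType) (fun _ h => h.tau) i
    (isLeftType_prodFamOp A C v)) (pow_invariant (p := IsLeftType) (fun _ h => h.tau) j
    (isLeftType_prodFamOp B D w)) p q

theorem LocalOrder.tensor_apply {A C : VertexOperator ℂ V} {B D : VertexOperator ℂ W} {N₁ N₂ : ℕ}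
    (h₁ : LocalOrder N₁ A C) (h₂ : LocalOrder N₂ B D) (v : V) (w : W) :
    (tau ^ (N₁ + N₂)) (prodFam (tensorField A B) (tensorField C D) (v ⊗ₜ w)) =
      (tau ^ (N₁ + N₂)) (prodFamOp (tensorField A B) (tensorField C D) (v ⊗ₜ w)) := by
  rw [prodFam_tensorField, prodFamOp_tensorField, tau_pow_conv (finite_conv_prodFam A C B D v w),
    tau_pow_conv (finite_conv_prodFamOp A C B D v w), h₁ v, h₂ w]

theorem LocalOrder.tensor {A C : VertexOperator ℂ V} {B D : VertexOperator ℂ W} {N₁ N₂ : ℕ}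
    (h₁ : LocalOrder N₁ A C) (h₂ : LocalOrder N₂ B D) :
    LocalOrder (N₁ + N₂) (tensorField A B) (tensorField C D) := by
  intro u
  induction u using TensorProduct.induction_on with
  | zero =>
    have e1 : prodFam (tensorField A B) (tensorField C D) 0 = 0 := by funext p q; simp [prodFam]
    have e2 : prodFamOp (tensorField A B) (tensorField C D) 0 = 0 := by
      funext p q; simp [prodFamOp]
    rw [e1, e2]
  | tmul v w => exact h₁.tensor_apply h₂ v w
  | add x y hx hy =>
    have e1 : prodFam (tensorField A B) (tensorField C D) (x + y) =
      prodFam (tensorField A B) (tensorField C D) x +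
        prodFam (tensorField A B) (tensorField C D) y := by funext p q; simp [prodFam]
    have e2 : prodFamOp (tensorField A B) (tensorField C D) (x + y) =
      prodFamOp (tensorField A B) (tensorField C D) x +
        prodFamOp (tensorField A B) (tensorField C D) y := by funext p q; simp [prodFamOp]
    rw [e1, e2, map_add, map_add, hx, hy]

theorem fieldProd_eq_zero {A B : VertexOperator ℂ V} {N : ℕ} (h : LocalOrder N A B) {n : ℤ}
    (hn : N ≤ n) : fieldProd A n B = 0 := by
  apply field_ext
  intro m v
  rw [fieldProd_ncoeff, famProd_eq_zero (truncR_prodFam _ _ _) (truncL_prodFamOp _ _ _) (h v) hn]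
  simp

theorem famProd_tau_pow_prodFam (A B : VertexOperator ℂ V) (v : V) {N : ℕ} (h : LocalOrder N A B)
    (n m : ℤ) : famProd n ((tau ^ N) (prodFam A B v)) ((tau ^ N) (prodFam A B v)) m =
      ((fieldProd A (n + N) B)[[m]]) v := by
  rw [fieldProd_ncoeff, ← famProd_tau_pow (truncR_prodFam _ _ _) (truncL_prodFamOp _ _ _), h v]

/-- The products of tensor products of pairs of mutually local fields. -/
theorem fieldProd_tensorField {A C : VertexOperator ℂ V} {B D : VertexOperator ℂ W}
    (h₁ : IsLocal A C) (h₂ : IsLocal B D) (k m : ℤ) (v : V) (w : W) :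
    ((fieldProd (tensorField A B) k (tensorField C D))[[m]]) (v ⊗ₜ w) =
      ∑ᶠ i : ℤ, ((tensorField (fieldProd A i C) (fieldProd B (k - 1 - i) D))[[m]]) (v ⊗ₜ w) := by
  obtain ⟨N₁, h₁⟩ := h₁
  obtain ⟨N₂, h₂⟩ := h₂
  have hz₁ : ∀ i : ℤ, N₁ ≤ i →
      ((tensorField (fieldProd A i C) (fieldProd B (k - 1 - i) D))[[m]]) (v ⊗ₜ w) = 0 := by
    intro i hi
    rw [fieldProd_eq_zero h₁ hi, tensorField_tmul]
    simp
  have hz₂ : ∀ i : ℤ, N₂ ≤ k - 1 - i →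
      ((tensorField (fieldProd A i C) (fieldProd B (k - 1 - i) D))[[m]]) (v ⊗ₜ w) = 0 := by
    intro i hi
    rw [fieldProd_eq_zero h₂ hi, tensorField_tmul]
    simp
  by_cases hk : N₁ + N₂ ≤ k
  · rw [fieldProd_eq_zero (h₁.tensor h₂) (by exact_mod_cast hk), finsum_eq_zero_of_forall_eq_zero]
    · simp
    · intro i
      by_cases hi : N₁ ≤ i
      · exact hz₁ i hi
      · exact hz₂ i (by omega)
  -- Writing k = -1 - j + (N₁ + N₂) spends N₁ + N₂ factors z - w on locality. What remains is the
  -- exponent -1 - j applied to a distribution on which both orderings agree, where the Leibniz rule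
  -- for residues is available.
  · obtain ⟨j, hj⟩ := Int.eq_ofNat_of_zero_le (show 0 ≤ N₁ + N₂ - 1 - k by omega)
    have hkj : k = -1 - j + (N₁ + N₂ : ℕ) := by push_cast; omega
    have hR := TruncR.tau_pow (truncR_prodFam (tensorField A B) (tensorField C D) (v ⊗ₜ w))
      (N₁ + N₂)
    have hL := TruncL.tau_pow (truncL_prodFamOp (tensorField A B) (tensorField C D) (v ⊗ₜ w))
      (N₁ + N₂)
    rw [← h₁.tensor_apply h₂] at hL
    have hG₁ := TruncL.tau_pow (truncL_prodFamOp A C v) N₁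
    rw [← h₁ v] at hG₁
    have hG₂ := TruncL.tau_pow (truncL_prodFamOp B D w) N₂
    rw [← h₂ w] at hG₂
    have step := famProd_tau_pow_prodFam _ _ (v ⊗ₜ[ℂ] w) (h₁.tensor h₂) (-1 - j) m
    rw [← hkj] at step
    rw [prodFam_tensorField, tau_pow_conv (finite_conv_prodFam A C B D v w)] at step hR hL
    rw [← step, famProd_neg_conv (TruncR.tau_pow (truncR_prodFam A C v) N₁) hG₁
      (TruncR.tau_pow (truncR_prodFam B D w) N₂) hG₂ hR hL]
    let f : ℕ × ℕ ↪ ℤ × ℤ := ⟨fun x => (x.1, x.2), fun a b h => by ext <;> simp_all⟩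
    have key : ∀ x ∈ Finset.HasAntidiagonal.antidiagonal j,
        ∑ᶠ a : ℤ, famProd (-1 - x.1) ((tau ^ N₁) (prodFam A C v)) ((tau ^ N₁) (prodFam A C v)) a ⊗ₜ
          famProd (-1 - x.2) ((tau ^ N₂) (prodFam B D w)) ((tau ^ N₂) (prodFam B D w))
            (m - 1 - a) =
        ((tensorField (fieldProd A (N₁ - 1 - x.1) C)
          (fieldProd B (k - 1 - (N₁ - 1 - x.1)) D))[[m]]) (v ⊗ₜ w) := by
      intro x hx
      rw [Finset.HasAntidiagonal.mem_antidiagonal] at hx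
      rw [tensorField_tmul]
      apply finsum_congr
      intro a
      rw [famProd_tau_pow_prodFam _ _ _ h₁, famProd_tau_pow_prodFam _ _ _ h₂,
        show -1 - (x.1 : ℤ) + N₁ = N₁ - 1 - x.1 by ring,
        show -1 - (x.2 : ℤ) + N₂ = k - 1 - (N₁ - 1 - x.1) by push_cast [hkj, ← hx]; ring]
    -- Only indices with i < N₁ and k - 1 - i < N₂ contribute. These are i = N₁ - 1 - a with 0 ≤ a ≤
    -- j.
    rw [Finset.sum_congr rfl key, Finset.Nat.sum_antidiagonal_eq_sum_range_succ_mk,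
      finsum_eq_sum_of_support_subset (s := (Finset.range (j + 1)).image
        fun a : ℕ => (N₁ : ℤ) - 1 - a), Finset.sum_image]
    · intro a _ b _ hab
      simpa using hab
    · intro i hi
      rw [Function.mem_support] at hi
      have h1 : i < N₁ := by
        by_contra hc; exact hi (hz₁ i (by omega))
      have h2 : k - 1 - i < N₂ := by
        by_contra hc; exact hi (hz₂ i (by omega))
      simp only [Finset.coe_image, Finset.coe_range, Set.mem_image, Set.mem_Iio]
      exact ⟨(N₁ - 1 - i).toNat, by omega, by omega⟩

variable [VertexStructure V] [VertexStructure W]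

theorem Y_tmul (a : V) (b : W) : VertexStructure.Y (a ⊗ₜ[ℂ] b) =
    tensorField (VertexStructure.Y a) (VertexStructure.Y b) := rfl

theorem nthProd_tmul_finite (a c : V) (b d : W) (n : ℤ) :
    (fun i : ℤ => nthProd a i c ⊗ₜ[ℂ] nthProd b (n - 1 - i) d).HasFiniteSupport :=
  finite_tensorField_tmul _ _ _ _ _

/-- On pure tensors the product of states and the product of tensor fields are the same sum over i,
by `nthProd_tmul` and `fieldProd_tensorField`. Associativity in the two factors then identifies the
summands. -/
theorem IsRegular.tmul {a : V} {b : W} (ha : IsRegular a) (hb : IsRegular b) :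
    IsRegular (a ⊗ₜ[ℂ] b) where
  assoc n u := by
    induction u using TensorProduct.induction_on with
    | zero =>
      have h : nthProd (a ⊗ₜ[ℂ] b) n (0 : V ⊗[ℂ] W) = 0 := by simp [nthProd]
      rw [h, map_zero]
      exact (LinearMap.map_zero (fieldProdLin n (VertexStructure.Y (a ⊗ₜ[ℂ] b)))).symm
    | add x y hx hy =>
      have h : nthProd (a ⊗ₜ[ℂ] b) n (x + y) =
          nthProd (a ⊗ₜ[ℂ] b) n x + nthProd (a ⊗ₜ[ℂ] b) n y := by simp [nthProd]
      rw [h, map_add, map_add, hx, hy]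
      exact (LinearMap.map_add (fieldProdLin n (VertexStructure.Y (a ⊗ₜ[ℂ] b))) _ _).symm
    | tmul c d =>
      apply field_ext
      intro m u
      induction u using TensorProduct.induction_on with
      | zero => simp
      | add x y hx hy => rw [map_add, map_add, hx, hy]
      | tmul v w =>
        let ev : VertexOperator ℂ (V ⊗[ℂ] W) →ₗ[ℂ] V ⊗[ℂ] W :=
          { toFun := fun A => (A[[m]]) (v ⊗ₜ w)
            map_add' := fun A B => by simp
            map_smul' := fun r A => by simp }
        have h := map_finsum (ev.comp VertexStructure.Y) (nthProd_tmul_finite a c b d n)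
        rw [Y_tmul, Y_tmul, fieldProd_tensorField (ha.isLocal c) (hb.isLocal d), nthProd_tmul]
        refine h.trans (finsum_congr fun i => ?_)
        change ((VertexStructure.Y (nthProd a i c ⊗ₜ[ℂ] nthProd b (n - 1 - i) d))[[m]]) _ = _
        rw [Y_tmul, ha.assoc, hb.assoc]
  isLocal u := by
    induction u using TensorProduct.induction_on with
    | zero => exact ⟨0, fun v => by funext p q; simp [prodFam, prodFamOp]⟩
    | add x y hx hy => rw [map_add]; exact hx.add hy
    | tmul c d =>
      obtain ⟨N₁, h₁⟩ := ha.isLocal c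
      obtain ⟨N₂, h₂⟩ := hb.isLocal d
      exact ⟨N₁ + N₂, h₁.tensor h₂⟩

end TensorFields

/-! ### Regularity of the vacuum and of x[-1], x[-2]. -/

namespace UnivAffine

variable {g : Type*} [LieRing g] [LieAlgebra ℂ g] (κ : InvForm g)

theorem isRegular_vac : IsRegular (VertexStructure.vac : UnivAffine κ) where
  assoc n b := by
    rw [nthProd_vac, Y_vac, idField_fieldProd]
    split_ifs <;> simp
  isLocal b := by rw [Y_vac]; exact (isLocal_idField _).symm

theorem isRegular_vec_neg_one (x : g) : IsRegular (vec κ x (-1)) where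
  assoc n b := by rw [nthProd_vec_neg_one, Y_act, Y_vec_neg_one]
  isLocal b := by rw [Y_vec_neg_one]; exact isLocal_current_Y κ x b

theorem isRegular_vec_neg_two (x : g) : IsRegular (vec κ x (-2)) where
  assoc n b := by rw [nthProd_vec_neg_two, map_smul, Y_act, Y_vec, fieldProd_deriv]
  isLocal b := by
    rw [Y_vec]
    exact ((isLocal_current_Y κ x b).symm.fieldProd (isLocal_idField _)
      (isLocal_idField _) (-2)).symm

end UnivAffine

/-! ### Words in creation modes, their degree filtration and reordering. -/

section Words

variable {E I : Type*} [AddCommGroup E] [Module ℂ E]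

/-- The vector `X_{i₁, -n₁-1} ⋯ X_{i_r, -n_r-1} Ω`. -/
def word (X : I → ℤ → Module.End ℂ E) (Ω : E) : List (I × ℕ) → E
  | [] => Ω
  | a :: l => X a.1 (-(a.2 : ℤ) - 1) (word X Ω l)

/-- The degree of a word. -/
def wordDeg (deg : I → ℕ) (l : List (I × ℕ)) : ℕ := (l.map fun a => deg a.1).sum

/-- The span of the words of degree less than `D`. -/
def wordSpan (X : I → ℤ → Module.End ℂ E) (Ω : E) (deg : I → ℕ) (D : ℕ) : Submodule ℂ E :=
  Submodule.span ℂ {v | ∃ l, wordDeg deg l < D ∧ v = word X Ω l}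

/-- The span of `w` and its images under the operators and products of two operators of degree at
most `D`. -/
def quadSpan (X : I → ℤ → Module.End ℂ E) (deg : I → ℕ) (D : ℕ) (w : E) : Submodule ℂ E :=
  Submodule.span ℂ ({w} ∪ {v | ∃ a p, deg a ≤ D ∧ v = X a p w} ∪
    {v | ∃ a p b q, deg a + deg b ≤ D ∧ v = X a p (X b q w)})

variable {X : I → ℤ → Module.End ℂ E} {Ω : E} {deg : I → ℕ}

theorem self_mem_quadSpan (D : ℕ) (w : E) : w ∈ quadSpan X deg D w :=
  Submodule.subset_span (Or.inl (Or.inl rfl))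

theorem apply_mem_quadSpan {D : ℕ} (w : E) {a : I} (p : ℤ) (h : deg a ≤ D) :
    X a p w ∈ quadSpan X deg D w :=
  Submodule.subset_span (Or.inl (Or.inr ⟨a, p, h, rfl⟩))

theorem apply_apply_mem_quadSpan {D : ℕ} (w : E) {a b : I} (p q : ℤ) (h : deg a + deg b ≤ D) :
    X a p (X b q w) ∈ quadSpan X deg D w :=
  Submodule.subset_span (Or.inr ⟨a, p, b, q, h, rfl⟩)

theorem wordSpan_mono {D D' : ℕ} (h : D ≤ D') : wordSpan X Ω deg D ≤ wordSpan X Ω deg D' :=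
  Submodule.span_mono fun _ ⟨l, hl, hv⟩ => ⟨l, by omega, hv⟩

theorem word_mem_wordSpan {l : List (I × ℕ)} {D : ℕ} (h : wordDeg deg l < D) :
    word X Ω l ∈ wordSpan X Ω deg D := Submodule.subset_span ⟨l, h, rfl⟩

theorem neg_apply_mem_wordSpan {D : ℕ} (i : I) (m : ℕ) {w : E} (hw : w ∈ wordSpan X Ω deg D) :
    X i (-(m : ℤ) - 1) w ∈ wordSpan X Ω deg (D + deg i) := by
  induction hw using Submodule.span_induction with
  | zero => rw [map_zero]; exact zero_mem _
  | add u v _ _ hu hv => rw [map_add]; exact add_mem hu hv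
  | smul a u _ hu => rw [map_smul]; exact Submodule.smul_mem _ _ hu
  | mem u hu =>
    obtain ⟨l, hl, rfl⟩ := hu
    refine Submodule.subset_span ⟨(i, m) :: l, ?_, rfl⟩
    simp only [wordDeg, List.map_cons, List.sum_cons] at hl ⊢
    omega

/-- Operators whose commutators are expressed through operators and products of two operators of
smaller total degree, and which kill `Ω` in the nonnegative modes. -/
structure IsWordSystem (X : I → ℤ → Module.End ℂ E) (Ω : E) (deg : I → ℕ) : Prop where
  deg_pos : ∀ i, 0 < deg i
  vac : ∀ i m, 0 ≤ m → X i m Ω = 0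
  comm : ∀ i k m n w, X i m (X k n w) - X k n (X i m w) ∈ quadSpan X deg (deg i + deg k - 1) w

namespace IsWordSystem

variable (h : IsWordSystem X Ω deg)
include h

/-- Strong induction on D + deg i. A creation mode just prepends a letter. An annihilation mode is
moved past the first letter until it meets the vacuum; the commutators that arise act on a shorter
word with smaller total degree, so the induction hypothesis covers them, applied twice for a product
of two operators. -/
theorem apply_mem (S : ℕ) : ∀ (D : ℕ) (i : I), D + deg i = S → ∀ (m : ℤ) (w : E),
    w ∈ wordSpan X Ω deg D → X i m w ∈ wordSpan X Ω deg (D + deg i) := by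
  induction S using Nat.strong_induction_on with
  | _ S ih =>
    intro D i hS m w hw
    induction hw using Submodule.span_induction with
    | zero => rw [map_zero]; exact zero_mem _
    | add u v _ _ hu hv => rw [map_add]; exact add_mem hu hv
    | smul a u _ hu => rw [map_smul]; exact Submodule.smul_mem _ _ hu
    | mem u hu =>
      obtain ⟨l, hl, rfl⟩ := hu
      by_cases hm : m < 0
      · obtain ⟨r, hr⟩ := Int.eq_ofNat_of_zero_le (show 0 ≤ -1 - m by omega)
        obtain rfl : m = -(r : ℤ) - 1 := by omega
        exact neg_apply_mem_wordSpan i r (word_mem_wordSpan hl)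
      cases l with
      | nil => rw [word, h.vac i m (by omega)]; exact zero_mem _
      | cons k l =>
        have hk := h.deg_pos k.1
        simp only [wordDeg, List.map_cons, List.sum_cons] at hl
        change deg k.1 + wordDeg deg l < D at hl
        -- The levels of `wordSpan` are strict upper bounds, so a word of degree d lies in level d +
        -- 1.
        have hw' : word X Ω l ∈ wordSpan X Ω deg (wordDeg deg l + 1) :=
          word_mem_wordSpan (by omega)
        rw [word]
        have split : X i m (X k.1 (-(k.2 : ℤ) - 1) (word X Ω l)) =
            X k.1 (-(k.2 : ℤ) - 1) (X i m (word X Ω l)) +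
            (X i m (X k.1 (-(k.2 : ℤ) - 1) (word X Ω l)) -
              X k.1 (-(k.2 : ℤ) - 1) (X i m (word X Ω l))) := by abel
        rw [split]
        refine add_mem ?_ ?_
        · refine wordSpan_mono ?_ (neg_apply_mem_wordSpan k.1 k.2
            (ih _ ?_ (wordDeg deg l + 1) i rfl m _ hw')) <;> omega
        · have hc := h.comm i k.1 m (-(k.2 : ℤ) - 1) (word X Ω l)
          refine (Submodule.span_le.2 ?_ : quadSpan X deg _ _ ≤ wordSpan X Ω deg (D + deg i)) hc
          rintro v ((rfl | ⟨a, p, ha, rfl⟩) | ⟨a, p, b, q, hab, rfl⟩)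
          · exact wordSpan_mono (by omega) hw'
          · exact wordSpan_mono (by omega)
              (ih _ (by omega) (wordDeg deg l + 1) a rfl p _ hw')
          · have h1 := ih (wordDeg deg l + 1 + deg b) (by omega) (wordDeg deg l + 1) b rfl q _ hw'
            exact wordSpan_mono (by omega)
              (ih _ (by omega) (wordDeg deg l + 1 + deg b) a rfl p _ h1)

theorem quadSpan_le {D D' : ℕ} {w : E} (hw : w ∈ wordSpan X Ω deg D) :
    quadSpan X deg D' w ≤ wordSpan X Ω deg (D + D') := by
  refine Submodule.span_le.2 ?_
  rintro v ((rfl | ⟨a, p, ha, rfl⟩) | ⟨a, p, b, q, hab, rfl⟩)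
  · exact wordSpan_mono (by omega) hw
  · exact wordSpan_mono (by omega) (h.apply_mem _ D a rfl p _ hw)
  · exact wordSpan_mono (by omega) (h.apply_mem _ _ a rfl p _ (h.apply_mem _ D b rfl q _ hw))

/-- An adjacent transposition costs one commutator, of total degree lower by at least one than the
two letters it replaces; prefixes and composites preserve this drop. So a word is determined by its
multiset of letters modulo words of strictly lower degree. -/
theorem word_sub_word_mem {l l' : List (I × ℕ)} (hp : l.Perm l') :
    word X Ω l - word X Ω l' ∈ wordSpan X Ω deg (wordDeg deg l) := by
  induction hp with
  | nil => rw [sub_self]; exact zero_mem _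
  | cons x hp ih =>
    rw [word, word, ← map_sub]
    refine wordSpan_mono ?_ (neg_apply_mem_wordSpan x.1 x.2 ih)
    simp only [wordDeg, List.map_cons, List.sum_cons]
    omega
  | swap x y l =>
    rw [word, word, word, word]
    refine wordSpan_mono ?_ (h.quadSpan_le (word_mem_wordSpan (Nat.lt_succ_self _))
      (h.comm _ _ _ _ (word X Ω l)))
    have := h.deg_pos x.1
    simp only [wordDeg, List.map_cons, List.sum_cons]
    omega
  | trans hp hp' ih ih' =>
    have hd : wordDeg deg _ = wordDeg deg _ := (hp.map fun a : I × ℕ => deg a.1).sum_eq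
    rw [← hd] at ih'
    have := add_mem ih ih'
    rwa [sub_add_sub_cancel] at this

/-- Words span the same space as the words attached to multisets. -/
theorem wordSpan_le_span_multiset (D : ℕ) : wordSpan X Ω deg D ≤
    Submodule.span ℂ (Set.range fun s : Multiset (I × ℕ) => word X Ω s.toList) := by
  induction D using Nat.strong_induction_on with
  | _ D ih =>
    refine Submodule.span_le.2 ?_
    rintro v ⟨l, hl, rfl⟩
    have hp : l.Perm (Multiset.toList (l : Multiset (I × ℕ))) := by
      rw [← Multiset.coe_eq_coe, Multiset.coe_toList]
    have := add_mem (ih _ hl (h.word_sub_word_mem hp))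
      (Submodule.subset_span ⟨(l : Multiset (I × ℕ)), rfl⟩)
    rwa [sub_add_cancel] at this

end IsWordSystem

/-- The span of all words. -/
def allWordSpan (X : I → ℤ → Module.End ℂ E) (Ω : E) : Submodule ℂ E :=
  Submodule.span ℂ (Set.range (word X Ω))

theorem wordSpan_le_allWordSpan (D : ℕ) : wordSpan X Ω deg D ≤ allWordSpan X Ω :=
  Submodule.span_mono fun _ ⟨l, _, hv⟩ => ⟨l, hv.symm⟩

theorem IsWordSystem.apply_mem_allWordSpan (h : IsWordSystem X Ω deg) (i : I) (m : ℤ) {w : E}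
    (hw : w ∈ allWordSpan X Ω) : X i m w ∈ allWordSpan X Ω := by
  induction hw using Submodule.span_induction with
  | zero => rw [map_zero]; exact zero_mem _
  | add u v _ _ hu hv => rw [map_add]; exact add_mem hu hv
  | smul a u _ hu => rw [map_smul]; exact Submodule.smul_mem _ _ hu
  | mem u hu =>
    obtain ⟨l, rfl⟩ := hu
    exact wordSpan_le_allWordSpan (deg := deg) _ (h.apply_mem _ _ i rfl m _
      (word_mem_wordSpan (Nat.lt_succ_self _)))

theorem IsWordSystem.allWordSpan_eq (h : IsWordSystem X Ω deg) : allWordSpan X Ω =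
    Submodule.span ℂ (Set.range fun s : Multiset (I × ℕ) => word X Ω s.toList) := by
  apply le_antisymm
  · refine Submodule.span_le.2 ?_
    rintro v ⟨l, rfl⟩
    exact h.wordSpan_le_span_multiset _ (word_mem_wordSpan (Nat.lt_succ_self _))
  · exact Submodule.span_mono fun _ ⟨s, hv⟩ => ⟨s.toList, hv⟩

theorem map_word {F : Type*} [AddCommGroup F] [Module ℂ F] {X' : I → ℤ → Module.End ℂ F} {Ω' : F}
    (f : E →ₗ[ℂ] F) (hΩ : f Ω = Ω') (hX : ∀ i m v, f (X i m v) = X' i m (f v))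
    (l : List (I × ℕ)) : f (word X Ω l) = word X' Ω' l := by
  induction l with
  | nil => exact hΩ
  | cons a l ih => rw [word, word, hX, ih]

end Words

/-! ### Modes of regular states, quadratic commutators and generated subalgebras. -/

section RegularStates

variable {V : Type*} [AddCommGroup V] [Module ℂ V] [VertexStructure V]

/-- Locality expresses the commutator of modes through the nonnegative products of the two fields,
and associativity identifies these with the fields of the states a_(j) b. -/
theorem IsRegular.exists_commutator {a : V} (ha : IsRegular a) (b : V) : ∃ N : ℕ, ∀ (m n : ℤ) (v : V),
    nthProd a m (nthProd b n v) - nthProd b n (nthProd a m v) =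
      ∑ j ∈ Finset.range N, ((Ring.choose m j : ℤ) : ℂ) •
        nthProd (nthProd a j b) (m + n - j) v := by
  obtain ⟨N, h⟩ := ha.isLocal b
  refine ⟨N, fun m n v => ?_⟩
  have := sub_eq_sum_famProd (truncR_prodFam _ _ v) (truncL_prodFamOp _ _ v) (h v) m n
  refine this.trans (Finset.sum_congr rfl fun j _ => ?_)
  rw [← fieldProd_ncoeff, ← ha.assoc]
  rfl

/-- The modes of `a_{(k)} b` are obtained from products of modes of `a` and `b`. -/
theorem IsRegular.nthProd_nthProd_mem {a : V} (ha : IsRegular a) {b v : V} (k m : ℤ)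
    {S : Submodule ℂ V} (h₁ : ∀ p q, nthProd a p (nthProd b q v) ∈ S)
    (h₂ : ∀ p q, nthProd b p (nthProd a q v) ∈ S) : nthProd (nthProd a k b) m v ∈ S := by
  rw [nthProd, ha.assoc, fieldProd_ncoeff, famProd]
  obtain ⟨N₁, hN₁⟩ := (truncR_prodFam (VertexStructure.Y a) (VertexStructure.Y b) v).exists_range k m
  obtain ⟨N₂, hN₂⟩ :=
    (truncL_prodFamOp (VertexStructure.Y a) (VertexStructure.Y b) v).exists_range k m
  rw [famLeft_range _ _ hN₁, famRight_range _ _ hN₂]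
  exact sub_mem (sum_mem fun l _ => S.smul_mem _ (h₁ _ _)) (sum_mem fun l _ => S.smul_mem _ (h₂ _ _))

/-- The vacuum acts as the identity. -/
def HasVacuumIdentity (V : Type*) [AddCommGroup V] [Module ℂ V] [VertexStructure V] : Prop :=
  VertexStructure.Y (VertexStructure.vac : V) = idField V

theorem HasVacuumIdentity.nthProd_vac (hV : HasVacuumIdentity V) (m : ℤ) (v : V) :
    nthProd VertexStructure.vac m v = if m = -1 then v else 0 := by
  rw [nthProd, hV, idField_ncoeff]

theorem IsRegular.nthProd_translation (hV : HasVacuumIdentity V) {a : V} (ha : IsRegular a) (m : ℤ)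
    (b : V) : nthProd (translation a) m b = (-(m : ℂ)) • nthProd a (m - 1) b := by
  rw [nthProd, translation, ha.assoc, hV, fieldProd_neg_two_idField]
  rfl

/-- The creation property of a state. -/
structure IsCreative (a : V) : Prop where
  nonneg : ∀ m : ℤ, 0 ≤ m → nthProd a m VertexStructure.vac = 0
  neg_one : nthProd a (-1) VertexStructure.vac = a

theorem IsCreative.add {a b : V} (ha : IsCreative a) (hb : IsCreative b) : IsCreative (a + b) := by
  have h : ∀ m v, nthProd (a + b) m v = nthProd a m v + nthProd b m v := fun m v => by
    simp [nthProd]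
  exact ⟨fun m hm => by rw [h, ha.nonneg m hm, hb.nonneg m hm, add_zero],
    by rw [h, ha.neg_one, hb.neg_one]⟩

theorem IsCreative.smul {a : V} (ha : IsCreative a) (r : ℂ) : IsCreative (r • a) := by
  have h : ∀ m v, nthProd (r • a) m v = r • nthProd a m v := fun m v => by
    simp [nthProd]
  exact ⟨fun m hm => by rw [h, ha.nonneg m hm, smul_zero], by rw [h, ha.neg_one]⟩

theorem IsCreative.zero : IsCreative (0 : V) :=
  ⟨fun m _ => by simp [nthProd], by simp [nthProd]⟩

theorem IsCreative.sub {a b : V} (ha : IsCreative a) (hb : IsCreative b) : IsCreative (a - b) := by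
  have := ha.add (hb.smul (-1))
  rwa [neg_one_smul, ← sub_eq_add_neg] at this

theorem IsCreative.sum {ι : Type*} (s : Finset ι) {a : ι → V} (h : ∀ i, IsCreative (a i)) :
    IsCreative (∑ i ∈ s, a i) := by
  classical
  induction s using Finset.induction_on with
  | empty => exact IsCreative.zero
  | insert i s hi ih => rw [Finset.sum_insert hi]; exact (h i).add ih

theorem IsCreative.tmul {W : Type*} [AddCommGroup W] [Module ℂ W] [VertexStructure W] {a : V}
    {b : W} (ha : IsCreative a) (hb : IsCreative b) : IsCreative (a ⊗ₜ[ℂ] b) where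
  nonneg m hm := by
    refine (nthProd_tmul _ _ _ _ _).trans (finsum_eq_zero_of_forall_eq_zero fun i => ?_)
    by_cases hi : 0 ≤ i
    · rw [ha.nonneg i hi, TensorProduct.zero_tmul]
    · rw [hb.nonneg _ (by omega), TensorProduct.tmul_zero]
  neg_one := by
    refine (nthProd_tmul _ _ _ _ _).trans ((finsum_eq_single _ (-1) fun i hi => ?_).trans ?_)
    · by_cases hi : 0 ≤ i
      · rw [ha.nonneg i hi, TensorProduct.zero_tmul]
      · rw [hb.nonneg _ (by omega), TensorProduct.tmul_zero]
    · rw [ha.neg_one, show (-1 : ℤ) - 1 - -1 = -1 by norm_num, hb.neg_one]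

theorem HasVacuumIdentity.tensor {W : Type*} [AddCommGroup W] [Module ℂ W] [VertexStructure W]
    (hV : HasVacuumIdentity V) (hW : HasVacuumIdentity W) : HasVacuumIdentity (V ⊗[ℂ] W) := by
  change tensorField (VertexStructure.Y VertexStructure.vac)
    (VertexStructure.Y VertexStructure.vac) = _
  rw [hV, hW]
  apply field_ext
  intro m u
  induction u using TensorProduct.induction_on with
  | zero => simp
  | add x y hx hy => rw [map_add, map_add, hx, hy]
  | tmul v w =>
    rw [tensorField_tmul, finsum_eq_single _ (-1), idField_ncoeff, idField_ncoeff, idField_ncoeff,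
      if_pos rfl]
    · by_cases hm : m = -1
      · rw [if_pos (by omega), if_pos hm]
      · rw [if_neg (by omega), if_neg hm, TensorProduct.tmul_zero]
    · intro i hi
      rw [idField_ncoeff, if_neg hi, TensorProduct.zero_tmul]

variable {I : Type*}

/-- The modes of the states `w i`. -/
def modes (w : I → V) (i : I) (m : ℤ) : Module.End ℂ V := (VertexStructure.Y (w i))[[m]]

theorem modes_apply (w : I → V) (i : I) (m : ℤ) (v : V) : modes w i m v = nthProd (w i) m v := rfl

/-- The modes of `s` are expressed through modes and products of two modes of the `w i` of total
degree at most `D`. -/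
def HasQuadModes (w : I → V) (deg : I → ℕ) (D : ℕ) (s : V) : Prop :=
  ∀ (p : ℤ) (v : V), nthProd s p v ∈ quadSpan (modes w) deg D v

namespace HasQuadModes

variable {w : I → V} {deg : I → ℕ} {D : ℕ}

theorem zero : HasQuadModes w deg D 0 := fun p v => by
  have h : nthProd (0 : V) p v = 0 := by simp [nthProd]
  rw [h]; exact zero_mem _

theorem add {s t : V} (hs : HasQuadModes w deg D s) (ht : HasQuadModes w deg D t) :
    HasQuadModes w deg D (s + t) := fun p v => by
  have h : nthProd (s + t) p v = nthProd s p v + nthProd t p v := by simp [nthProd]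
  rw [h]; exact add_mem (hs p v) (ht p v)

theorem smul {s : V} (hs : HasQuadModes w deg D s) (c : ℂ) : HasQuadModes w deg D (c • s) :=
  fun p v => by
  have h : nthProd (c • s) p v = c • nthProd s p v := by simp [nthProd]
  rw [h]; exact Submodule.smul_mem _ _ (hs p v)

theorem neg {s : V} (hs : HasQuadModes w deg D s) : HasQuadModes w deg D (-s) := by
  simpa using hs.smul (-1)

theorem sub {s t : V} (hs : HasQuadModes w deg D s) (ht : HasQuadModes w deg D t) :
    HasQuadModes w deg D (s - t) := by
  rw [sub_eq_add_neg]; exact hs.add ht.neg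

theorem vac (hV : HasVacuumIdentity V) : HasQuadModes w deg D VertexStructure.vac := fun p v => by
  rw [hV.nthProd_vac]
  split_ifs
  · exact self_mem_quadSpan _ _
  · exact zero_mem _

theorem gen {i : I} (hi : deg i ≤ D) : HasQuadModes w deg D (w i) := fun p v =>
  apply_mem_quadSpan v p hi

theorem translation (hV : HasVacuumIdentity V) {s : V} (hr : IsRegular s)
    (hs : HasQuadModes w deg D s) : HasQuadModes w deg D (translation s) := fun p v => by
  rw [hr.nthProd_translation hV]
  exact Submodule.smul_mem _ _ (hs _ _)

theorem nthProd {i k : I} (hr : IsRegular (w i)) (n : ℤ) (h : deg i + deg k ≤ D) :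
    HasQuadModes w deg D (nthProd (w i) n (w k)) := fun p v =>
  hr.nthProd_nthProd_mem n p (fun p q => apply_apply_mem_quadSpan (X := modes w) v p q h)
    (fun p q => apply_apply_mem_quadSpan (X := modes w) v p q (by omega))

end HasQuadModes

/-- By the commutator formula, a commutator of modes is controlled entirely by the modes of the
nonnegative products of the two states. A list of those products is therefore all that is needed. -/
theorem IsRegular.comm_mem_quadSpan {w : I → V} {deg : I → ℕ} {D : ℕ} {i k : I}
    (hi : IsRegular (w i)) (h : ∀ j : ℕ, HasQuadModes w deg D (nthProd (w i) j (w k))) (m n : ℤ)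
    (v : V) : modes w i m (modes w k n v) - modes w k n (modes w i m v) ∈
      quadSpan (modes w) deg D v := by
  obtain ⟨N, hN⟩ := hi.exists_commutator (w k)
  have := hN m n v
  simp only [modes_apply]
  rw [this]
  exact sum_mem fun j _ => Submodule.smul_mem _ _ (h j _ _)

variable {w : I → V} {deg : I → ℕ}

/-- The span of all words in the modes of the `w i` as a vertex subalgebra. -/
def wordSubalgebra (hV : HasVacuumIdentity V) (w : I → V) (deg : I → ℕ)
    (hw : IsWordSystem (modes w) VertexStructure.vac deg)
    (hr : ∀ i, IsRegular (w i)) : VertexSubalgebra V where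
  toSubmodule := allWordSpan (modes w) VertexStructure.vac
  vac_mem := Submodule.subset_span ⟨[], rfl⟩
  nthProd_mem := by
    intro a b n ha hb
    change a ∈ allWordSpan (modes w) VertexStructure.vac at ha
    change b ∈ allWordSpan (modes w) VertexStructure.vac at hb
    change nthProd a n b ∈ allWordSpan (modes w) VertexStructure.vac
    induction ha using Submodule.span_induction generalizing b n with
    | zero => simp [nthProd]
    | add u v _ _ hu hv =>
      have h : nthProd (u + v) n b = nthProd u n b + nthProd v n b := by simp [nthProd]
      rw [h]; exact add_mem (hu n hb) (hv n hb)
    | smul c u _ hu =>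
      have h : nthProd (c • u) n b = c • nthProd u n b := by simp [nthProd]
      rw [h]; exact Submodule.smul_mem _ _ (hu n hb)
    | mem u hu =>
      obtain ⟨l, rfl⟩ := hu
      induction l generalizing b n with
      | nil =>
        rw [word, hV.nthProd_vac]
        split_ifs
        · exact hb
        · exact zero_mem _
      -- The left argument is itself a product of a generator with a shorter word. By associativity
      -- its modes are combinations of modes of the two, composed in either order, and both preserve
      -- the span.
      | cons x l ih =>
        exact (hr x.1).nthProd_nthProd_mem _ _
          (fun p q => hw.apply_mem_allWordSpan x.1 p (ih q hb))
          (fun p q => ih p (hw.apply_mem_allWordSpan x.1 q hb))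

theorem strongWord_range_iff (v : V) :
    StrongWord (Set.range w) v ↔ v ∈ Set.range (word (modes w) VertexStructure.vac) := by
  constructor
  · intro h
    induction h with
    | vac => exact ⟨[], rfl⟩
    | cons a n v ha _ ih =>
      obtain ⟨i, rfl⟩ := ha
      obtain ⟨l, rfl⟩ := ih
      exact ⟨(i, n) :: l, rfl⟩
  · rintro ⟨l, rfl⟩
    induction l with
    | nil => exact StrongWord.vac
    | cons x l ih => exact StrongWord.cons _ _ _ ⟨x.1, rfl⟩ ih

theorem generate_le_of_subset {X : Set V} {S : VertexSubalgebra V}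
    (h : X ⊆ (S.toSubmodule : Set V)) :
    (VertexSubalgebra.generate X).toSubmodule ≤ S.toSubmodule :=
  sInf_le ⟨S, rfl, h⟩

/-- The span of words is itself a vertex subalgebra and contains each generator as a one-letter
word, by the creation property. Conversely, words are iterated products of generators. -/
theorem generate_eq_allWordSpan (hV : HasVacuumIdentity V)
    (hw : IsWordSystem (modes w) VertexStructure.vac deg) (hr : ∀ i, IsRegular (w i))
    (hc : ∀ i, IsCreative (w i)) : (VertexSubalgebra.generate (Set.range w)).toSubmodule =
      allWordSpan (modes w) VertexStructure.vac := by
  apply le_antisymm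
  · refine generate_le_of_subset (S := wordSubalgebra hV w deg hw hr) ?_
    rintro _ ⟨i, rfl⟩
    refine Submodule.subset_span ⟨[(i, 0)], ?_⟩
    change nthProd (w i) _ VertexStructure.vac = _
    simpa using (hc i).neg_one
  · refine Submodule.span_le.2 ?_
    rintro _ ⟨l, rfl⟩
    induction l with
    | nil => exact (VertexSubalgebra.generate (Set.range w)).vac_mem
    | cons x l ih =>
      exact (VertexSubalgebra.generate (Set.range w)).nthProd_mem _
        (VertexSubalgebra.subset_generate _ ⟨x.1, rfl⟩) ih

theorem stronglyGenerates (hV : HasVacuumIdentity V)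
    (hw : IsWordSystem (modes w) VertexStructure.vac deg) (hr : ∀ i, IsRegular (w i))
    (hc : ∀ i, IsCreative (w i)) :
    StronglyGenerates (Set.range w) (VertexSubalgebra.generate (Set.range w)) := by
  refine ⟨VertexSubalgebra.subset_generate _, ?_⟩
  rw [generate_eq_allWordSpan hV hw hr hc, allWordSpan]
  congr 1
  ext v
  exact strongWord_range_iff v

end RegularStates

section

attribute [local instance] LieRing.ofAssociativeRing

/-! ### Matrix units. -/

section MatrixUnits

variable {n : ℕ}

theorem delta_comm (i j : Fin n) : delta i j = delta j i := by simp only [delta, eq_comm]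

theorem sum_delta_smul {M : Type*} [AddCommGroup M] [Module ℂ M] (i : Fin n) (f : Fin n → M) :
    ∑ u, delta u i • f u = f i := by
  simp [delta, ite_smul]

theorem sum_delta_smul' {M : Type*} [AddCommGroup M] [Module ℂ M] (i : Fin n) (f : Fin n → M) :
    ∑ u, delta i u • f u = f i := by
  simp [delta, ite_smul]

theorem lie_single (i j p q : Fin n) :
    ⁅(Matrix.single i j 1 : Matrix (Fin n) (Fin n) ℂ),
        (Matrix.single p q 1 : Matrix (Fin n) (Fin n) ℂ)⁆ =
      delta j p • Matrix.single i q (1 : ℂ) - delta q i • Matrix.single p j (1 : ℂ) := by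
  simp only [delta, Ring.lie_def, ite_smul, one_smul, zero_smul]
  congr 1
  · split_ifs with h
    · subst h; simp
    · simp [h]
  · split_ifs with h
    · subst h; simp
    · simp [h]

end MatrixUnits

/-! ### Currents of the two tensor factors and the modes of the generators. -/

section Currents

variable {n : ℕ} (α : ℂ)

/-- The operator `e_{ij} t^m` on `V^κ(gl(n))`. -/
def unitOp (i j : Fin n) (m : ℤ) : Module.End ℂ (AffGL n α) :=
  UnivAffine.act (glForm n α) (loopElt (glForm n α) (Matrix.single i j 1) m)

theorem unitOp_vac (i j : Fin n) (m : ℤ) : unitOp α i j m VertexStructure.vac = unitVec α i j m :=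
  rfl

theorem unitVec_of_nonneg (i j : Fin n) {m : ℤ} (hm : 0 ≤ m) : unitVec α i j m = 0 :=
  UnivAffine.act_loop_vacuum _ _ _ hm

theorem unitOp_comm (i j p q : Fin n) (m r : ℤ) (v : AffGL n α) :
    unitOp α i j m (unitOp α p q r v) = unitOp α p q r (unitOp α i j m v) +
      (delta j p • unitOp α i q (m + r) v - delta q i • unitOp α p j (m + r) v) +
      (if m + r = 0 then (m : ℂ) * (delta j p * delta i q * α + delta i j * delta p q) else 0) •
        v := by
  have h := UnivAffine.act_loop_comm (glForm n α) (Matrix.single i j 1) (Matrix.single p q 1) m r v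
  rw [lie_single, glForm_single, sub_eq_add_neg (_ • Matrix.single i q (1 : ℂ)), UnivAffine.loopElt_add, UnivAffine.act_add,
    ← neg_smul, UnivAffine.loopElt_smul, UnivAffine.loopElt_smul, UnivAffine.act_smul,
    UnivAffine.act_smul, neg_smul] at h
  simp only [unitOp]
  rw [sub_eq_iff_eq_add.1 h, LinearMap.add_apply, LinearMap.neg_apply, LinearMap.smul_apply,
    LinearMap.smul_apply]
  abel

theorem unitOp_unitVec {i j p q : Fin n} {m : ℤ} (hm : 0 ≤ m) (r : ℤ) :
    unitOp α i j m (unitVec α p q r) =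
      delta j p • unitVec α i q (m + r) - delta q i • unitVec α p j (m + r) +
      (if m + r = 0 then (m : ℂ) * (delta j p * delta i q * α + delta i j * delta p q) else 0) •
        VertexStructure.vac := by
  rw [← unitOp_vac, unitOp_comm, unitOp_vac, unitVec_of_nonneg α i j hm, map_zero, zero_add]
  rfl

/-- When m + r < 0 the central term is absent, so the two orderings of a quadratic vector differ by
linear vectors only. This brings the quadratic terms on both sides of the product formulas to a
common order. -/
theorem unitOp_unitVec_swap (i j p q : Fin n) (m r : ℤ) (h : m + r < 0) :
    unitOp α i j m (unitVec α p q r) = unitOp α p q r (unitVec α i j m) +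
      (delta j p • unitVec α i q (m + r) - delta q i • unitVec α p j (m + r)) := by
  rw [← unitOp_vac, unitOp_comm, if_neg (by omega), zero_smul, add_zero]
  rfl

theorem unitOp_zero_neg_one (i j p q : Fin n) : unitOp α i j 0 (unitVec α p q (-1)) =
    delta j p • unitVec α i q (-1) - delta q i • unitVec α p j (-1) := by
  rw [unitOp_unitVec α le_rfl, zero_add, if_neg (by norm_num), zero_smul, add_zero]

theorem unitOp_one_neg_one (i j p q : Fin n) : unitOp α i j 1 (unitVec α p q (-1)) =
    (delta j p * delta i q * α + delta i j * delta p q) • VertexStructure.vac := by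
  rw [unitOp_unitVec α (by norm_num), if_pos (by norm_num), unitVec_of_nonneg _ _ _ (by norm_num),
    unitVec_of_nonneg _ _ _ (by norm_num)]
  simp

theorem unitOp_neg_one_eq_zero (i j p q : Fin n) {m : ℤ} (hm : 2 ≤ m) :
    unitOp α i j m (unitVec α p q (-1)) = 0 := by
  rw [unitOp_unitVec α (by omega), if_neg (by omega), unitVec_of_nonneg _ _ _ (by omega),
    unitVec_of_nonneg _ _ _ (by omega)]
  simp

theorem unitOp_zero_neg_two (i j p q : Fin n) : unitOp α i j 0 (unitVec α p q (-2)) =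
    delta j p • unitVec α i q (-2) - delta q i • unitVec α p j (-2) := by
  rw [unitOp_unitVec α le_rfl, zero_add, if_neg (by norm_num), zero_smul, add_zero]

theorem unitOp_one_neg_two (i j p q : Fin n) : unitOp α i j 1 (unitVec α p q (-2)) =
    delta j p • unitVec α i q (-1) - delta q i • unitVec α p j (-1) := by
  rw [unitOp_unitVec α (by norm_num), if_neg (by norm_num), zero_smul, add_zero]
  norm_num

theorem unitOp_two_neg_two (i j p q : Fin n) : unitOp α i j 2 (unitVec α p q (-2)) =
    (2 * (delta j p * delta i q * α + delta i j * delta p q)) • VertexStructure.vac := by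
  rw [unitOp_unitVec α (by norm_num), if_pos (by norm_num), unitVec_of_nonneg _ _ _ (by norm_num),
    unitVec_of_nonneg _ _ _ (by norm_num)]
  simp

theorem unitOp_neg_two_eq_zero (i j p q : Fin n) {m : ℤ} (hm : 3 ≤ m) :
    unitOp α i j m (unitVec α p q (-2)) = 0 := by
  rw [unitOp_unitVec α (by omega), if_neg (by omega), unitVec_of_nonneg _ _ _ (by omega),
    unitVec_of_nonneg _ _ _ (by omega)]
  simp

/-- The operator `e_{ij} t^m ⊗ 1`. -/
def opL (i j : Fin n) (m : ℤ) : Module.End ℂ (AffGL2 n α) :=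
  TensorProduct.map (unitOp α i j m) LinearMap.id

/-- The operator `1 ⊗ e_{ij} t^m`. -/
def opR (i j : Fin n) (m : ℤ) : Module.End ℂ (AffGL2 n α) :=
  TensorProduct.map LinearMap.id (unitOp α i j m)

theorem opL_tmul (i j : Fin n) (m : ℤ) (x y : AffGL n α) :
    opL α i j m (x ⊗ₜ y) = unitOp α i j m x ⊗ₜ y := rfl

theorem opR_tmul (i j : Fin n) (m : ℤ) (x y : AffGL n α) :
    opR α i j m (x ⊗ₜ y) = x ⊗ₜ unitOp α i j m y := rfl

theorem opL_opR (i j p q : Fin n) (m r : ℤ) (v : AffGL2 n α) :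
    opL α i j m (opR α p q r v) = opR α p q r (opL α i j m v) := by
  induction v using TensorProduct.induction_on with
  | zero => simp
  | add x y hx hy => simp only [map_add, hx, hy]
  | tmul x y => rfl

theorem nthProd_unitVec_tmul_vac (i j : Fin n) (m : ℤ) (v : AffGL2 n α) :
    nthProd (unitVec α i j (-1) ⊗ₜ[ℂ] (VertexStructure.vac : AffGL n α)) m v = opL α i j m v := by
  induction v using TensorProduct.induction_on with
  | zero => simp [nthProd]
  | add x y hx hy => rw [map_add, ← hx, ← hy]; simp [nthProd]
  | tmul x y =>
    rw [nthProd_tmul, finsum_eq_single _ m, UnivAffine.nthProd_vac, if_pos (by omega)]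
    · exact congrArg (· ⊗ₜ y) (UnivAffine.nthProd_vec_neg_one (glForm n α) _ m x)
    · intro k hk
      rw [UnivAffine.nthProd_vac, if_neg (by omega), TensorProduct.tmul_zero]

theorem nthProd_vac_tmul_unitVec (i j : Fin n) (m : ℤ) (v : AffGL2 n α) :
    nthProd ((VertexStructure.vac : AffGL n α) ⊗ₜ[ℂ] unitVec α i j (-1)) m v = opR α i j m v := by
  induction v using TensorProduct.induction_on with
  | zero => simp [nthProd]
  | add x y hx hy => rw [map_add, ← hx, ← hy]; simp [nthProd]
  | tmul x y =>
    rw [nthProd_tmul, finsum_eq_single _ (-1), UnivAffine.nthProd_vac, if_pos rfl,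
      show m - 1 - -1 = m by ring]
    · exact congrArg (x ⊗ₜ ·) (UnivAffine.nthProd_vec_neg_one (glForm n α) _ m y)
    · intro k hk
      rw [UnivAffine.nthProd_vac, if_neg (by omega), TensorProduct.zero_tmul]

theorem nthProd_unitVec_neg_two_tmul_vac (i j : Fin n) (m : ℤ) (v : AffGL2 n α) :
    nthProd (unitVec α i j (-2) ⊗ₜ[ℂ] (VertexStructure.vac : AffGL n α)) m v =
      (-(m : ℂ)) • opL α i j (m - 1) v := by
  induction v using TensorProduct.induction_on with
  | zero => simp [nthProd]
  | add x y hx hy => rw [map_add, smul_add, ← hx, ← hy]; simp [nthProd]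
  | tmul x y =>
    rw [nthProd_tmul, finsum_eq_single _ m, UnivAffine.nthProd_vac, if_pos (by omega)]
    · refine (congrArg (· ⊗ₜ y) (UnivAffine.nthProd_vec_neg_two (glForm n α) _ m x)).trans ?_
      exact (TensorProduct.smul_tmul' _ _ _).symm
    · intro k hk
      rw [UnivAffine.nthProd_vac, if_neg (by omega), TensorProduct.tmul_zero]

theorem nthProd_unitVec_tmul_unitVec (i j p q : Fin n) (m : ℤ) (v : AffGL2 n α) :
    nthProd (unitVec α i j (-1) ⊗ₜ[ℂ] unitVec α p q (-1)) m v =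
      ∑ᶠ k : ℤ, opL α i j k (opR α p q (m - 1 - k) v) := by
  have h (i j : Fin n) (k : ℤ) :
      ((VertexStructure.Y (unitVec α i j (-1)))[[k]]) = unitOp α i j k :=
    LinearMap.ext fun x => UnivAffine.nthProd_vec_neg_one (glForm n α) _ k x
  rw [nthProd, Y_tmul, tensorField_apply]
  apply finsum_congr
  intro k
  rw [h, h, opL, opR, ← LinearMap.comp_apply, ← TensorProduct.map_comp, LinearMap.comp_id,
    LinearMap.id_comp]

theorem nthProd_W1 (i j : Fin n) (m : ℤ) (v : AffGL2 n α) :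
    nthProd (W1 α i j) m v = opL α i j m v + opR α i j m v := by
  rw [← nthProd_unitVec_tmul_vac, ← nthProd_vac_tmul_unitVec, W1]
  simp [nthProd]

/-- The quadratic part contributes modes k on the left and s - 1 - k on the right. Annihilation by
left modes ≥ K and right modes ≥ M leaves s - M ≤ k < K, parametrized by k = s - M + l. The last
term comes from -α e[-2], because the s-th mode of e[-2] is -s e t^{s-1}. -/
theorem nthProd_W2 (p q : Fin n) (s : ℤ) (v : AffGL2 n α) {K M : ℤ}
    (hK : ∀ i j k, K ≤ k → opL α i j k v = 0) (hM : ∀ i j k, M ≤ k → opR α i j k v = 0) (N : ℕ)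
    (hN : K + M - s ≤ N) : nthProd (W2 α p q) s v =
      ∑ l ∈ Finset.range N, ∑ u, opL α u q (s - M + l) (opR α p u (M - 1 - l) v) +
        (α * s) • opL α p q (s - 1) v := by
  have h : nthProd (W2 α p q) s v =
      ∑ u, nthProd (unitVec α u q (-1) ⊗ₜ[ℂ] unitVec α p u (-1)) s v -
        α • nthProd (unitVec α p q (-2) ⊗ₜ[ℂ] (VertexStructure.vac : AffGL n α)) s v := by
    simp [nthProd, W2]
  rw [h, nthProd_unitVec_neg_two_tmul_vac, smul_smul, mul_neg, neg_smul, sub_neg_eq_add,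
    Finset.sum_comm]
  congr 1
  apply Finset.sum_congr rfl
  intro u _
  rw [nthProd_unitVec_tmul_unitVec, finsum_eq_sum_of_support_subset
    (s := (Finset.range N).image fun l : ℕ => s - M + l), Finset.sum_image]
  · apply Finset.sum_congr rfl
    intro l _
    congr 3
    ring
  · intro a _ b _ hab
    simpa using hab
  · intro k hk
    rw [Function.mem_support] at hk
    have h1 : k < K := by
      by_contra hc
      apply hk
      rw [opL_opR, hK _ _ _ (by omega), map_zero]
    have h2 : s - 1 - k < M := by
      by_contra hc
      apply hk
      rw [hM _ _ _ (by omega), map_zero]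
    simp only [Finset.coe_image, Finset.coe_range, Set.mem_image, Set.mem_Iio]
    exact ⟨(k - (s - M)).toNat, by omega, by omega⟩

end Currents

end

section

attribute [local instance] LieRing.ofAssociativeRing

/-! ### Action of the currents on the generators. -/

section CurrentsOnGenerators

variable {n : ℕ} (α : ℂ)

/-- The quadratic part of `W2`. -/
def quadGen (i j : Fin n) : AffGL2 n α := ∑ u : Fin n, unitVec α u j (-1) ⊗ₜ[ℂ] unitVec α i u (-1)

theorem W2_eq (i j : Fin n) : W2 α i j = quadGen α i j -
    α • (unitVec α i j (-2) ⊗ₜ[ℂ] (VertexStructure.vac : AffGL n α)) := rfl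

theorem opL_W1 (a b i j : Fin n) (m : ℤ) : opL α a b m (W1 α i j) =
    unitOp α a b m (unitVec α i j (-1)) ⊗ₜ VertexStructure.vac +
      unitVec α a b m ⊗ₜ unitVec α i j (-1) := by
  rw [W1, map_add, opL_tmul, opL_tmul, unitOp_vac]

theorem opR_W1 (a b i j : Fin n) (m : ℤ) : opR α a b m (W1 α i j) =
    unitVec α i j (-1) ⊗ₜ unitVec α a b m +
      VertexStructure.vac ⊗ₜ unitOp α a b m (unitVec α i j (-1)) := by
  rw [W1, map_add, opR_tmul, opR_tmul, unitOp_vac]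

theorem opL_W1_eq_zero (a b i j : Fin n) {m : ℤ} (hm : 2 ≤ m) : opL α a b m (W1 α i j) = 0 := by
  rw [opL_W1, unitOp_neg_one_eq_zero α _ _ _ _ hm, unitVec_of_nonneg α a b (by omega)]
  simp

theorem opR_W1_eq_zero (a b i j : Fin n) {m : ℤ} (hm : 2 ≤ m) : opR α a b m (W1 α i j) = 0 := by
  rw [opR_W1, unitOp_neg_one_eq_zero α _ _ _ _ hm, unitVec_of_nonneg α a b (by omega)]
  simp

theorem opL_vac (a b : Fin n) (m : ℤ) : opL α a b m VertexStructure.vac =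
    unitVec α a b m ⊗ₜ VertexStructure.vac := rfl

theorem opR_vac (a b : Fin n) (m : ℤ) : opR α a b m VertexStructure.vac =
    VertexStructure.vac ⊗ₜ unitVec α a b m := rfl

theorem opL_quadGen (a b i j : Fin n) (m : ℤ) : opL α a b m (quadGen α i j) =
    ∑ u, unitOp α a b m (unitVec α u j (-1)) ⊗ₜ unitVec α i u (-1) := by
  simp only [quadGen, map_sum, opL_tmul]

theorem opR_quadGen (a b i j : Fin n) (m : ℤ) : opR α a b m (quadGen α i j) =
    ∑ u, unitVec α u j (-1) ⊗ₜ unitOp α a b m (unitVec α i u (-1)) := by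
  simp only [quadGen, map_sum, opR_tmul]

theorem opL_W2 (a b i j : Fin n) (m : ℤ) : opL α a b m (W2 α i j) =
    opL α a b m (quadGen α i j) -
      α • (unitOp α a b m (unitVec α i j (-2)) ⊗ₜ VertexStructure.vac) := by
  rw [W2_eq, map_sub, map_smul, opL_tmul]

theorem opR_W2 (a b i j : Fin n) (m : ℤ) : opR α a b m (W2 α i j) =
    opR α a b m (quadGen α i j) - α • (unitVec α i j (-2) ⊗ₜ unitVec α a b m) := by
  rw [W2_eq, map_sub, map_smul, opR_tmul, unitOp_vac]

theorem opR_W2_zero (a b i j : Fin n) : opR α a b 0 (W2 α i j) =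
    delta b i • quadGen α a j - unitVec α a j (-1) ⊗ₜ unitVec α i b (-1) := by
  rw [opR_W2, unitVec_of_nonneg α a b le_rfl, opR_quadGen]
  simp only [unitOp_zero_neg_one, TensorProduct.tmul_sub, TensorProduct.tmul_smul,
    Finset.sum_sub_distrib, ← Finset.smul_sum, TensorProduct.tmul_zero, smul_zero, sub_zero]
  rw [sum_delta_smul, quadGen]

theorem opR_W2_one (a b i j : Fin n) : opR α a b 1 (W2 α i j) =
    (delta b i * α) • (unitVec α a j (-1) ⊗ₜ VertexStructure.vac) +
      delta a b • (unitVec α i j (-1) ⊗ₜ VertexStructure.vac) := by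
  rw [opR_W2, unitVec_of_nonneg α a b zero_le_one, opR_quadGen]
  have h (u : Fin n) : delta b i * delta a u * α + delta a b * delta i u =
    delta a u * (delta b i * α) + delta i u * delta a b := by ring
  simp only [unitOp_one_neg_one, h, TensorProduct.tmul_smul, TensorProduct.tmul_add, add_smul,
    Finset.sum_add_distrib, TensorProduct.tmul_zero, smul_zero, sub_zero, mul_smul (delta _ _) (_ * _) _,
    mul_smul (delta i _)]
  rw [sum_delta_smul', sum_delta_smul']

theorem opR_W2_eq_zero (a b i j : Fin n) {m : ℤ} (hm : 2 ≤ m) : opR α a b m (W2 α i j) = 0 := by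
  rw [opR_W2, unitVec_of_nonneg α a b (by omega), opR_quadGen]
  simp [unitOp_neg_one_eq_zero α _ _ _ _ hm]

theorem opL_W2_zero (a b i j : Fin n) : opL α a b 0 (W2 α i j) =
    unitVec α a j (-1) ⊗ₜ unitVec α i b (-1) - delta j a • quadGen α i b -
      α • (delta b i • (unitVec α a j (-2) ⊗ₜ VertexStructure.vac) -
        delta j a • (unitVec α i b (-2) ⊗ₜ VertexStructure.vac)) := by
  rw [opL_W2, opL_quadGen]
  simp only [unitOp_zero_neg_one, unitOp_zero_neg_two, TensorProduct.sub_tmul,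
    ← TensorProduct.smul_tmul', Finset.sum_sub_distrib, ← Finset.smul_sum]
  rw [sum_delta_smul', quadGen]

theorem opL_W2_one (a b i j : Fin n) : opL α a b 1 (W2 α i j) =
    (delta a j * α) • (VertexStructure.vac ⊗ₜ unitVec α i b (-1)) +
      delta a b • (VertexStructure.vac ⊗ₜ unitVec α i j (-1)) -
      α • (delta b i • (unitVec α a j (-1) ⊗ₜ VertexStructure.vac) -
        delta j a • (unitVec α i b (-1) ⊗ₜ VertexStructure.vac)) := by
  rw [opL_W2, opL_quadGen]
  have h (u : Fin n) : delta b u * delta a j * α + delta a b * delta u j =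
    delta b u * (delta a j * α) + delta u j * delta a b := by ring
  simp only [unitOp_one_neg_one, unitOp_one_neg_two, TensorProduct.sub_tmul, h, add_smul,
    TensorProduct.add_tmul, ← TensorProduct.smul_tmul', Finset.sum_add_distrib,
    mul_smul (delta b _), mul_smul (delta _ j) (delta a b)]
  rw [sum_delta_smul', sum_delta_smul]

theorem opL_W2_two (a b i j : Fin n) : opL α a b 2 (W2 α i j) =
    (-(2 * α * (delta b i * delta a j * α + delta a b * delta i j))) • VertexStructure.vac := by
  rw [opL_W2, opL_quadGen, unitOp_two_neg_two]
  simp only [unitOp_neg_one_eq_zero α _ _ _ _ le_rfl, TensorProduct.zero_tmul,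
    Finset.sum_const_zero, ← TensorProduct.smul_tmul', smul_smul, zero_sub, neg_smul]
  congr 1
  rw [← mul_assoc, mul_comm α 2]
  rfl

theorem opL_W2_eq_zero (a b i j : Fin n) {m : ℤ} (hm : 3 ≤ m) : opL α a b m (W2 α i j) = 0 := by
  rw [opL_W2, unitOp_neg_two_eq_zero α _ _ _ _ hm, opL_quadGen]
  simp [unitOp_neg_one_eq_zero α _ _ _ _ (show 2 ≤ m by omega)]

end CurrentsOnGenerators

/-! ### Contraction of the summation index of the quadratic part. -/

section Contractions

variable {n : ℕ} (α : ℂ) (p q i j : Fin n)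

/-- This and the four lemmas after it give every summand needed for products of two W^(2). The index
u is either fixed by a Kronecker delta or survives in a genuine sum of vectors. No closed sum of
δ_{u,u} occurs, so no factor n enters and α is the only parameter. -/
theorem sum_opL_opR_one (k : ℤ) : ∑ u, opL α u q k (opR α p u 1 (W2 α i j)) =
    α • (unitOp α i q k (unitVec α p j (-1)) ⊗ₜ VertexStructure.vac) +
      unitOp α p q k (unitVec α i j (-1)) ⊗ₜ VertexStructure.vac := by
  simp only [opR_W2_one, map_add, map_smul, opL_tmul, Finset.sum_add_distrib, mul_smul]
  rw [sum_delta_smul, sum_delta_smul']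

theorem sum_opL_opR_zero (k : ℤ) : ∑ u, opL α u q k (opR α p u 0 (W2 α i j)) =
    ∑ u, unitOp α i q k (unitVec α u j (-1)) ⊗ₜ unitVec α p u (-1) -
      ∑ u, unitOp α u q k (unitVec α p j (-1)) ⊗ₜ unitVec α i u (-1) := by
  simp only [opR_W2_zero, map_sub, map_smul, opL_tmul, Finset.sum_sub_distrib]
  rw [sum_delta_smul, opL_quadGen]

theorem sum_opL_zero_opR (m : ℤ) : ∑ u, opL α u q 0 (opR α p u m (W2 α i j)) =
    ∑ u, unitVec α u j (-1) ⊗ₜ unitOp α p u m (unitVec α i q (-1)) -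
      ∑ u, unitVec α u q (-1) ⊗ₜ unitOp α p j m (unitVec α i u (-1)) -
      α • (delta q i • ∑ u, unitVec α u j (-2) ⊗ₜ unitVec α p u m -
        unitVec α i q (-2) ⊗ₜ unitVec α p j m) := by
  simp only [opL_opR, opL_W2_zero, map_sub, map_smul, opR_tmul, Finset.sum_sub_distrib,
    ← Finset.smul_sum, unitOp_vac]
  rw [sum_delta_smul', sum_delta_smul', opR_quadGen]

theorem sum_opL_one_opR (m : ℤ) : ∑ u, opL α u q 1 (opR α p u m (W2 α i j)) =
    α • (VertexStructure.vac ⊗ₜ unitOp α p j m (unitVec α i q (-1))) +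
      VertexStructure.vac ⊗ₜ unitOp α p q m (unitVec α i j (-1)) -
      α • (delta q i • ∑ u, unitVec α u j (-1) ⊗ₜ unitVec α p u m -
        unitVec α i q (-1) ⊗ₜ unitVec α p j m) := by
  simp only [opL_opR, opL_W2_one, map_sub, map_add, map_smul, opR_tmul, Finset.sum_sub_distrib,
    Finset.sum_add_distrib, ← Finset.smul_sum, unitOp_vac, mul_smul]
  rw [sum_delta_smul', sum_delta_smul, sum_delta_smul]

theorem sum_opL_two_opR (m : ℤ) : ∑ u, opL α u q 2 (opR α p u m (W2 α i j)) =
    (-(2 * α)) • ((delta q i * α) • (VertexStructure.vac ⊗ₜ unitVec α p j m) +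
      delta i j • (VertexStructure.vac ⊗ₜ unitVec α p q m)) := by
  have h (u : Fin n) : -(2 * α * (delta q i * delta u j * α + delta u q * delta i j)) =
    delta u j * (-(2 * α) * (delta q i * α)) + delta u q * (-(2 * α) * delta i j) := by ring
  simp only [opL_opR, opL_W2_two, map_add, map_smul, opR_vac, h, add_smul, Finset.sum_add_distrib,
    mul_smul (delta _ _) (_ * _) (_ ⊗ₜ _)]
  rw [sum_delta_smul, sum_delta_smul]
  simp only [mul_smul, smul_add]

end Contractions

end

section

attribute [local instance] LieRing.ofAssociativeRing

/-! ### The list of products as a property of two families of states. -/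

section RectangularOPE

variable {V : Type*} [AddCommGroup V] [Module ℂ V] [VertexStructure V]

/-- The products of the generators of the rectangular `W`-algebra of `gl(2n)`. -/
structure RectOPE {n : ℕ} (α : ℂ) (w₁ w₂ : Fin n → Fin n → V) : Prop where
  one_one : ∀ p q i j : Fin n,
      nthProd (w₁ p q) 0 (w₁ i j) = delta q i • w₁ p j - delta p j • w₁ i q ∧
      nthProd (w₁ p q) 1 (w₁ i j) =
        (2 * delta q i * delta p j * α + 2 * delta p q * delta i j) • VertexStructure.vac ∧
      ∀ s : ℤ, 1 < s → nthProd (w₁ p q) s (w₁ i j) = 0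
  one_two : ∀ p q i j : Fin n,
      nthProd (w₁ p q) 0 (w₂ i j) = -(delta p j • w₂ i q) + delta i q • w₂ p j ∧
      nthProd (w₁ p q) 1 (w₂ i j) = (delta p j * α) • w₁ i q + delta p q • w₁ i j ∧
      nthProd (w₁ p q) 2 (w₂ i j) =
        (-(2 * delta q i * delta p j * α ^ 2) - 2 * delta p q * delta i j * α) •
          VertexStructure.vac ∧
      ∀ s : ℤ, 2 < s → nthProd (w₁ p q) s (w₂ i j) = 0
  two_two : ∀ p q i j : Fin n,
      nthProd (w₂ p q) 0 (w₂ i j) =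
        nthProd (w₂ p j) (-1) (w₁ i q) - nthProd (w₁ p j) (-1) (w₂ i q)
        + α • nthProd (translation (w₁ p j)) (-1) (w₁ i q)
        + nthProd (translation (w₁ p q)) (-1) (w₁ i j)
        - (delta q i * α) • translation (w₂ p j)
        - (delta i q * ((2 * α ^ 2 + 1) / 2)) • translation (translation (w₁ p j))
        - delta i j • translation (w₂ p q)
        - (3 / 2 * delta i j * α) • translation (translation (w₁ p q)) ∧
      nthProd (w₂ p q) 1 (w₂ i j) =
        α • nthProd (w₁ p j) (-1) (w₁ i q)
        + nthProd (w₁ p q) (-1) (w₁ i j)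
        - (delta q i * α) • w₂ p j
        - (2 * delta q i * α ^ 2) • translation (w₁ p j)
        - (delta p j * α) • w₂ i q
        - delta i j • w₂ p q
        - (2 * delta i j * α) • translation (w₁ p q)
        - delta p q • w₂ i j ∧
      nthProd (w₂ p q) 2 (w₂ i j) =
        (delta p j * (2 * α ^ 2 - 1)) • w₁ i q
        - (delta i j * α) • w₁ p q
        - (delta i q * (2 * α ^ 2 - 1)) • w₁ p j
        + (delta p q * α) • w₁ i j ∧
      nthProd (w₂ p q) 3 (w₂ i j) =
        ((1 - 5 * α ^ 2) * delta p q * delta i j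
          + (2 * α - 6 * α ^ 3) * delta p j * delta i q) • VertexStructure.vac ∧
      ∀ s : ℤ, 3 < s → nthProd (w₂ p q) s (w₂ i j) = 0

theorem delta_castSucc {n : ℕ} (i j : Fin n) : delta i.castSucc j.castSucc = delta i j := by
  simp [delta]

/-- The relations contain no summation over matrix indices, and their coefficients are polynomials
in α and Kronecker deltas. They therefore restrict to any subset of the indices with α unchanged. -/
theorem RectOPE.castSucc {n : ℕ} {α : ℂ} {w₁ w₂ : Fin (n + 1) → Fin (n + 1) → V}
    (h : RectOPE α w₁ w₂) :
    RectOPE α (fun i j : Fin n => w₁ i.castSucc j.castSucc)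
      (fun i j : Fin n => w₂ i.castSucc j.castSucc) where
  one_one p q i j := by
    have := h.one_one p.castSucc q.castSucc i.castSucc j.castSucc
    simpa only [delta_castSucc] using this
  one_two p q i j := by
    have := h.one_two p.castSucc q.castSucc i.castSucc j.castSucc
    simpa only [delta_castSucc] using this
  two_two p q i j := by
    have := h.two_two p.castSucc q.castSucc i.castSucc j.castSucc
    simpa only [delta_castSucc] using this

end RectangularOPE

/-! ### Regularity of the generators and computation of their products. -/

section Generators

variable {n : ℕ} (α : ℂ)

theorem hasVacuumIdentity_affGL2 : HasVacuumIdentity (AffGL2 n α) :=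
  HasVacuumIdentity.tensor (UnivAffine.Y_vac _) (UnivAffine.Y_vac _)

theorem isRegular_W1 (i j : Fin n) : IsRegular (W1 α i j) :=
  ((UnivAffine.isRegular_vec_neg_one _ _).tmul (UnivAffine.isRegular_vac _)).add
    ((UnivAffine.isRegular_vac _).tmul (UnivAffine.isRegular_vec_neg_one _ _))

theorem isRegular_W2 (i j : Fin n) : IsRegular (W2 α i j) :=
  (IsRegular.sum _ fun _ => (UnivAffine.isRegular_vec_neg_one _ _).tmul
    (UnivAffine.isRegular_vec_neg_one _ _)).sub
    (((UnivAffine.isRegular_vec_neg_two _ _).tmul (UnivAffine.isRegular_vac _)).smul α)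

theorem isCreative_vac : IsCreative (VertexStructure.vac : AffGL n α) :=
  ⟨fun m hm => by rw [UnivAffine.nthProd_vac, if_neg (by omega)],
    by rw [UnivAffine.nthProd_vac, if_pos rfl]⟩

theorem isCreative_unitVec_neg_one (i j : Fin n) : IsCreative (unitVec α i j (-1)) :=
  ⟨fun m hm => (UnivAffine.nthProd_vec_neg_one (glForm n α) _ m _).trans
      (unitVec_of_nonneg α i j hm),
    UnivAffine.nthProd_vec_neg_one (glForm n α) _ (-1) _⟩

theorem isCreative_unitVec_neg_two (i j : Fin n) : IsCreative (unitVec α i j (-2)) := by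
  have h (m : ℤ) : nthProd (unitVec α i j (-2)) m VertexStructure.vac =
    (-(m : ℂ)) • unitVec α i j (m - 1) := UnivAffine.nthProd_vec_neg_two (glForm n α) _ m _
  refine ⟨fun m hm => ?_, ?_⟩
  · rw [h]
    obtain rfl | hm := hm.eq_or_lt
    · simp
    · rw [unitVec_of_nonneg α i j (by omega), smul_zero]
  · rw [h]
    norm_num

theorem isCreative_W1 (i j : Fin n) : IsCreative (W1 α i j) :=
  ((isCreative_unitVec_neg_one α i j).tmul (isCreative_vac α)).add
    ((isCreative_vac α).tmul (isCreative_unitVec_neg_one α i j))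

theorem isCreative_W2 (i j : Fin n) : IsCreative (W2 α i j) :=
  (IsCreative.sum _ fun u => (isCreative_unitVec_neg_one α u j).tmul
    (isCreative_unitVec_neg_one α i u)).sub
    (((isCreative_unitVec_neg_two α i j).tmul (isCreative_vac α)).smul α)

theorem translation_W1 (i j : Fin n) : translation (W1 α i j) =
    unitVec α i j (-2) ⊗ₜ VertexStructure.vac + VertexStructure.vac ⊗ₜ unitVec α i j (-2) := by
  rw [translation, nthProd_W1, opL_vac, opR_vac]

theorem translation_translation_W1 (i j : Fin n) : translation (translation (W1 α i j)) =
    (2 : ℂ) • (unitVec α i j (-3) ⊗ₜ VertexStructure.vac +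
      VertexStructure.vac ⊗ₜ unitVec α i j (-3)) := by
  rw [translation, (isRegular_W1 α i j).nthProd_translation (hasVacuumIdentity_affGL2 α),
    nthProd_W1, opL_vac, opR_vac]
  norm_num

theorem nthProd_translation_W1 (i j : Fin n) (v : AffGL2 n α) :
    nthProd (translation (W1 α i j)) (-1) v = opL α i j (-2) v + opR α i j (-2) v := by
  rw [(isRegular_W1 α i j).nthProd_translation (hasVacuumIdentity_affGL2 α), nthProd_W1]
  norm_num

theorem translation_W2 (p q : Fin n) : translation (W2 α p q) =
    ∑ u, unitVec α u q (-2) ⊗ₜ unitVec α p u (-1) +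
      ∑ u, unitVec α u q (-1) ⊗ₜ unitVec α p u (-2) -
        (2 * α) • (unitVec α p q (-3) ⊗ₜ VertexStructure.vac) := by
  have h := nthProd_W2 α p q (-2) VertexStructure.vac (K := 0) (M := 0)
    (fun i j k hk => by rw [opL_vac, unitVec_of_nonneg α i j hk, TensorProduct.zero_tmul])
    (fun i j k hk => by rw [opR_vac, unitVec_of_nonneg α i j hk, TensorProduct.tmul_zero]) 2
    (by norm_num)
  simp only [Finset.sum_range_succ, Finset.sum_range_zero, zero_add, Nat.cast_zero, Nat.cast_one,
    Int.reduceSub, Int.reduceAdd, Int.reduceNeg, opL_opR, opL_vac, opR_tmul, unitOp_vac, add_zero,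
    sub_zero] at h
  rw [translation, h, sub_eq_add_neg, ← neg_smul]
  congr 2
  push_cast
  ring

theorem nthProd_W2_neg_one_W1 (p j i q : Fin n) : nthProd (W2 α p j) (-1) (W1 α i q) =
    ∑ u, unitOp α u j (-1) (unitVec α i q (-1)) ⊗ₜ unitVec α p u (-1) +
      ∑ u, unitVec α u j (-1) ⊗ₜ unitOp α p u (-1) (unitVec α i q (-1)) +
      (delta i j • ∑ u, unitVec α u q (-1) ⊗ₜ unitVec α p u (-2) -
        unitVec α i j (-1) ⊗ₜ unitVec α p q (-2)) +
      (unitVec α i j (-2) ⊗ₜ unitVec α p q (-1) -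
        delta p q • ∑ u, unitVec α u j (-2) ⊗ₜ unitVec α i u (-1)) +
      ((delta i j * α) • (VertexStructure.vac ⊗ₜ unitVec α p q (-3)) +
        delta i q • (VertexStructure.vac ⊗ₜ unitVec α p j (-3))) +
      ((delta p q * α) • (unitVec α i j (-3) ⊗ₜ VertexStructure.vac) +
        delta i q • (unitVec α p j (-3) ⊗ₜ VertexStructure.vac)) -
      α • (unitOp α p j (-2) (unitVec α i q (-1)) ⊗ₜ VertexStructure.vac +
        unitVec α p j (-2) ⊗ₜ unitVec α i q (-1)) := by
  -- Modes ≥ 2 of either factor kill W^(1), so K = M = 2 and the sum has 2 + 2 + 1 = 5 terms.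
  have h := nthProd_W2 α p j (-1) (W1 α i q) (K := 2) (M := 2)
    (fun a b k hk => opL_W1_eq_zero α a b i q hk)
    (fun a b k hk => opR_W1_eq_zero α a b i q hk) 5 (by norm_num)
  simp only [Finset.sum_range_succ, Finset.sum_range_zero, zero_add, Nat.cast_zero, Nat.cast_one,
    Nat.cast_ofNat, Int.reduceSub, Int.reduceAdd, Int.reduceNeg, opR_W1, map_add, opL_tmul,
    sub_zero, Finset.sum_add_distrib, opL_W1, unitOp_vac] at h
  rw [h]
  have e₁ : ∑ u, unitVec α u j (-3) ⊗ₜ[ℂ] unitOp α p u 1 (unitVec α i q (-1)) =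
      (delta p q * α) • (unitVec α i j (-3) ⊗ₜ[ℂ] (VertexStructure.vac : AffGL n α)) +
        delta i q • (unitVec α p j (-3) ⊗ₜ VertexStructure.vac) := by
    have h (u : Fin n) : delta u i * delta p q * α + delta p u * delta i q =
      delta u i * (delta p q * α) + delta p u * delta i q := by ring
    simp only [unitOp_one_neg_one, h, add_smul, TensorProduct.tmul_add, TensorProduct.tmul_smul,
      Finset.sum_add_distrib, mul_smul (delta _ i), mul_smul (delta p _) (delta i q)]
    rw [sum_delta_smul, sum_delta_smul']
  have e₂ : ∑ u, unitVec α u j (-2) ⊗ₜ[ℂ] unitOp α p u 0 (unitVec α i q (-1)) =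
      unitVec α i j (-2) ⊗ₜ unitVec α p q (-1) -
        delta p q • ∑ u, unitVec α u j (-2) ⊗ₜ unitVec α i u (-1) := by
    simp only [unitOp_zero_neg_one, TensorProduct.tmul_sub, TensorProduct.tmul_smul,
      Finset.sum_sub_distrib, ← Finset.smul_sum]
    rw [sum_delta_smul, delta_comm q p]
  have e₃ : ∑ u, unitOp α u j 0 (unitVec α i q (-1)) ⊗ₜ[ℂ] unitVec α p u (-2) =
      delta i j • ∑ u, unitVec α u q (-1) ⊗ₜ unitVec α p u (-2) -
        unitVec α i j (-1) ⊗ₜ unitVec α p q (-2) := by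
    simp only [unitOp_zero_neg_one, TensorProduct.sub_tmul, ← TensorProduct.smul_tmul',
      Finset.sum_sub_distrib, ← Finset.smul_sum]
    rw [sum_delta_smul', delta_comm j i]
  have e₄ : ∑ u, unitOp α u j 1 (unitVec α i q (-1)) ⊗ₜ[ℂ] unitVec α p u (-3) =
      (delta i j * α) • ((VertexStructure.vac : AffGL n α) ⊗ₜ unitVec α p q (-3)) +
        delta i q • (VertexStructure.vac ⊗ₜ unitVec α p j (-3)) := by
    have h (u : Fin n) : delta j i * delta u q * α + delta u j * delta i q =
      delta u q * (delta i j * α) + delta u j * delta i q := by rw [delta_comm j i]; ring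
    simp only [unitOp_one_neg_one, h, add_smul, TensorProduct.add_tmul, ← TensorProduct.smul_tmul',
      Finset.sum_add_distrib, mul_smul (delta _ q) (_ * _), mul_smul (delta _ j)]
    rw [sum_delta_smul, sum_delta_smul]
  rw [e₁, e₂, e₃, e₄]
  simp only [unitVec_of_nonneg α _ _ le_rfl, unitVec_of_nonneg α _ _ zero_le_one,
    TensorProduct.zero_tmul, TensorProduct.tmul_zero, Finset.sum_const_zero]
  push_cast
  module

theorem vac_tmul_vac : (VertexStructure.vac : AffGL n α) ⊗ₜ[ℂ] (VertexStructure.vac : AffGL n α) =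
    (VertexStructure.vac : AffGL2 n α) := rfl

theorem W1_W1_products (p q i j : Fin n) :
    nthProd (W1 α p q) 0 (W1 α i j) = delta q i • W1 α p j - delta p j • W1 α i q ∧
    nthProd (W1 α p q) 1 (W1 α i j) =
      (2 * delta q i * delta p j * α + 2 * delta p q * delta i j) • VertexStructure.vac ∧
    ∀ s : ℤ, 1 < s → nthProd (W1 α p q) s (W1 α i j) = 0 := by
  refine ⟨?_, ?_, fun s hs => ?_⟩
  · rw [nthProd_W1, opL_W1, opR_W1, unitOp_zero_neg_one, unitVec_of_nonneg α p q le_rfl,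
      TensorProduct.tmul_zero, TensorProduct.zero_tmul, TensorProduct.sub_tmul,
      TensorProduct.tmul_sub, W1, W1, delta_comm p j]
    simp only [← TensorProduct.smul_tmul', TensorProduct.tmul_smul]
    module
  · rw [nthProd_W1, opL_W1, opR_W1, unitOp_one_neg_one, unitVec_of_nonneg α p q zero_le_one,
      TensorProduct.tmul_zero, TensorProduct.zero_tmul]
    simp only [← TensorProduct.smul_tmul', TensorProduct.tmul_smul, vac_tmul_vac]
    module
  · rw [nthProd_W1, opL_W1_eq_zero α _ _ _ _ (by omega), opR_W1_eq_zero α _ _ _ _ (by omega),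
      add_zero]

theorem W1_W2_products (p q i j : Fin n) :
    nthProd (W1 α p q) 0 (W2 α i j) = -(delta p j • W2 α i q) + delta i q • W2 α p j ∧
    nthProd (W1 α p q) 1 (W2 α i j) = (delta p j * α) • W1 α i q + delta p q • W1 α i j ∧
    nthProd (W1 α p q) 2 (W2 α i j) =
      (-(2 * delta q i * delta p j * α ^ 2) - 2 * delta p q * delta i j * α) •
        VertexStructure.vac ∧
    ∀ s : ℤ, 2 < s → nthProd (W1 α p q) s (W2 α i j) = 0 := by
  refine ⟨?_, ?_, ?_, fun s hs => ?_⟩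
  · rw [nthProd_W1, opL_W2_zero, opR_W2_zero, W2_eq, W2_eq, delta_comm j p, delta_comm q i]
    module
  · rw [nthProd_W1, opL_W2_one, opR_W2_one, W1, W1, delta_comm j p]
    module
  · rw [nthProd_W1, opL_W2_two, opR_W2_eq_zero α _ _ _ _ le_rfl]
    module
  · rw [nthProd_W1, opL_W2_eq_zero α _ _ _ _ (by omega), opR_W2_eq_zero α _ _ _ _ (by omega),
      add_zero]

/-- The bounds are K = 3 on the left, where mode 2 still pairs with the term e[-2], and M = 2 on the
right. The sum therefore has at most 5 - s terms. -/
theorem nthProd_W2_W2 (p q i j : Fin n) (s : ℤ) (N : ℕ) (hN : 5 - s ≤ N) :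
    nthProd (W2 α p q) s (W2 α i j) =
      ∑ l ∈ Finset.range N, ∑ u, opL α u q (s - 2 + l) (opR α p u (2 - 1 - l) (W2 α i j)) +
        (α * s) • opL α p q (s - 1) (W2 α i j) :=
  nthProd_W2 α p q s _ (fun a b _ hk => opL_W2_eq_zero α a b i j hk)
    (fun a b _ hk => opR_W2_eq_zero α a b i j hk) N (by omega)

theorem W2_W2_products_pos (p q i j : Fin n) :
    nthProd (W2 α p q) 1 (W2 α i j) =
      α • nthProd (W1 α p j) (-1) (W1 α i q)
      + nthProd (W1 α p q) (-1) (W1 α i j)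
      - (delta q i * α) • W2 α p j
      - (2 * delta q i * α ^ 2) • translation (W1 α p j)
      - (delta p j * α) • W2 α i q
      - delta i j • W2 α p q
      - (2 * delta i j * α) • translation (W1 α p q)
      - delta p q • W2 α i j ∧
    nthProd (W2 α p q) 2 (W2 α i j) =
      (delta p j * (2 * α ^ 2 - 1)) • W1 α i q
      - (delta i j * α) • W1 α p q
      - (delta i q * (2 * α ^ 2 - 1)) • W1 α p j
      + (delta p q * α) • W1 α i j ∧
    nthProd (W2 α p q) 3 (W2 α i j) =
      ((1 - 5 * α ^ 2) * delta p q * delta i j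
        + (2 * α - 6 * α ^ 3) * delta p j * delta i q) • VertexStructure.vac ∧
    ∀ s : ℤ, 3 < s → nthProd (W2 α p q) s (W2 α i j) = 0 := by
  refine ⟨?_, ?_, ?_, fun s hs => ?_⟩
  · have h := nthProd_W2_W2 α p q i j 1 4 (by norm_num)
    simp only [Finset.sum_range_succ, Finset.sum_range_zero, zero_add, Nat.cast_zero, Nat.cast_one,
      Nat.cast_ofNat, Int.reduceSub, Int.reduceAdd, Int.reduceNeg, sub_zero, add_zero, sub_self,
      Int.cast_one, mul_one, sum_opL_opR_one, sum_opL_opR_zero, sum_opL_one_opR, sum_opL_two_opR,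
      opL_W2_zero] at h
    rw [h]
    simp only [unitOp_zero_neg_one, TensorProduct.sub_tmul, ← TensorProduct.smul_tmul',
      Finset.sum_sub_distrib, ← Finset.smul_sum, sum_delta_smul', nthProd_W1,
      opL_W1, opR_W1, W2_eq, translation_W1, quadGen]
    -- The contraction produces e_{iq}[-1] e_{pj}[-1], whereas the product of two W^(1) gives the
    -- opposite order.
    rw [unitOp_unitVec_swap α p j i q (-1) (-1) (by norm_num), delta_comm j p, delta_comm q p,
      delta_comm j i]
    simp only [TensorProduct.add_tmul, TensorProduct.sub_tmul, ← TensorProduct.smul_tmul',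
      Int.reduceNeg, Int.reduceAdd]
    module
  · have h := nthProd_W2_W2 α p q i j 2 3 (by norm_num)
    simp only [Finset.sum_range_succ, Finset.sum_range_zero, zero_add, Nat.cast_zero, Nat.cast_one,
      Nat.cast_ofNat, Int.reduceSub, Int.reduceNeg, sub_zero, sub_self,
      Int.cast_ofNat, sum_opL_opR_one, sum_opL_one_opR, sum_opL_two_opR, opL_W2_one] at h
    rw [h]
    simp only [unitOp_zero_neg_one, TensorProduct.sub_tmul, TensorProduct.tmul_sub,
      ← TensorProduct.smul_tmul', TensorProduct.tmul_smul, W1,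
      unitVec_of_nonneg α _ _ le_rfl, TensorProduct.tmul_zero, Finset.sum_const_zero]
    rw [delta_comm q p, delta_comm j i, delta_comm j p, delta_comm q i]
    module
  · have h := nthProd_W2_W2 α p q i j 3 2 (by norm_num)
    simp only [Finset.sum_range_succ, Finset.sum_range_zero, zero_add, Nat.cast_zero, Nat.cast_one,
      Int.reduceSub, Int.reduceAdd, sub_zero, add_zero, sub_self, Int.cast_ofNat,
      sum_opL_opR_one, sum_opL_two_opR, opL_W2_two] at h
    rw [h]
    simp only [unitOp_one_neg_one, ← TensorProduct.smul_tmul', unitVec_of_nonneg α _ _ le_rfl,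
      TensorProduct.tmul_zero, vac_tmul_vac]
    rw [delta_comm q p, delta_comm q i]
    module
  -- For s ≥ 4 only left mode s - 2 with right mode 1 is left. At s = 4 the right mode has already
  -- reduced the vector to single currents, which left mode 2 kills; for s ≥ 5 the left mode is at
  -- least 3 and kills W^(2) directly.
  · have h := nthProd_W2_W2 α p q i j s 1 (by norm_num; omega)
    rw [h, opL_W2_eq_zero α _ _ _ _ (by omega), smul_zero, add_zero, Finset.sum_range_one]
    refine Finset.sum_eq_zero fun u _ => ?_
    obtain rfl | hs' := (show 4 ≤ s from hs).eq_or_lt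
    · simp only [Nat.cast_zero, Int.reduceSub, add_zero, sub_zero]
      rw [opR_W2_one]
      simp [opL_tmul, unitOp_neg_one_eq_zero]
    · rw [opL_opR, opL_W2_eq_zero α _ _ _ _ (by simp; omega), map_zero]

theorem W2_W2_products_zero (p q i j : Fin n) :
    nthProd (W2 α p q) 0 (W2 α i j) =
      nthProd (W2 α p j) (-1) (W1 α i q) - nthProd (W1 α p j) (-1) (W2 α i q)
      + α • nthProd (translation (W1 α p j)) (-1) (W1 α i q)
      + nthProd (translation (W1 α p q)) (-1) (W1 α i j)
      - (delta q i * α) • translation (W2 α p j)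
      - (delta i q * ((2 * α ^ 2 + 1) / 2)) • translation (translation (W1 α p j))
      - delta i j • translation (W2 α p q)
      - (3 / 2 * delta i j * α) • translation (translation (W1 α p q)) := by
  have h := nthProd_W2_W2 α p q i j 0 5 (by norm_num)
  simp only [Finset.sum_range_succ, Finset.sum_range_zero, zero_add, Nat.cast_zero, Nat.cast_one,
    Nat.cast_ofNat, Int.reduceSub, Int.reduceAdd, Int.reduceNeg, sub_zero, add_zero, sub_self,
    Int.cast_zero, mul_zero, zero_smul, sum_opL_opR_one, sum_opL_opR_zero, sum_opL_zero_opR,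
    sum_opL_one_opR, sum_opL_two_opR] at h
  rw [h, nthProd_W2_neg_one_W1]
  -- `e₁` and `e₂` reverse the order of two currents of the first factor under the sum over u,
  -- matching W^(2)W^(1) and W^(1)W^(2) on the right-hand side. After that, the identity is linear
  -- in the remaining vectors.
  have e₁ : ∑ u, unitOp α i q (-1) (unitVec α u j (-1)) ⊗ₜ[ℂ] unitVec α p u (-1) =
      ∑ u, unitOp α u j (-1) (unitVec α i q (-1)) ⊗ₜ[ℂ] unitVec α p u (-1) +
        unitVec α i j (-2) ⊗ₜ unitVec α p q (-1) -
          delta i j • ∑ u, unitVec α u q (-2) ⊗ₜ unitVec α p u (-1) := by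
    simp only [unitOp_unitVec_swap α i q _ j (-1) (-1) (by norm_num), TensorProduct.add_tmul,
      TensorProduct.sub_tmul, ← TensorProduct.smul_tmul', Finset.sum_add_distrib,
      Finset.sum_sub_distrib, ← Finset.smul_sum, Int.reduceNeg, Int.reduceAdd]
    rw [sum_delta_smul', delta_comm j i, add_sub_assoc]
  have e₂ : ∑ u, unitOp α u q (-1) (unitVec α p j (-1)) ⊗ₜ[ℂ] unitVec α i u (-1) =
      ∑ u, unitOp α p j (-1) (unitVec α u q (-1)) ⊗ₜ[ℂ] unitVec α i u (-1) +
        delta p q • ∑ u, unitVec α u j (-2) ⊗ₜ unitVec α i u (-1) -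
          unitVec α p q (-2) ⊗ₜ unitVec α i j (-1) := by
    simp only [unitOp_unitVec_swap α _ q p j (-1) (-1) (by norm_num), TensorProduct.add_tmul,
      TensorProduct.sub_tmul, ← TensorProduct.smul_tmul', Finset.sum_add_distrib,
      Finset.sum_sub_distrib, ← Finset.smul_sum, Int.reduceNeg, Int.reduceAdd]
    rw [sum_delta_smul', delta_comm q p, add_sub_assoc]
  rw [e₁, e₂, nthProd_W1, nthProd_translation_W1, nthProd_translation_W1, opL_W2, opR_W2,
    translation_W2, translation_W2, translation_translation_W1, translation_translation_W1,
    opL_W1, opL_W1, opR_W1, opR_W1, opL_quadGen, opR_quadGen,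
    unitOp_unitVec_swap α p j i q (-1) (-2) (by norm_num),
    unitOp_unitVec_swap α p j i q (-2) (-1) (by norm_num),
    delta_comm j i, delta_comm q p, delta_comm q i]
  simp only [TensorProduct.add_tmul, TensorProduct.sub_tmul, ← TensorProduct.smul_tmul',
    TensorProduct.tmul_add, TensorProduct.tmul_sub, TensorProduct.tmul_smul, Int.reduceNeg,
    Int.reduceAdd]
  module

theorem rectOPE : RectOPE α (W1 (n := n) α) (W2 α) where
  one_one := W1_W1_products α
  one_two := W1_W2_products α
  two_two p q i j := ⟨W2_W2_products_zero α p q i j, W2_W2_products_pos α p q i j⟩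

end Generators

/-! ### The generators as a word system, with degrees 1 and 2. -/

section WordSystem

variable {V : Type*} [AddCommGroup V] [Module ℂ V] [VertexStructure V] {n : ℕ}

/-- Two families of states indexed by matrix entries as a single family. -/
def joinFam (w₁ w₂ : Fin n → Fin n → V) (x : Bool × Fin n × Fin n) : V :=
  if x.1 then w₂ x.2.1 x.2.2 else w₁ x.2.1 x.2.2

/-- The degrees of the members of `joinFam`. -/
def joinDeg (x : Bool × Fin n × Fin n) : ℕ := if x.1 then 2 else 1

theorem IsRegular.translation (hV : HasVacuumIdentity V) {a : V} (ha : IsRegular a) :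
    IsRegular (translation a) where
  assoc m b := by
    rw [ha.nthProd_translation hV, map_smul, ha.assoc, RectW.translation, ha.assoc, hV,
      fieldProd_deriv]
  isLocal b := by
    rw [RectW.translation, ha.assoc, hV]
    exact ((ha.isLocal b).symm.fieldProd (isLocal_idField _) (isLocal_idField _) (-2)).symm

theorem nthProd_eq_zero_or_natCast {P : V → Prop} (h0 : P 0) {a b : V} {N : ℕ}
    (hN : ∀ s : ℤ, N < s → nthProd a s b = 0) (h : ∀ j : ℕ, j ≤ N → P (nthProd a j b)) (j : ℕ) :
    P (nthProd a j b) := by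
  by_cases hj : j ≤ N
  · exact h j hj
  · rw [hN _ (by omega)]; exact h0

/-- With these degrees every nonnegative product of two generators has degree at most the sum of the
degrees minus one: linear terms have degree at most 2, quadratic terms at most 3, and derivatives
cost nothing because the modes of ∂a are multiples of modes of a. -/
theorem RectOPE.isWordSystem (hV : HasVacuumIdentity V) {α : ℂ} {w₁ w₂ : Fin n → Fin n → V}
    (h : RectOPE α w₁ w₂) (hr₁ : ∀ i j, IsRegular (w₁ i j)) (hr₂ : ∀ i j, IsRegular (w₂ i j))
    (hc₁ : ∀ i j, IsCreative (w₁ i j)) (hc₂ : ∀ i j, IsCreative (w₂ i j)) :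
    IsWordSystem (modes (joinFam w₁ w₂)) VertexStructure.vac joinDeg := by
  have g₁ : ∀ {D : ℕ}, 1 ≤ D → ∀ i j, HasQuadModes (joinFam w₁ w₂) joinDeg D (w₁ i j) :=
    fun hD i j => HasQuadModes.gen (w := joinFam w₁ w₂) (i := (false, i, j)) hD
  have g₂ : ∀ {D : ℕ}, 2 ≤ D → ∀ i j, HasQuadModes (joinFam w₁ w₂) joinDeg D (w₂ i j) :=
    fun hD i j => HasQuadModes.gen (w := joinFam w₁ w₂) (i := (true, i, j)) hD
  have v : ∀ {D : ℕ}, HasQuadModes (joinFam w₁ w₂) joinDeg D VertexStructure.vac :=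
    HasQuadModes.vac hV
  have m₁₁ : ∀ i j p q (s : ℤ), HasQuadModes (joinFam w₁ w₂) joinDeg 3
      (nthProd (w₁ i j) s (w₁ p q)) := fun i j p q s =>
    HasQuadModes.nthProd (w := joinFam w₁ w₂) (i := (false, i, j)) (k := (false, p, q))
      (hr₁ i j) s (by simp [joinDeg])
  have m₁₂ : ∀ i j p q (s : ℤ), HasQuadModes (joinFam w₁ w₂) joinDeg 3
      (nthProd (w₁ i j) s (w₂ p q)) := fun i j p q s =>
    HasQuadModes.nthProd (w := joinFam w₁ w₂) (i := (false, i, j)) (k := (true, p, q))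
      (hr₁ i j) s (by simp [joinDeg])
  have m₂₁ : ∀ i j p q (s : ℤ), HasQuadModes (joinFam w₁ w₂) joinDeg 3
      (nthProd (w₂ i j) s (w₁ p q)) := fun i j p q s =>
    HasQuadModes.nthProd (w := joinFam w₁ w₂) (i := (true, i, j)) (k := (false, p, q))
      (hr₂ i j) s (by simp [joinDeg])
  have c₁₂ : ∀ p q i j (m r : ℤ) (x : V),
      modes (joinFam w₁ w₂) (false, p, q) m (modes (joinFam w₁ w₂) (true, i, j) r x) -
        modes (joinFam w₁ w₂) (true, i, j) r (modes (joinFam w₁ w₂) (false, p, q) m x) ∈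
      quadSpan (modes (joinFam w₁ w₂)) joinDeg 2 x := by
    intro p q i j m r x
    refine IsRegular.comm_mem_quadSpan (w := joinFam w₁ w₂) (i := (false, p, q)) (k := (true, i, j)) (hr₁ p q) ?_ m r x
    obtain ⟨h0, h1, h2, h3⟩ := h.one_two p q i j
    refine nthProd_eq_zero_or_natCast HasQuadModes.zero (N := 2) h3 fun s hs => ?_
    change HasQuadModes _ _ _ (nthProd (w₁ p q) s (w₂ i j))
    interval_cases s
    · rw [Nat.cast_zero, h0]
      exact ((g₂ le_rfl _ _).smul _).neg.add ((g₂ le_rfl _ _).smul _)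
    · rw [Nat.cast_one, h1]
      exact ((g₁ one_le_two _ _).smul _).add ((g₁ one_le_two _ _).smul _)
    · rw [Nat.cast_ofNat, h2]
      exact v.smul _
  refine ⟨?_, ?_, ?_⟩
  · rintro ⟨_ | _, i, j⟩ <;> simp [joinDeg]
  · rintro ⟨_ | _, i, j⟩ m hm
    · exact (hc₁ i j).nonneg m hm
    · exact (hc₂ i j).nonneg m hm
  · rintro ⟨_ | _, p, q⟩ ⟨_ | _, i, j⟩ m r x
    · refine IsRegular.comm_mem_quadSpan (w := joinFam w₁ w₂) (i := (false, p, q)) (k := (false, i, j)) (hr₁ p q) ?_ m r x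
      obtain ⟨h0, h1, h3⟩ := h.one_one p q i j
      refine nthProd_eq_zero_or_natCast HasQuadModes.zero (N := 1) h3 fun s hs => ?_
      change HasQuadModes _ _ 1 (nthProd (w₁ p q) s (w₁ i j))
      interval_cases s
      · rw [Nat.cast_zero, h0]
        exact ((g₁ le_rfl _ _).smul _).sub ((g₁ le_rfl _ _).smul _)
      · rw [Nat.cast_one, h1]
        exact v.smul _
    · exact c₁₂ p q i j m r x
    · rw [← neg_sub]
      exact neg_mem (c₁₂ i j p q r m x)
    · refine IsRegular.comm_mem_quadSpan (w := joinFam w₁ w₂) (i := (true, p, q))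
        (k := (true, i, j)) (hr₂ p q) ?_ m r x
      obtain ⟨h0, h1, h2, h3, h4⟩ := h.two_two p q i j
      refine nthProd_eq_zero_or_natCast HasQuadModes.zero (N := 3) h4 fun s hs => ?_
      change HasQuadModes _ _ 3 (nthProd (w₂ p q) s (w₂ i j))
      interval_cases s
      -- The product of ∂a with index -1 is the product of a with index -2, so the terms with a
      -- derivative inside are again products of two generators.
      · rw [Nat.cast_zero, h0, (hr₁ p j).nthProd_translation hV,
          (hr₁ p q).nthProd_translation hV]
        exact ((((((((m₂₁ _ _ _ _ _).sub (m₁₂ _ _ _ _ _)).add (((m₁₁ _ _ _ _ _).smul _).smul _)).add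
          ((m₁₁ _ _ _ _ _).smul _)).sub (((g₂ (by norm_num) _ _).translation hV (hr₂ _ _)).smul _)).sub
          ((((g₁ (by norm_num) _ _).translation hV (hr₁ _ _)).translation hV ((hr₁ _ _).translation hV)).smul _)).sub
          (((g₂ (by norm_num) _ _).translation hV (hr₂ _ _)).smul _)).sub
          ((((g₁ (by norm_num) _ _).translation hV (hr₁ _ _)).translation hV ((hr₁ _ _).translation hV)).smul _))
      · rw [Nat.cast_one, h1]
        exact (((((((((m₁₁ _ _ _ _ _).smul _).add (m₁₁ _ _ _ _ _)).sub
          ((g₂ (by norm_num) _ _).smul _)).sub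
          (((g₁ (by norm_num) _ _).translation hV (hr₁ _ _)).smul _)).sub
          ((g₂ (by norm_num) _ _).smul _)).sub ((g₂ (by norm_num) _ _).smul _)).sub
          (((g₁ (by norm_num) _ _).translation hV (hr₁ _ _)).smul _)).sub
          ((g₂ (by norm_num) _ _).smul _))
      · rw [Nat.cast_ofNat, h2]
        exact (((((g₁ (by norm_num) _ _).smul _).sub ((g₁ (by norm_num) _ _).smul _)).sub
          ((g₁ (by norm_num) _ _).smul _)).add ((g₁ (by norm_num) _ _).smul _))
      · rw [Nat.cast_ofNat, h3]
        exact v.smul _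

end WordSystem

end

section

attribute [local instance] LieRing.ofAssociativeRing

/-! ### Induced modules realized on the enveloping algebra of a complementary subalgebra. -/

section Induced

variable {L : Type*} [LieRing L] [LieAlgebra ℂ L]

theorem uea_left_induction {p : UniversalEnvelopingAlgebra ℂ L → Prop} (one : p 1)
    (add : ∀ u v, p u → p v → p (u + v)) (smul : ∀ (c : ℂ) u, p u → p (c • u))
    (gen_mul : ∀ x u, p u → p (UniversalEnvelopingAlgebra.ι ℂ x * u)) (u) : p u := by
  have key : ∀ w, p w → p (u * w) := by
    induction u using uea_induction with
    | scalar a => intro w hw; rw [← Algebra.smul_def]; exact smul a w hw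
    | gen x => exact gen_mul x
    | mul u v hu hv => intro w hw; rw [mul_assoc]; exact hu _ (hv _ hw)
    | add u v hu hv => intro w hw; rw [add_mul]; exact add _ _ (hu _ hw) (hv _ hw)
  simpa using key 1 one

variable (a : LieSubalgebra ℂ L)

/-- The action of `y ∈ a` on linear maps `L → U(a)`, by `f ↦ (x ↦ y f(x) + f([x, y]))`. -/
def coindOp (y : a) : Module.End ℂ (L →ₗ[ℂ] UniversalEnvelopingAlgebra ℂ a) where
  toFun f := LinearMap.mulLeft ℂ (UniversalEnvelopingAlgebra.ι ℂ y) ∘ₗ f -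
    f ∘ₗ (LieAlgebra.ad ℂ L (y : L) : Module.End ℂ L)
  map_add' f g := by
    ext x
    simp only [LinearMap.sub_apply, LinearMap.comp_apply, LinearMap.add_apply, map_add]
    abel
  map_smul' c f := by
    ext x
    simp only [LinearMap.sub_apply, LinearMap.comp_apply, LinearMap.smul_apply, map_smul,
      smul_sub, RingHom.id_apply]

theorem coindOp_apply (y : a) (f : L →ₗ[ℂ] UniversalEnvelopingAlgebra ℂ a) (x : L) :
    coindOp a y f x = UniversalEnvelopingAlgebra.ι ℂ y * f x - f ⁅(y : L), x⁆ := rfl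

/-- `coindOp` as a representation of `a`. -/
def coindRep : a →ₗ⁅ℂ⁆ Module.End ℂ (L →ₗ[ℂ] UniversalEnvelopingAlgebra ℂ a) where
  toFun := coindOp a
  map_add' y z := by
    ext f x
    simp only [coindOp_apply, LinearMap.add_apply, map_add, add_mul, AddMemClass.coe_add, add_lie]
    abel
  map_smul' c y := by
    ext f x
    simp only [coindOp_apply, LinearMap.smul_apply, map_smul, smul_mul_assoc, RingHom.id_apply,
      SetLike.val_smul, smul_lie, smul_sub]
  map_lie' := by
    intro y z
    ext f x
    have h : (coindOp a y * coindOp a z) f x - (coindOp a z * coindOp a y) f x =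
        coindOp a ⁅y, z⁆ f x := by
      simp only [Module.End.mul_apply, coindOp_apply, LieHom.map_lie, LieSubalgebra.coe_bracket,
        LieRing.of_associative_ring_bracket, mul_sub, sub_mul, mul_assoc, lie_lie, map_sub]
      abel
    exact h.symm

variable (π : L →ₗ[ℂ] a) (χ : L →ₗ[ℂ] ℂ)

/-- The linear map `L → U(a)` describing the action on the generator of the induced module. -/
def inducedGen : L →ₗ[ℂ] UniversalEnvelopingAlgebra ℂ a :=
  (UniversalEnvelopingAlgebra.ι ℂ : a →ₗ⁅ℂ⁆ UniversalEnvelopingAlgebra ℂ a).toLinearMap ∘ₗ π +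
    Algebra.linearMap ℂ _ ∘ₗ χ

/-- The action of `x ∈ L` on the induced module, realized on `U(a)`. -/
def inducedOp : L →ₗ[ℂ] Module.End ℂ (UniversalEnvelopingAlgebra ℂ a) :=
  LinearMap.flip ((LinearMap.applyₗ (inducedGen a π χ)) ∘ₗ
    (UniversalEnvelopingAlgebra.lift ℂ (coindRep a)).toLinearMap)

theorem inducedOp_one (x : L) :
    inducedOp a π χ x 1 = UniversalEnvelopingAlgebra.ι ℂ (π x) + algebraMap ℂ _ (χ x) := by
  change UniversalEnvelopingAlgebra.lift ℂ (coindRep a) 1 (inducedGen a π χ) x = _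
  rw [map_one]
  rfl

/-- With `inducedOp_one` this is the recursion of an induced module: x acts on 1 by π(x) + χ(x), and
x(yu) = y(xu) - [y, x]u for y in the subalgebra. Regarding x ↦ xu as a linear map L → U(a) makes the
recursion a Lie algebra action on such maps, which extends to U(a); no basis of U(a) is chosen. -/
theorem inducedOp_gen_mul (x : L) (y : a) (u : UniversalEnvelopingAlgebra ℂ a) :
    inducedOp a π χ x (UniversalEnvelopingAlgebra.ι ℂ y * u) =
      UniversalEnvelopingAlgebra.ι ℂ y * inducedOp a π χ x u - inducedOp a π χ ⁅(y : L), x⁆ u := by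
  change UniversalEnvelopingAlgebra.lift ℂ (coindRep a) _ (inducedGen a π χ) x = _
  rw [map_mul, UniversalEnvelopingAlgebra.lift_ι_apply]
  rfl

variable {a π χ}

theorem inducedOp_of_mem (hπ : ∀ y : a, π y = y) (hχ : ∀ y : a, χ y = 0) (y : a)
    (u : UniversalEnvelopingAlgebra ℂ a) :
    inducedOp a π χ y u = UniversalEnvelopingAlgebra.ι ℂ y * u := by
  induction u using uea_left_induction generalizing y with
  | one => rw [inducedOp_one, hπ, hχ, map_zero, add_zero, mul_one]
  | add u v hu hv => rw [map_add, hu, hv, mul_add]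
  | smul c u hu => rw [map_smul, hu, mul_smul_comm]
  | gen_mul z u hu =>
    rw [inducedOp_gen_mul, hu, ← LieSubalgebra.coe_bracket, hu, LieHom.map_lie,
      LieRing.of_associative_ring_bracket, sub_mul, mul_assoc, mul_assoc]
    abel

/-- L is the sum of a and ker π. On u = 1, a bracket with an element of a is covered by the
recursion, and two elements of ker π act on 1 by scalars, while π and χ vanish on their bracket. The
passage from u to zu is the Jacobi identity. -/
theorem inducedOp_lie (hπ : ∀ y : a, π y = y) (hχ : ∀ y : a, χ y = 0)
    (hker : ∀ x y, π x = 0 → π y = 0 → π ⁅x, y⁆ = 0 ∧ χ ⁅x, y⁆ = 0) (x y : L)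
    (u : UniversalEnvelopingAlgebra ℂ a) :
    inducedOp a π χ x (inducedOp a π χ y u) - inducedOp a π χ y (inducedOp a π χ x u) =
      inducedOp a π χ ⁅x, y⁆ u := by
  induction u using uea_left_induction generalizing x y with
  | one =>
    have left : ∀ (x : a) (y : L),
        inducedOp a π χ x (inducedOp a π χ y 1) - inducedOp a π χ y (inducedOp a π χ x 1) =
          inducedOp a π χ ⁅(x : L), y⁆ 1 := by
      intro x y
      rw [inducedOp_of_mem hπ hχ, inducedOp_of_mem hπ hχ, inducedOp_gen_mul]
      abel
    have ker : ∀ x y : L, π x = 0 → π y = 0 →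
        inducedOp a π χ x (inducedOp a π χ y 1) - inducedOp a π χ y (inducedOp a π χ x 1) =
          inducedOp a π χ ⁅x, y⁆ 1 := by
      intro x y hx hy
      obtain ⟨h1, h2⟩ := hker x y hx hy
      simp only [inducedOp_one, hx, hy, h1, h2, map_zero, zero_add, Algebra.algebraMap_eq_smul_one,
        map_smul, smul_smul, mul_comm (χ x), sub_self]
    have hk : ∀ x : L, π (x - π x) = 0 := fun x => by rw [map_sub, hπ, sub_self]
    -- Decompose [x, y] as [πx, y] - [πy, x - πx] + [x - πx, y - πy] and add the three relations.
    have e1 := left (π x) y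
    have e2 := left (π y) (x - π x)
    have e3 := ker _ _ (hk x) (hk y)
    simp only [map_sub, LinearMap.sub_apply, lie_sub, sub_lie] at e1 e2 e3 ⊢
    rw [← lie_skew (π y : L) x, ← lie_skew (π y : L) (π x : L)] at e2
    simp only [map_neg, LinearMap.neg_apply] at e2
    rw [← sub_eq_zero] at e1 e2 e3 ⊢
    have := congrArg₂ (· + ·) (congrArg₂ (· - ·) e1 e2) e3
    simp only [sub_zero, add_zero] at this
    rw [← this]
    abel
  | add u v hu hv => simp only [map_add, ← hu, ← hv]; abel
  | smul c u hu => simp only [map_smul, ← hu, smul_sub]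
  | gen_mul z u hu =>
    simp only [inducedOp_gen_mul, map_sub]
    rw [leibniz_lie (z : L) x y, map_add, LinearMap.add_apply, ← hu ⁅(z : L), x⁆ y,
      ← hu x ⁅(z : L), y⁆, ← hu x y, mul_sub]
    abel

end Induced

end

section

attribute [local instance] LieRing.ofAssociativeRing

/-! ### The vacuum module mapped to the enveloping algebra of the negative loops. -/

section AffineInduced

variable {g : Type*} [LieRing g] [LieAlgebra ℂ g] (κ : InvForm g)
variable {M : Type*} [AddCommGroup M] [Module ℂ M]

/-- The linear map on the affine Lie algebra with `x t^m ↦ f m x` and `K ↦ c`. -/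
def loopLift (f : ℤ → g →ₗ[ℂ] M) (c : M) : AffineLie κ →ₗ[ℂ] M where
  toFun X := Finsupp.lsum ℂ f
      (LieAlgebra.LoopAlgebra.toFinsupp ℂ ℤ g ((LieAlgebra.ofProd _).symm X).1) +
    (TrivialLieModule.equiv ℂ _ ℂ ((LieAlgebra.ofProd _).symm X).2) • c
  map_add' X Y := by
    simp only [LieAlgebra.of_symm_add, Prod.fst_add, Prod.snd_add, map_add, add_smul]
    abel
  map_smul' a X := by
    simp only [LieAlgebra.of_symm_smul, Prod.smul_fst, Prod.smul_snd, map_smul, smul_add,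
      smul_assoc, RingHom.id_apply]

theorem loopLift_loopElt (f : ℤ → g →ₗ[ℂ] M) (c : M) (x : g) (m : ℤ) :
    loopLift κ f c (loopElt κ x m) = f m x := by
  simp only [loopLift, loopElt, LinearMap.coe_mk, AddHom.coe_mk, Equiv.symm_apply_apply,
    LieAlgebra.LoopAlgebra.toFinsupp_single_tmul, map_zero, zero_smul, add_zero,
    Finsupp.lsum_single]

theorem loopLift_centralElt (f : ℤ → g →ₗ[ℂ] M) (c : M) :
    loopLift κ f c (centralElt κ) = c := by
  simp [loopLift, centralElt]

/-- `x ↦ x t^m` as a linear map. -/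
def loopEltLin (m : ℤ) : g →ₗ[ℂ] AffineLie κ where
  toFun x := loopElt κ x m
  map_add' x y := UnivAffine.loopElt_add κ x y m
  map_smul' c x := UnivAffine.loopElt_smul κ c x m

/-- The projection of the affine Lie algebra onto its negative part. -/
def negProj : AffineLie κ →ₗ[ℂ] AffineLie κ :=
  loopLift κ (fun m => if m < 0 then loopEltLin κ m else 0) 0

theorem negProj_of_neg (x : g) {m : ℤ} (hm : m < 0) :
    negProj κ (loopElt κ x m) = loopElt κ x m := by
  rw [negProj, loopLift_loopElt, if_pos hm]; rfl

theorem negProj_of_nonneg (x : g) {m : ℤ} (hm : 0 ≤ m) : negProj κ (loopElt κ x m) = 0 := by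
  rw [negProj, loopLift_loopElt, if_neg (by omega)]; rfl

theorem negProj_centralElt : negProj κ (centralElt κ) = 0 := loopLift_centralElt _ _ _

theorem negProj_negProj (X : AffineLie κ) : negProj κ (negProj κ X) = negProj κ X := by
  induction X using affineLie_induction with
  | loop x m =>
    by_cases hm : m < 0
    · rw [negProj_of_neg κ x hm, negProj_of_neg κ x hm]
    · rw [negProj_of_nonneg κ x (by omega), map_zero]
  | central => rw [negProj_centralElt, map_zero]
  | add X Y hX hY => rw [map_add, map_add, hX, hY]
  | smul a X hX => rw [map_smul, map_smul, hX]

theorem negProj_lie (X Y : AffineLie κ) :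
    negProj κ ⁅negProj κ X, negProj κ Y⁆ = ⁅negProj κ X, negProj κ Y⁆ := by
  induction X using affineLie_induction with
  | central => rw [negProj_centralElt, zero_lie, map_zero]
  | add X X' hX hX' => rw [map_add, add_lie, map_add, hX, hX']
  | smul a X hX => rw [map_smul, smul_lie, map_smul, hX]
  | loop x m =>
    induction Y using affineLie_induction with
    | central => rw [negProj_centralElt, lie_zero, map_zero]
    | add X X' hX hX' => rw [map_add, lie_add, map_add, hX, hX']
    | smul a X hX => rw [map_smul, lie_smul, map_smul, hX]
    | loop y r =>
      by_cases hm : 0 ≤ m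
      · rw [negProj_of_nonneg κ x hm, zero_lie, map_zero]
      by_cases hr : 0 ≤ r
      · rw [negProj_of_nonneg κ y hr, lie_zero, map_zero]
      rw [negProj_of_neg κ x (by omega), negProj_of_neg κ y (by omega), lie_loopElt,
        if_neg (by omega), zero_smul, add_zero, negProj_of_neg κ _ (by omega)]

/-- The negative part `t⁻¹ g[t⁻¹]` of the affine Lie algebra. -/
def negPart : LieSubalgebra ℂ (AffineLie κ) where
  carrier := {X | negProj κ X = X}
  add_mem' {X Y} hX hY := by
    change negProj κ (X + Y) = X + Y
    rw [map_add, hX, hY]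
  zero_mem' := map_zero _
  smul_mem' c X hX := by
    change negProj κ (c • X) = c • X
    rw [map_smul, hX]
  lie_mem' {X Y} hX hY := by
    change negProj κ X = X at hX
    change negProj κ Y = Y at hY
    change negProj κ ⁅X, Y⁆ = ⁅X, Y⁆
    rw [← hX, ← hY]
    exact negProj_lie κ X Y

/-- The projection onto the negative part. -/
def negPartProj : AffineLie κ →ₗ[ℂ] negPart κ :=
  (negProj κ).codRestrict (negPart κ).toSubmodule (negProj_negProj κ)

/-- The coefficient of `K`. -/
def centralCoeff : AffineLie κ →ₗ[ℂ] ℂ := loopLift κ 0 1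

theorem centralCoeff_loopElt (x : g) (m : ℤ) : centralCoeff κ (loopElt κ x m) = 0 :=
  loopLift_loopElt _ _ _ _ _

theorem centralCoeff_negProj (X : AffineLie κ) : centralCoeff κ (negProj κ X) = 0 := by
  induction X using affineLie_induction with
  | loop x m =>
    by_cases hm : m < 0
    · rw [negProj_of_neg κ x hm, centralCoeff_loopElt]
    · rw [negProj_of_nonneg κ x (by omega), map_zero]
  | central => rw [negProj_centralElt, map_zero]
  | add X Y hX hY => rw [map_add, map_add, hX, hY, add_zero]
  | smul a X hX => rw [map_smul, map_smul, hX, smul_zero]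

/-- The complement of the negative part is g[t] ⊕ ℂK. The cocycle vanishes on it: with nonnegative
exponents, m + r = 0 forces m = 0, and the coefficient is m. So it is closed under brackets and the
coefficient of K is a character of it. -/
theorem lie_sub_negProj (X Y : AffineLie κ) :
    negProj κ ⁅X - negProj κ X, Y - negProj κ Y⁆ = 0 ∧
      centralCoeff κ ⁅X - negProj κ X, Y - negProj κ Y⁆ = 0 := by
  induction X using affineLie_induction with
  | central =>
    rw [negProj_centralElt, sub_zero, ← lie_skew, lie_centralElt]
    simp
  | add X X' hX hX' =>
    rw [map_add, add_sub_add_comm, add_lie, map_add, map_add, hX.1, hX.2, hX'.1, hX'.2]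
    simp
  | smul a X hX =>
    rw [map_smul, ← smul_sub, smul_lie, map_smul, map_smul, hX.1, hX.2]
    simp
  | loop x m =>
    by_cases hm : 0 ≤ m
    · induction Y using affineLie_induction with
      | central =>
        rw [negProj_centralElt, sub_zero, lie_centralElt]
        simp
      | add X X' hX hX' =>
        rw [map_add, add_sub_add_comm, lie_add, map_add, map_add, hX.1, hX.2, hX'.1, hX'.2]
        simp
      | smul a X hX =>
        rw [map_smul, ← smul_sub, lie_smul, map_smul, map_smul, hX.1, hX.2]
        simp
      | loop y r =>
        by_cases hr : 0 ≤ r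
        · rw [negProj_of_nonneg κ x hm, negProj_of_nonneg κ y hr, sub_zero, sub_zero, lie_loopElt]
          have hc : (if m + r = 0 then (m : ℂ) * κ.form x y else 0) = 0 := by
            split_ifs with h
            · obtain rfl : m = 0 := by omega
              simp
            · rfl
          rw [hc, zero_smul, add_zero, negProj_of_nonneg κ _ (by omega), centralCoeff_loopElt]
          exact ⟨rfl, rfl⟩
        · rw [negProj_of_neg κ y (by omega), sub_self, lie_zero]
          simp
    · rw [negProj_of_neg κ x (by omega), sub_self, zero_lie]
      simp

theorem negPartProj_coe (y : negPart κ) : negPartProj κ y = y := Subtype.ext y.2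

theorem centralCoeff_coe (y : negPart κ) : centralCoeff κ y = 0 := by
  have h : negProj κ y = y := y.2
  rw [← h, centralCoeff_negProj]

theorem lie_of_negPartProj_eq_zero (X Y : AffineLie κ) (hX : negPartProj κ X = 0)
    (hY : negPartProj κ Y = 0) : negPartProj κ ⁅X, Y⁆ = 0 ∧ centralCoeff κ ⁅X, Y⁆ = 0 := by
  have hX' : negProj κ X = 0 := congrArg Subtype.val hX
  have hY' : negProj κ Y = 0 := congrArg Subtype.val hY
  have h := lie_sub_negProj κ X Y
  rw [hX', hY', sub_zero, sub_zero] at h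
  exact ⟨Subtype.ext h.1, h.2⟩

/-- The action of the affine Lie algebra on the enveloping algebra of its negative part. -/
def negRep : AffineLie κ →ₗ⁅ℂ⁆ Module.End ℂ (UniversalEnvelopingAlgebra ℂ (negPart κ)) :=
  { inducedOp (negPart κ) (negPartProj κ) (centralCoeff κ) with
    map_lie' := by
      intro X Y
      ext u
      exact (inducedOp_lie (negPartProj_coe κ) (centralCoeff_coe κ)
        (lie_of_negPartProj_eq_zero κ) X Y u).symm }

theorem negRep_one (X : AffineLie κ) : negRep κ X 1 =
    UniversalEnvelopingAlgebra.ι ℂ (negPartProj κ X) + algebraMap ℂ _ (centralCoeff κ X) :=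
  inducedOp_one _ _ _ _

/-- The map from the vacuum module to the enveloping algebra of the negative part. -/
def toNegEnv : UnivAffine κ →ₗ[ℂ] UniversalEnvelopingAlgebra ℂ (negPart κ) :=
  Submodule.liftQ ((vacuumIdeal κ).restrictScalars ℂ)
    ((LinearMap.applyₗ 1).comp (UniversalEnvelopingAlgebra.lift ℂ (negRep κ)).toLinearMap)
    (by
      intro u hu
      rw [Submodule.restrictScalars_mem] at hu
      rw [LinearMap.mem_ker]
      change UniversalEnvelopingAlgebra.lift ℂ (negRep κ) u 1 = 0
      induction hu using Submodule.span_induction with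
      | zero => simp
      | add u v _ _ hu hv => rw [map_add, LinearMap.add_apply, hu, hv, add_zero]
      | smul a u _ hu => rw [smul_eq_mul, map_mul, Module.End.mul_apply, hu, map_zero]
      | mem u hu =>
        rcases hu with ⟨x, m, hm, rfl⟩ | rfl
        · rw [UniversalEnvelopingAlgebra.lift_ι_apply, negRep_one, centralCoeff_loopElt,
            show negPartProj κ (loopElt κ x m) = 0 from Subtype.ext (negProj_of_nonneg κ x hm)]
          simp
        · rw [map_sub, UniversalEnvelopingAlgebra.lift_ι_apply,
            map_one (UniversalEnvelopingAlgebra.lift ℂ (negRep κ)), LinearMap.sub_apply,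
            negRep_one, show negPartProj κ (centralElt κ) = 0 from
              Subtype.ext (negProj_centralElt κ), centralCoeff, loopLift_centralElt]
          simp)

theorem toNegEnv_vacuum : toNegEnv κ (UnivAffine.vacuum κ) = 1 := by
  change UniversalEnvelopingAlgebra.lift ℂ (negRep κ) 1 1 = _
  rw [map_one (UniversalEnvelopingAlgebra.lift ℂ (negRep κ))]
  rfl

/-- The element `x t^m` of the negative part. -/
def negElt (x : g) (m : ℤ) (hm : m < 0) : negPart κ := ⟨loopElt κ x m, negProj_of_neg κ x hm⟩

/-- Negative modes act by left multiplication, so a word in creation modes becomes the product of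
its letters in the enveloping algebra. Equivariance for these modes is all that the symbol
construction uses. -/
theorem toNegEnv_act (x : g) {m : ℤ} (hm : m < 0) (v : UnivAffine κ) :
    toNegEnv κ (UnivAffine.act κ (loopElt κ x m) v) =
      UniversalEnvelopingAlgebra.ι ℂ (negElt κ x m hm) * toNegEnv κ v := by
  obtain ⟨u, rfl⟩ := Submodule.Quotient.mk_surjective (vacuumIdeal κ) v
  change UniversalEnvelopingAlgebra.lift ℂ (negRep κ)
    (UniversalEnvelopingAlgebra.ι ℂ (loopElt κ x m) * u) 1 = _
  rw [map_mul, Module.End.mul_apply, UniversalEnvelopingAlgebra.lift_ι_apply]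
  exact inducedOp_of_mem (negPartProj_coe κ) (centralCoeff_coe κ) (negElt κ x m hm) _

end AffineInduced

end

section

attribute [local instance] LieRing.ofAssociativeRing

/-! ### Derivations of polynomial functions on loop matrices. -/

section LoopDerivations

variable {n : ℕ}

/-- The derivation by which `x t^m` acts on the polynomial functions on loop matrices. -/
def matDer (n : ℕ) (m : ℤ) : Matrix (Fin n) (Fin n) ℂ →ₗ[ℂ]
    Derivation ℂ (MvPolynomial (Fin n × Fin n × ℤ) ℂ) (MvPolynomial (Fin n × Fin n × ℤ) ℂ) where
  toFun x := MvPolynomial.mkDerivation ℂ fun c =>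
    ∑ a, x a c.1 • MvPolynomial.X (a, c.2.1, c.2.2 + m)
  map_add' x y := by
    apply MvPolynomial.derivation_ext
    intro c
    simp only [Derivation.add_apply, MvPolynomial.mkDerivation_X, Matrix.add_apply, add_smul,
      Finset.sum_add_distrib]
  map_smul' r x := by
    apply MvPolynomial.derivation_ext
    intro c
    simp only [Derivation.smul_apply, MvPolynomial.mkDerivation_X, Matrix.smul_apply, smul_assoc,
      Finset.smul_sum, RingHom.id_apply]

theorem matDer_X (m : ℤ) (x : Matrix (Fin n) (Fin n) ℂ) (c : Fin n × Fin n × ℤ) :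
    matDer n m x (MvPolynomial.X c) = ∑ a, x a c.1 • MvPolynomial.X (a, c.2.1, c.2.2 + m) :=
  MvPolynomial.mkDerivation_X _ _ _

theorem matDer_matDer_X (m r : ℤ) (x y : Matrix (Fin n) (Fin n) ℂ) (c : Fin n × Fin n × ℤ) :
    matDer n m x (matDer n r y (MvPolynomial.X c)) =
      ∑ a, (x * y) a c.1 • MvPolynomial.X (a, c.2.1, c.2.2 + (m + r)) := by
  simp only [matDer_X, map_sum, Derivation.map_smul, Finset.smul_sum, smul_smul, Matrix.mul_apply,
    Finset.sum_smul]
  rw [Finset.sum_comm]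
  refine Finset.sum_congr rfl fun a _ => Finset.sum_congr rfl fun b _ => ?_
  rw [mul_comm, add_assoc, add_comm r m]

/-- On coordinates two of these derivations compose to matrix multiplication with exponents added.
Both sides are derivations in `p`, so agreement on coordinates is enough. -/
theorem matDer_lie (m r : ℤ) (x y : Matrix (Fin n) (Fin n) ℂ)
    (p : MvPolynomial (Fin n × Fin n × ℤ) ℂ) :
    matDer n (m + r) ⁅x, y⁆ p = matDer n m x (matDer n r y p) - matDer n r y (matDer n m x p) := by
  rw [← Derivation.commutator_apply]
  congr 1
  apply MvPolynomial.derivation_ext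
  intro c
  rw [Derivation.commutator_apply, matDer_matDer_X, matDer_matDer_X, matDer_X, add_comm r m,
    ← Finset.sum_sub_distrib]
  refine Finset.sum_congr rfl fun a _ => ?_
  rw [← sub_smul, Ring.lie_def, Matrix.sub_apply]

variable (κ : InvForm (Matrix (Fin n) (Fin n) ℂ))

theorem loopLift_matDer_lie (X Y : AffineLie κ) (p : MvPolynomial (Fin n × Fin n × ℤ) ℂ) :
    loopLift κ (matDer n) 0 ⁅X, Y⁆ p =
      loopLift κ (matDer n) 0 X (loopLift κ (matDer n) 0 Y p) -
        loopLift κ (matDer n) 0 Y (loopLift κ (matDer n) 0 X p) := by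
  induction X using affineLie_induction with
  | central => rw [← lie_skew, lie_centralElt, neg_zero, map_zero, loopLift_centralElt]; simp
  | add X X' hX hX' =>
    simp only [add_lie, map_add, Derivation.add_apply, hX, hX']
    abel
  | smul a X hX => simp only [smul_lie, map_smul, Derivation.smul_apply, hX, Derivation.map_smul,
      smul_sub]
  | loop x m =>
    induction Y using affineLie_induction with
    | central => rw [lie_centralElt, map_zero, loopLift_centralElt]; simp
    | add X X' hX hX' =>
      simp only [lie_add, map_add, Derivation.add_apply, hX, hX']
      abel
    | smul a X hX => simp only [lie_smul, map_smul, Derivation.smul_apply, hX, Derivation.map_smul,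
        smul_sub]
    | loop y r =>
      rw [lie_loopElt, map_add, map_smul, loopLift_centralElt, smul_zero, add_zero,
        loopLift_loopElt, loopLift_loopElt, loopLift_loopElt, matDer_lie]

/-- The affine Lie algebra acting by derivations on the polynomial functions on loop matrices. -/
def loopDer : AffineLie κ →ₗ⁅ℂ⁆ Module.End ℂ (MvPolynomial (Fin n × Fin n × ℤ) ℂ) where
  toFun X := (loopLift κ (matDer n) 0 X).toLinearMap
  map_add' X Y := by rw [map_add]; rfl
  map_smul' a X := by rw [map_smul]; rfl
  map_lie' {X Y} := LinearMap.ext fun p => loopLift_matDer_lie κ X Y p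

/-- The action of the enveloping algebra of the negative part on polynomial functions. -/
def negEnvAct : UniversalEnvelopingAlgebra ℂ (negPart κ) →ₐ[ℂ]
    Module.End ℂ (MvPolynomial (Fin n × Fin n × ℤ) ℂ) :=
  UniversalEnvelopingAlgebra.lift ℂ ((loopDer κ).comp (negPart κ).incl)

theorem negEnvAct_act (x : Matrix (Fin n) (Fin n) ℂ) {m : ℤ} (hm : m < 0) (v : UnivAffine κ)
    (p : MvPolynomial (Fin n × Fin n × ℤ) ℂ) :
    negEnvAct κ (toNegEnv κ (UnivAffine.act κ (loopElt κ x m) v)) p =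
      matDer n m x (negEnvAct κ (toNegEnv κ v) p) := by
  rw [toNegEnv_act κ x hm, map_mul, Module.End.mul_apply]
  have h : negEnvAct κ (UniversalEnvelopingAlgebra.ι ℂ (negElt κ x m hm)) =
      loopDer κ (loopElt κ x m) := by
    rw [negEnvAct, UniversalEnvelopingAlgebra.lift_ι_apply]
    rfl
  rw [h]
  change loopLift κ (matDer n) 0 (loopElt κ x m) _ = _
  rw [loopLift_loopElt]

/-- The trace of the constant coefficient. -/
def constTrace (n : ℕ) : MvPolynomial (Fin n × Fin n × ℤ) ℂ := ∑ i, MvPolynomial.X (i, i, 0)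

/-- Acting on the trace of the constant coefficient recovers each letter as its own coordinate. That
makes this polynomial a good test vector for separating words. -/
theorem matDer_constTrace (m : ℤ) (i j : Fin n) :
    matDer n m (Matrix.single i j 1) (constTrace n) = MvPolynomial.X (i, j, m) := by
  rw [constTrace, map_sum]
  simp only [matDer_X, Matrix.single_apply, ite_smul, one_smul, zero_smul, zero_add, ite_and]
  simp

end LoopDerivations

/-! ### Symbols of words in the affine vertex algebra. -/

section AffineSymbol

variable {n : ℕ} (α : ℂ) {R : Type*} [CommRing R] [Algebra ℂ R] (ξ : Fin n × Fin n → ℕ → R)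

/-- Evaluation of the negative coordinates at `ξ` and of the other coordinates at `0`. -/
def negEval : MvPolynomial (Fin n × Fin n × ℤ) ℂ →ₐ[ℂ] R :=
  MvPolynomial.aeval fun c => if c.2.2 < 0 then ξ (c.1, c.2.1) (-c.2.2 - 1).toNat else 0

theorem negEval_constTrace : negEval ξ (constTrace n) = 0 := by
  simp [negEval, constTrace]

theorem negEval_X (i j : Fin n) (m : ℕ) :
    negEval ξ (MvPolynomial.X (i, j, -(m : ℤ) - 1)) = ξ (i, j) m := by
  rw [negEval, MvPolynomial.aeval_X]
  simp only
  rw [if_pos (by omega)]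
  congr 1
  omega

/-- The degree `d` symbol map on `V^κ(gl(n))`. -/
def affSymbol (d : ℕ) : AffGL n α →ₗ[ℂ] R :=
  ((d.factorial : ℂ)⁻¹) • ((negEval ξ).toLinearMap ∘ₗ LinearMap.applyₗ (constTrace n ^ d) ∘ₗ
    (negEnvAct (glForm n α)).toLinearMap ∘ₗ toNegEnv (glForm n α))

theorem affSymbol_apply (d : ℕ) (v : AffGL n α) : affSymbol α ξ d v =
    ((d.factorial : ℂ)⁻¹) • negEval ξ
      (negEnvAct (glForm n α) (toNegEnv (glForm n α) v) (constTrace n ^ d)) := rfl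

/-- The operators `e_{ij} t^m` as a family indexed by pairs. -/
def affOp (i : Fin n × Fin n) (m : ℤ) : Module.End ℂ (AffGL n α) := unitOp α i.1 i.2 m

/-- The monomial attached to a word. -/
def wordMonomial {J : Type*} (ξ : J → ℕ → R) (l : List (J × ℕ)) : R :=
  (l.map fun a => ξ a.1 a.2).prod

/-- By the Leibniz rule each letter either differentiates one remaining copy of the trace, producing
its coordinate, or differentiates the cofactor and leaves a surplus factor of the trace, which
evaluates to zero. The descending factorial counts the choices of copies. For words of length d this
gives d! times the monomial; for shorter words a power of the trace survives and evaluates to zero.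
-/
theorem exists_negEnvAct_word (d : ℕ) (l : List ((Fin n × Fin n) × ℕ)) (hl : l.length ≤ d) :
    ∃ p, negEnvAct (glForm n α) (toNegEnv (glForm n α) (word (affOp α) VertexStructure.vac l))
        (constTrace n ^ d) = constTrace n ^ (d - l.length) * p ∧
      negEval ξ p = (d.descFactorial l.length : R) * wordMonomial ξ l := by
  induction l with
  | nil =>
    refine ⟨1, ?_, ?_⟩
    · change negEnvAct _ (toNegEnv _ (UnivAffine.vacuum _)) _ = _
      rw [toNegEnv_vacuum, map_one]
      simp
    · simp [wordMonomial]
  | cons a l ih =>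
    rw [List.length_cons] at hl
    obtain ⟨p, hp, hp'⟩ := ih (by omega)
    obtain ⟨r, hr⟩ : ∃ r, d = l.length + 1 + r := ⟨d - (l.length + 1), by omega⟩
    -- The two summands are the two Leibniz terms, and r + 1 is the exponent of the trace still
    -- present before this letter acts.
    refine ⟨((r + 1 : ℕ) : MvPolynomial (Fin n × Fin n × ℤ) ℂ) *
      MvPolynomial.X (a.1.1, a.1.2, -(a.2 : ℤ) - 1) * p +
      constTrace n * matDer n (-(a.2 : ℤ) - 1) (Matrix.single a.1.1 a.1.2 1) p, ?_, ?_⟩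
    · refine (negEnvAct_act (glForm n α) _ (by omega) _ _).trans ?_
      rw [hp, Derivation.leibniz, Derivation.leibniz_pow, matDer_constTrace, List.length_cons,
        show d - l.length = r + 1 by omega, show d - (l.length + 1) = r by omega]
      simp only [smul_eq_mul, nsmul_eq_mul, Nat.add_sub_cancel]
      ring
    · rw [map_add, map_mul, map_mul, map_mul, negEval_constTrace, zero_mul, add_zero, negEval_X,
        hp', List.length_cons, Nat.descFactorial_succ, show d - l.length = r + 1 by omega,
        map_natCast]
      simp only [wordMonomial, List.map_cons, List.prod_cons]
      push_cast
      ring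

theorem affSymbol_word (d : ℕ) (l : List ((Fin n × Fin n) × ℕ)) (hl : l.length ≤ d) :
    affSymbol α ξ d (word (affOp α) VertexStructure.vac l) =
      if l.length = d then wordMonomial ξ l else 0 := by
  obtain ⟨p, hp, hp'⟩ := exists_negEnvAct_word α ξ d l hl
  rw [affSymbol_apply, hp, map_mul, map_pow, negEval_constTrace]
  split_ifs with h
  · rw [h, Nat.sub_self, pow_zero, one_mul, hp', h, Nat.descFactorial_self, ← nsmul_eq_mul,
      ← Nat.cast_smul_eq_nsmul ℂ, smul_smul, inv_mul_cancel₀ (by exact_mod_cast d.factorial_ne_zero),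
      one_smul]
  · rw [zero_pow (by omega), zero_mul, smul_zero]

end AffineSymbol

end

section

attribute [local instance] LieRing.ofAssociativeRing

/-! ### Currents of both tensor factors as a word system. -/

section PairOperators

variable {n : ℕ} (α : ℂ)

/-- When all letters have degree 1, a commutator involves at most one letter. Pushing an
annihilation mode to the vacuum then never lengthens a word, which improves on the general bound by
one. -/
theorem IsWordSystem.nonneg_apply_mem {E I : Type*} [AddCommGroup E] [Module ℂ E]
    {X : I → ℤ → Module.End ℂ E} {Ω : E} (h : IsWordSystem X Ω fun _ => 1) {D : ℕ} (i : I) {m : ℤ}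
    (hm : 0 ≤ m) {w : E} (hw : w ∈ wordSpan X Ω (fun _ => 1) D) :
    X i m w ∈ wordSpan X Ω (fun _ => 1) D := by
  have key : ∀ l : List (I × ℕ),
      X i m (word X Ω l) ∈ wordSpan X Ω (fun _ => 1) (wordDeg (fun _ => 1) l + 1) := by
    intro l
    induction l with
    | nil => rw [word, h.vac i m hm]; exact zero_mem _
    | cons k l ih =>
      have hd : wordDeg (fun _ : I => 1) (k :: l) = wordDeg (fun _ => 1) l + 1 := by
        simp [wordDeg, add_comm]
      rw [word, hd, ← sub_add_cancel (X i m _) (X k.1 (-(k.2 : ℤ) - 1) (X i m (word X Ω l)))]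
      refine add_mem ?_ (neg_apply_mem_wordSpan k.1 k.2 ih)
      exact wordSpan_mono (by omega) (h.quadSpan_le (word_mem_wordSpan (Nat.lt_succ_self _))
        (h.comm i k.1 m (-(k.2 : ℤ) - 1) (word X Ω l)))
  induction hw using Submodule.span_induction with
  | zero => rw [map_zero]; exact zero_mem _
  | add u v _ _ hu hv => rw [map_add]; exact add_mem hu hv
  | smul a u _ hu => rw [map_smul]; exact Submodule.smul_mem _ _ hu
  | mem u hu =>
    obtain ⟨l, hl, rfl⟩ := hu
    exact wordSpan_mono hl (key l)

theorem finite_opL_opR (i j p q : Fin n) (s : ℤ) (v : AffGL2 n α) :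
    (fun k : ℤ => opL α i j k (opR α p q (s - 1 - k) v)).HasFiniteSupport := by
  refine Set.Finite.subset (tensor_finite (UnivAffine.current (glForm n α) (Matrix.single i j 1))
    (UnivAffine.current (glForm n α) (Matrix.single p q 1)) s v) fun k hk => ?_
  rw [Function.mem_support] at hk ⊢
  rw [opL, opR, ← LinearMap.comp_apply, ← TensorProduct.map_comp, LinearMap.comp_id,
    LinearMap.id_comp] at hk
  rwa [UnivAffine.current_ncoeff, UnivAffine.current_ncoeff]

/-- The operators `e_{ij} t^m ⊗ 1` and `1 ⊗ e_{ij} t^m` as one family. -/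
def pairOp (i : Bool × Fin n × Fin n) (m : ℤ) : Module.End ℂ (AffGL2 n α) :=
  if i.1 then opR α i.2.1 i.2.2 m else opL α i.2.1 i.2.2 m

theorem opL_comm (i j p q : Fin n) (m r : ℤ) (v : AffGL2 n α) :
    opL α i j m (opL α p q r v) - opL α p q r (opL α i j m v) =
      (delta j p • opL α i q (m + r) v - delta q i • opL α p j (m + r) v) +
      (if m + r = 0 then (m : ℂ) * (delta j p * delta i q * α + delta i j * delta p q) else 0) •
        v := by
  induction v using TensorProduct.induction_on with
  | zero => simp
  | add x y hx hy =>
    simp only [map_add, smul_add]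
    rw [add_sub_add_comm, hx, hy]
    abel
  | tmul x y =>
    simp only [opL_tmul]
    rw [unitOp_comm, add_assoc, TensorProduct.add_tmul, add_sub_cancel_left, TensorProduct.add_tmul,
      TensorProduct.sub_tmul]
    simp only [← TensorProduct.smul_tmul']

theorem opR_comm (i j p q : Fin n) (m r : ℤ) (v : AffGL2 n α) :
    opR α i j m (opR α p q r v) - opR α p q r (opR α i j m v) =
      (delta j p • opR α i q (m + r) v - delta q i • opR α p j (m + r) v) +
      (if m + r = 0 then (m : ℂ) * (delta j p * delta i q * α + delta i j * delta p q) else 0) •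
        v := by
  induction v using TensorProduct.induction_on with
  | zero => simp
  | add x y hx hy =>
    simp only [map_add, smul_add]
    rw [add_sub_add_comm, hx, hy]
    abel
  | tmul x y =>
    simp only [opR_tmul]
    rw [unitOp_comm, add_assoc, TensorProduct.tmul_add, add_sub_cancel_left, TensorProduct.tmul_add,
      TensorProduct.tmul_sub]
    simp only [TensorProduct.tmul_smul]

theorem isWordSystem_pairOp :
    IsWordSystem (pairOp (n := n) α) VertexStructure.vac fun _ => 1 where
  deg_pos _ := one_pos
  vac i m hm := by
    obtain ⟨_ | _, i, j⟩ := i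
    · change opL α i j m _ = 0
      rw [opL_vac, unitVec_of_nonneg α i j hm, TensorProduct.zero_tmul]
    · change opR α i j m _ = 0
      rw [opR_vac, unitVec_of_nonneg α i j hm, TensorProduct.tmul_zero]
  comm := by
    rintro ⟨_ | _, i, j⟩ ⟨_ | _, p, q⟩ m r w
    · refine (opL_comm α i j p q m r w).symm ▸ ?_
      exact add_mem (sub_mem
        (Submodule.smul_mem _ _ (apply_mem_quadSpan (X := pairOp α) w (a := (false, i, q)) _ le_rfl))
        (Submodule.smul_mem _ _ (apply_mem_quadSpan (X := pairOp α) w (a := (false, p, j)) _ le_rfl)))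
        (Submodule.smul_mem _ _ (self_mem_quadSpan _ _))
    · have h : pairOp α (false, i, j) m (pairOp α (true, p, q) r w) =
        pairOp α (true, p, q) r (pairOp α (false, i, j) m w) := opL_opR α _ _ _ _ _ _ _
      rw [h, sub_self]
      exact zero_mem _
    · have h : pairOp α (true, i, j) m (pairOp α (false, p, q) r w) =
        pairOp α (false, p, q) r (pairOp α (true, i, j) m w) := (opL_opR α _ _ _ _ _ _ _).symm
      rw [h, sub_self]
      exact zero_mem _
    · refine (opR_comm α i j p q m r w).symm ▸ ?_
      exact add_mem (sub_mem
        (Submodule.smul_mem _ _ (apply_mem_quadSpan (X := pairOp α) w (a := (true, i, q)) _ le_rfl))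
        (Submodule.smul_mem _ _ (apply_mem_quadSpan (X := pairOp α) w (a := (true, p, j)) _ le_rfl)))
        (Submodule.smul_mem _ _ (self_mem_quadSpan _ _))

/-- The span of the words of length less than `D` in the currents of both factors. -/
abbrev pairFil (n : ℕ) (D : ℕ) : Submodule ℂ (AffGL2 n α) :=
  wordSpan (pairOp α) VertexStructure.vac (fun _ => 1) D

end PairOperators

/-! ### Symbols on the tensor square and symbols of the generators. -/

section PairSymbol

variable {n : ℕ} (α : ℂ) {R : Type*} [CommRing R] [Algebra ℂ R] (ξ : Bool → Fin n × Fin n → ℕ → R)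

/-- The degree `d` symbol map on `V^κ(gl(n))^{⊗ 2}`. -/
def pairSymbol (d : ℕ) : AffGL2 n α →ₗ[ℂ] R :=
  ∑ x ∈ Finset.HasAntidiagonal.antidiagonal d, LinearMap.mul' ℂ R ∘ₗ
    TensorProduct.map (affSymbol α (ξ false) x.1) (affSymbol α (ξ true) x.2)

theorem pairSymbol_tmul (d : ℕ) (x y : AffGL n α) : pairSymbol α ξ d (x ⊗ₜ y) =
    ∑ c ∈ Finset.HasAntidiagonal.antidiagonal d,
      affSymbol α (ξ false) c.1 x * affSymbol α (ξ true) c.2 y := by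
  simp [pairSymbol]

/-- Currents of different factors act on separate tensor slots, so a mixed word splits into one word
for each factor. -/
theorem word_pairOp (l : List ((Bool × Fin n × Fin n) × ℕ)) : ∃ l₁ l₂,
    word (pairOp α) VertexStructure.vac l = word (affOp α) VertexStructure.vac l₁ ⊗ₜ
      word (affOp α) VertexStructure.vac l₂ ∧ l₁.length + l₂.length = l.length ∧
    wordMonomial (fun i => ξ i.1 i.2) l =
      wordMonomial (ξ false) l₁ * wordMonomial (ξ true) l₂ := by
  induction l with
  | nil => exact ⟨[], [], rfl, rfl, by simp [wordMonomial]⟩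
  | cons a l ih =>
    obtain ⟨l₁, l₂, h₁, h₂, h₃⟩ := ih
    obtain ⟨⟨_ | _, i⟩, m⟩ := a
    · refine ⟨(i, m) :: l₁, l₂, ?_, by simp only [List.length_cons]; omega, ?_⟩
      · rw [word, h₁]; rfl
      · simp only [wordMonomial, List.map_cons, List.prod_cons, mul_assoc] at h₃ ⊢
        rw [h₃]
    · refine ⟨l₁, (i, m) :: l₂, ?_, by simp only [List.length_cons]; omega, ?_⟩
      · rw [word, h₁]; rfl
      · simp only [wordMonomial, List.map_cons, List.prod_cons] at h₃ ⊢
        rw [h₃]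
        ring

theorem pairSymbol_word (d : ℕ) (l : List ((Bool × Fin n × Fin n) × ℕ)) (hl : l.length ≤ d) :
    pairSymbol α ξ d (word (pairOp α) VertexStructure.vac l) =
      if l.length = d then wordMonomial (fun i => ξ i.1 i.2) l else 0 := by
  obtain ⟨l₁, l₂, h₁, h₂, h₃⟩ := word_pairOp α ξ l
  rw [h₁, pairSymbol_tmul, h₃]
  have key : ∀ c ∈ Finset.HasAntidiagonal.antidiagonal d, (l₁.length, l₂.length) ≠ c →
      affSymbol α (ξ false) c.1 (word (affOp α) VertexStructure.vac l₁) *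
        affSymbol α (ξ true) c.2 (word (affOp α) VertexStructure.vac l₂) = 0 := by
    intro c hc hne
    rw [Finset.HasAntidiagonal.mem_antidiagonal] at hc
    by_cases h : l₁.length < c.1
    · rw [affSymbol_word α _ _ _ h.le, if_neg h.ne, zero_mul]
    · have h' : l₂.length < c.2 := by
        by_contra h'
        exact hne (Prod.ext (by simp only; omega) (by simp only; omega))
      rw [affSymbol_word α _ _ _ h'.le, if_neg h'.ne, mul_zero]
  split_ifs with h
  · rw [Finset.sum_eq_single_of_mem (l₁.length, l₂.length)
      (Finset.HasAntidiagonal.mem_antidiagonal.2 (by simp only; omega)) fun c hc hne =>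
        key c hc hne.symm, affSymbol_word α _ _ _ le_rfl, affSymbol_word α _ _ _ le_rfl, if_pos rfl,
      if_pos rfl]
  · refine Finset.sum_eq_zero fun c hc => key c hc ?_
    rintro rfl
    exact h (h₂.symm.trans (Finset.HasAntidiagonal.mem_antidiagonal.1 hc))

theorem wordDeg_one {J : Type*} (l : List (J × ℕ)) : wordDeg (fun _ => 1) l = l.length := by
  simp [wordDeg]

theorem pairSymbol_eq_zero {d : ℕ} {v : AffGL2 n α} (hv : v ∈ pairFil α n d) :
    pairSymbol α ξ d v = 0 := by
  induction hv using Submodule.span_induction with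
  | zero => rw [map_zero]
  | add u v _ _ hu hv => rw [map_add, hu, hv, add_zero]
  | smul a u _ hu => rw [map_smul, hu, smul_zero]
  | mem u hu =>
    obtain ⟨l, hl, rfl⟩ := hu
    rw [wordDeg_one] at hl
    rw [pairSymbol_word α ξ d l hl.le, if_neg hl.ne]

theorem pairSymbol_neg_apply {d : ℕ} {v : AffGL2 n α} (hv : v ∈ pairFil α n (d + 1))
    (i : Bool × Fin n × Fin n) (m : ℕ) :
    pairSymbol α ξ (d + 1) (pairOp α i (-(m : ℤ) - 1) v) = ξ i.1 i.2 m * pairSymbol α ξ d v := by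
  induction hv using Submodule.span_induction with
  | zero => simp only [map_zero, mul_zero]
  | add u v _ _ hu hv => rw [map_add, map_add, map_add, hu, hv, mul_add]
  | smul a u _ hu => rw [map_smul, map_smul, map_smul, hu, mul_smul_comm]
  | mem u hu =>
    obtain ⟨l, hl, rfl⟩ := hu
    rw [wordDeg_one] at hl
    change pairSymbol α ξ (d + 1) (word (pairOp α) VertexStructure.vac ((i, m) :: l)) = _
    rw [pairSymbol_word α ξ _ _ (by simpa using Nat.lt_succ_iff.1 hl),
      pairSymbol_word α ξ _ _ (Nat.lt_succ_iff.1 hl)]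
    simp only [List.length_cons, add_left_inj]
    split_ifs
    · simp [wordMonomial]
    · rw [mul_zero]

/-- The symbols of the generators of the rectangular `W`-algebra. -/
def rectSymbol (x : Bool × Fin n × Fin n) (m : ℕ) : R :=
  if x.1 then ∑ a ∈ Finset.range (m + 1), ∑ u, ξ false (u, x.2.2) a * ξ true (x.2.1, u) (m - a)
  else ξ false x.2 m + ξ true x.2 m

theorem W1_mem_and_pairSymbol {d : ℕ} {v : AffGL2 n α} (hv : v ∈ pairFil α n (d + 1)) (i j : Fin n)
    (m : ℕ) : nthProd (W1 α i j) (-(m : ℤ) - 1) v ∈ pairFil α n (d + 1 + 1) ∧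
    pairSymbol α ξ (d + 1) (nthProd (W1 α i j) (-(m : ℤ) - 1) v) =
      (ξ false (i, j) m + ξ true (i, j) m) * pairSymbol α ξ d v := by
  have e : nthProd (W1 α i j) (-(m : ℤ) - 1) v = pairOp α (false, i, j) (-(m : ℤ) - 1) v +
    pairOp α (true, i, j) (-(m : ℤ) - 1) v := nthProd_W1 _ _ _ _ _
  rw [e]
  refine ⟨add_mem (neg_apply_mem_wordSpan _ _ hv) (neg_apply_mem_wordSpan _ _ hv), ?_⟩
  rw [map_add, pairSymbol_neg_apply α ξ hv, pairSymbol_neg_apply α ξ hv, add_mul]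

/-- The symbol in degree d + 2 sees only the terms in which both currents are creation modes, namely
-a - 1 and -(m - a) - 1 with 0 ≤ a ≤ m. If either mode is nonnegative the length grows by at most
one, and the same holds for the derivative term. -/
theorem W2_mem_and_pairSymbol {d : ℕ} {v : AffGL2 n α} (hv : v ∈ pairFil α n (d + 1)) (i j : Fin n)
    (m : ℕ) : nthProd (W2 α i j) (-(m : ℤ) - 1) v ∈ pairFil α n (d + 2 + 1) ∧
    pairSymbol α ξ (d + 2) (nthProd (W2 α i j) (-(m : ℤ) - 1) v) =
      (∑ a ∈ Finset.range (m + 1), ∑ u, ξ false (u, j) a * ξ true (i, u) (m - a)) *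
        pairSymbol α ξ d v := by
  have hX := isWordSystem_pairOp (n := n) α
  set s : ℤ := -(m : ℤ) - 1 with hs
  have e : nthProd (W2 α i j) s v =
      ∑ u, ∑ᶠ k : ℤ, pairOp α (false, u, j) k (pairOp α (true, i, u) (s - 1 - k) v) -
        α • ((-(s : ℂ)) • pairOp α (false, i, j) (s - 1) v) := by
    have h : nthProd (W2 α i j) s v =
        ∑ u, nthProd (unitVec α u j (-1) ⊗ₜ[ℂ] unitVec α i u (-1)) s v -
          α • nthProd (unitVec α i j (-2) ⊗ₜ[ℂ] (VertexStructure.vac : AffGL n α)) s v := by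
      simp [nthProd, W2]
    rw [h, nthProd_unitVec_neg_two_tmul_vac]
    simp only [nthProd_unitVec_tmul_unitVec]
    rfl
  have hfin (u : Fin n) : (fun k : ℤ =>
      pairOp α (false, u, j) k (pairOp α (true, i, u) (s - 1 - k) v)).HasFiniteSupport :=
    finite_opL_opR α u j i u s v
  have hterm (u : Fin n) (k : ℤ) : pairOp α (false, u, j) k (pairOp α (true, i, u) (s - 1 - k) v) ∈
      pairFil α n (d + 2 + 1) := hX.apply_mem _ _ _ rfl _ _ (hX.apply_mem _ _ _ rfl _ _ hv)
  have hlast : pairOp α (false, i, j) (s - 1) v ∈ pairFil α n (d + 2) :=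
    hX.apply_mem _ _ _ rfl _ _ hv
  have hsmall (u : Fin n) (k : ℤ) (hk : 0 ≤ k ∨ 0 ≤ s - 1 - k) :
      pairOp α (false, u, j) k (pairOp α (true, i, u) (s - 1 - k) v) ∈ pairFil α n (d + 2) := by
    rcases hk with hk | hk
    · exact hX.nonneg_apply_mem _ hk (hX.apply_mem _ _ _ rfl _ _ hv)
    · exact hX.apply_mem _ _ _ rfl _ _ (hX.nonneg_apply_mem _ hk hv)
  rw [e]
  refine ⟨sub_mem (sum_mem fun u _ => ?_) (Submodule.smul_mem _ _ (Submodule.smul_mem _ _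
    (wordSpan_mono (Nat.le_succ _) hlast))), ?_⟩
  · exact finsum_induction _ (zero_mem _) (fun _ _ => add_mem) (hterm u)
  · rw [map_sub, map_smul, map_smul, pairSymbol_eq_zero α ξ hlast, smul_zero, smul_zero, sub_zero,
      map_sum, Finset.sum_comm, Finset.sum_mul]
    refine Finset.sum_congr rfl fun u _ => ?_
    rw [map_finsum _ (hfin u), finsum_eq_sum_of_support_subset
      (s := (Finset.range (m + 1)).image fun a : ℕ => -(a : ℤ) - 1), Finset.sum_image,
      Finset.sum_mul]
    · refine Finset.sum_congr rfl fun a ha => ?_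
      rw [Finset.mem_range] at ha
      rw [show s - 1 - (-(a : ℤ) - 1) = -((m - a : ℕ) : ℤ) - 1 by omega,
        pairSymbol_neg_apply α ξ (neg_apply_mem_wordSpan _ _ hv), pairSymbol_neg_apply α ξ hv,
        mul_assoc]
    · intro a _ b _ hab
      simpa using hab
    · intro k hk
      rw [Function.mem_support] at hk
      have h1 : k < 0 := by
        by_contra hc
        exact hk (pairSymbol_eq_zero α ξ (hsmall u k (Or.inl (by omega))))
      have h2 : s - 1 - k < 0 := by
        by_contra hc
        exact hk (pairSymbol_eq_zero α ξ (hsmall u k (Or.inr (by omega))))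
      simp only [Finset.coe_image, Finset.coe_range, Set.mem_image, Set.mem_Iio]
      exact ⟨(-k - 1).toNat, by omega, by omega⟩

/-- The symbol of a word in the modes of the generators of the rectangular `W`-algebra. -/
theorem word_mem_and_pairSymbol (l : List ((Bool × Fin n × Fin n) × ℕ)) :
    word (modes (joinFam (W1 α) (W2 α))) VertexStructure.vac l ∈
      pairFil α n (wordDeg joinDeg l + 1) ∧
    pairSymbol α ξ (wordDeg joinDeg l)
      (word (modes (joinFam (W1 α) (W2 α))) VertexStructure.vac l) =
        wordMonomial (rectSymbol ξ) l := by
  induction l with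
  | nil =>
    refine ⟨Submodule.subset_span ⟨[], by simp [wordDeg], rfl⟩, ?_⟩
    refine (pairSymbol_word α ξ 0 [] le_rfl).trans ?_
    simp [wordMonomial]
  | cons a l ih =>
    obtain ⟨⟨_ | _, i, j⟩, m⟩ := a
    · obtain ⟨h1, h2⟩ := W1_mem_and_pairSymbol α ξ ih.1 i j m
      have hd : wordDeg joinDeg (((false, i, j), m) :: l) = wordDeg joinDeg l + 1 := by
        simp [wordDeg, joinDeg, add_comm]
      rw [hd]
      refine ⟨h1, h2.trans ?_⟩
      rw [ih.2]
      rfl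
    · obtain ⟨h1, h2⟩ := W2_mem_and_pairSymbol α ξ ih.1 i j m
      have hd : wordDeg joinDeg (((true, i, j), m) :: l) = wordDeg joinDeg l + 2 := by
        simp [wordDeg, joinDeg, add_comm]
      rw [hd]
      refine ⟨h1, h2.trans ?_⟩
      rw [ih.2]
      rfl

end PairSymbol

end

/-! ### Algebraic independence from lowest-order terms. -/

section AlgebraicIndependence

variable {σ S : Type*} [CommRing S] [Algebra ℂ S]

/-- Substitution gives every variable one factor of the polynomial variable, so a monomial of degree
d starts in order d. In order k only the component of degree k survives, evaluated at the constant
terms of `g`. -/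
theorem coeff_aeval_X_mul (g : σ → Polynomial S) (P : MvPolynomial σ ℂ) (k : ℕ)
    (hk : ∀ d ∈ P.support, k ≤ d.degree) :
    (MvPolynomial.aeval (fun x => Polynomial.X * g x) P).coeff k =
      MvPolynomial.aeval (fun x => (g x).coeff 0) (MvPolynomial.homogeneousComponent k P) := by
  have hprod : ∀ d : σ →₀ ℕ, ((∏ i ∈ d.support, (Polynomial.X * g i) ^ d i : Polynomial S)) =
      Polynomial.X ^ d.degree * ∏ i ∈ d.support, g i ^ d i := by
    intro d
    simp only [mul_pow, Finset.prod_mul_distrib, Finset.prod_pow_eq_pow_sum, Finsupp.degree_apply]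
  have hzero : ∀ d : σ →₀ ℕ, (∏ i ∈ d.support, g i ^ d i).coeff 0 =
      ∏ i ∈ d.support, (g i).coeff 0 ^ d i := by
    intro d
    simp only [Polynomial.coeff_zero_eq_eval_zero, Polynomial.eval_prod, Polynomial.eval_pow]
  rw [MvPolynomial.homogeneousComponent_apply, map_sum, MvPolynomial.aeval_def,
    MvPolynomial.eval₂_eq, Polynomial.finsetSum_coeff, Finset.sum_filter]
  refine Finset.sum_congr rfl fun d hd => ?_
  rw [hprod, ← Algebra.smul_def, Polynomial.coeff_smul, Polynomial.coeff_X_pow_mul',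
    MvPolynomial.aeval_monomial, ← Algebra.smul_def]
  have := hk d hd
  by_cases h : d.degree = k
  · rw [if_pos h.le, if_pos h, h, Nat.sub_self, hzero]
    rfl
  · rw [if_neg (by omega), if_neg h, smul_zero]

/-- A nonzero relation has a nonzero component of lowest degree, and the lowest coefficient after
substitution would make that component a relation between the constant terms of `g`. -/
theorem injective_aeval_of_lowest_term {g : σ → Polynomial S}
    (hl : Function.Injective (MvPolynomial.aeval (R := ℂ) fun x => (g x).coeff 0)) :
    Function.Injective (MvPolynomial.aeval (R := ℂ) fun x => Polynomial.X * g x) := by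
  rw [injective_iff_map_eq_zero]
  intro P hP
  by_contra hne
  obtain ⟨d, hd, hmin⟩ := P.support.exists_min_image Finsupp.degree
    (MvPolynomial.support_nonempty.2 hne)
  have h := coeff_aeval_X_mul g P d.degree hmin
  rw [hP, Polynomial.coeff_zero] at h
  have h' := (injective_iff_map_eq_zero _).1 hl _ h.symm
  have h'' := congrArg (MvPolynomial.coeff d) h'
  rw [MvPolynomial.coeff_homogeneousComponent, if_pos rfl, MvPolynomial.coeff_zero] at h''
  exact MvPolynomial.mem_support_iff.1 hd h''

theorem injective_aeval_add_const {z : σ → S} (hz : Function.Injective (MvPolynomial.aeval (R := ℂ) z))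
    (c : σ → ℂ) : Function.Injective (MvPolynomial.aeval (R := ℂ) fun x => algebraMap ℂ S (c x) + z x) := by
  have h₁ : MvPolynomial.aeval (fun x => algebraMap ℂ S (c x) + z x) =
      (MvPolynomial.aeval (R := ℂ) z).comp
        (MvPolynomial.aeval fun x => MvPolynomial.C (c x) + MvPolynomial.X x) := by
    apply MvPolynomial.algHom_ext
    intro x
    simp
  have h₂ : Function.LeftInverse
      (MvPolynomial.aeval (R := ℂ) fun x => MvPolynomial.X x - MvPolynomial.C (σ := σ) (c x))
      (MvPolynomial.aeval (R := ℂ) fun x => MvPolynomial.C (c x) + MvPolynomial.X x) := by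
    intro P
    rw [← AlgHom.comp_apply]
    conv_rhs => rw [← AlgHom.id_apply (R := ℂ) P]
    congr 1
    apply MvPolynomial.algHom_ext
    intro x
    simp
  rw [h₁]
  exact hz.comp h₂.injective

theorem linearIndependent_monomials {z : σ → S}
    (hz : Function.Injective (MvPolynomial.aeval (R := ℂ) z)) :
    LinearIndependent ℂ fun s : Multiset σ => (s.map z).prod := by
  classical
  have h₁ : ∀ s : Multiset σ, (s.map (MvPolynomial.X (R := ℂ))).prod =
      MvPolynomial.basisMonomials σ ℂ (Multiset.toFinsupp s) := by
    intro s
    induction s using Multiset.induction_on with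
    | empty => simp
    | cons a s ih =>
      rw [Multiset.map_cons, Multiset.prod_cons, ih, ← Multiset.singleton_add, map_add,
        Multiset.toFinsupp_singleton, MvPolynomial.coe_basisMonomials, MvPolynomial.X,
        MvPolynomial.monomial_mul, mul_one]
  have h₂ := (MvPolynomial.basisMonomials σ ℂ).linearIndependent.comp _
    (Multiset.toFinsupp (α := σ)).injective
  rw [linearIndependent_iff'] at h₂ ⊢
  intro t c hc
  refine h₂ t c (hz ?_)
  rw [map_sum, map_zero, ← hc]
  refine Finset.sum_congr rfl fun s _ => ?_
  rw [map_smul, Function.comp_apply, ← h₁, map_multiset_prod, Multiset.map_map]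
  simp

end AlgebraicIndependence

section

attribute [local instance] LieRing.ofAssociativeRing

/-! ### Linear independence of words in the generators. -/

section WordIndependence

variable {n : ℕ}

/-- The symbols of the currents used to separate words. -/
def testSymbol (n : ℕ) (b : Bool) (i : Fin n × Fin n) (m : ℕ) :
    Polynomial (MvPolynomial ((Bool × Fin n × Fin n) × ℕ) ℂ) :=
  algebraMap ℂ _ (if b = true ∧ i.1 = i.2 ∧ m = 0 then 1 else 0) +
    Polynomial.X * Polynomial.C (MvPolynomial.X ((b, i), m))

theorem injective_aeval_linearSymbol : Function.Injective (MvPolynomial.aeval (R := ℂ)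
    fun x : (Bool × Fin n × Fin n) × ℕ =>
      if x.1.1 then (MvPolynomial.X ((false, x.1.2), x.2) : MvPolynomial _ ℂ)
      else MvPolynomial.X ((false, x.1.2), x.2) + MvPolynomial.X ((true, x.1.2), x.2)) := by
  have h : Function.LeftInverse (MvPolynomial.aeval (R := ℂ)
    fun x : (Bool × Fin n × Fin n) × ℕ =>
      if x.1.1 then (MvPolynomial.X ((false, x.1.2), x.2) : MvPolynomial _ ℂ) -
        MvPolynomial.X ((true, x.1.2), x.2) else MvPolynomial.X ((true, x.1.2), x.2))
    (MvPolynomial.aeval (R := ℂ) fun x : (Bool × Fin n × Fin n) × ℕ =>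
      if x.1.1 then (MvPolynomial.X ((false, x.1.2), x.2) : MvPolynomial _ ℂ)
      else MvPolynomial.X ((false, x.1.2), x.2) + MvPolynomial.X ((true, x.1.2), x.2)) := by
    intro P
    rw [← AlgHom.comp_apply]
    conv_rhs => rw [← AlgHom.id_apply (R := ℂ) P]
    congr 1
    apply MvPolynomial.algHom_ext
    rintro ⟨⟨_ | _, i⟩, m⟩ <;> simp
  exact h.injective

/-- The test symbols expand two power series matrices A and B around A = 0, B = 1 along a formal
line. To first order A + B varies by dA + dB and BA varies by dA, an invertible linear change of
coordinates. Constants are removed by a translation of the variables, and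
`injective_aeval_of_lowest_term` reduces the claim to this linear part. -/
theorem injective_aeval_rectSymbol : Function.Injective (MvPolynomial.aeval (R := ℂ)
    fun x : (Bool × Fin n × Fin n) × ℕ => rectSymbol (testSymbol n) x.1 x.2) := by
  let q : (Bool × Fin n × Fin n) × ℕ → Polynomial (MvPolynomial ((Bool × Fin n × Fin n) × ℕ) ℂ) :=
    fun x => if x.1.1 then ∑ a ∈ Finset.range (x.2 + 1), ∑ u,
      Polynomial.C (MvPolynomial.X ((false, u, x.1.2.2), a)) *
        Polynomial.C (MvPolynomial.X ((true, x.1.2.1, u), x.2 - a)) else 0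
  let l : (Bool × Fin n × Fin n) × ℕ → MvPolynomial ((Bool × Fin n × Fin n) × ℕ) ℂ := fun x =>
      if x.1.1 then (MvPolynomial.X ((false, x.1.2), x.2) : MvPolynomial _ ℂ)
      else MvPolynomial.X ((false, x.1.2), x.2) + MvPolynomial.X ((true, x.1.2), x.2)
  let c : (Bool × Fin n × Fin n) × ℕ → ℂ := fun x =>
    if x.1.1 = false ∧ x.1.2.1 = x.1.2.2 ∧ x.2 = 0 then 1 else 0
  have h : (fun x : (Bool × Fin n × Fin n) × ℕ => rectSymbol (testSymbol n) x.1 x.2) =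
      fun x => algebraMap ℂ _ (c x) +
        Polynomial.X * (Polynomial.C (l x) + Polynomial.X * q x) := by
    funext x
    obtain ⟨⟨_ | _, i, j⟩, m⟩ := x
    · simp [rectSymbol, testSymbol, c, l, q]
      ring
    -- The constant part of B is the identity in order zero, so it contributes only for u = i and a
    -- = m, leaving one linear coordinate of A. All other contributions are of second order.
    · have h1 : ∀ a ∈ Finset.range (m + 1), ∀ u : Fin n,
          testSymbol n false (u, j) a * testSymbol n true (i, u) (m - a) =
          (if a = m then if u = i then
            Polynomial.X * Polynomial.C (MvPolynomial.X ((false, i, j), m)) else 0 else 0) +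
          Polynomial.X * (Polynomial.X * (Polynomial.C (MvPolynomial.X ((false, u, j), a)) *
            Polynomial.C (MvPolynomial.X ((true, i, u), m - a)))) := by
        intro a ha u
        rw [Finset.mem_range] at ha
        have hm : m - a = 0 ↔ a = m := by omega
        simp only [testSymbol, Bool.false_eq_true, false_and, if_false, map_zero, zero_add,
          true_and, hm]
        by_cases h1 : a = m
        · by_cases h2 : u = i
          · subst h1 h2
            simp
            ring
          · simp [h2, Ne.symm h2]
            ring
        · simp [h1]
          ring
      change ∑ a ∈ Finset.range (m + 1), ∑ u, _ = _
      rw [Finset.sum_congr rfl fun a ha => Finset.sum_congr rfl fun u _ => h1 a ha u]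
      simp only [Finset.sum_add_distrib, ← Finset.mul_sum]
      simp [c, l, q, mul_add]
  rw [h]
  refine injective_aeval_add_const (injective_aeval_of_lowest_term ?_) c
  have e : (fun x => (Polynomial.C (l x) + Polynomial.X * q x).coeff 0) = l := by
    funext x
    simp
  rw [e]
  exact injective_aeval_linearSymbol

/-- Words in the modes of the generators that differ by more than reordering are linearly
independent. -/
theorem linearIndependent_words (α : ℂ) {ι : Type*}
    (L : ι → List ((Bool × Fin n × Fin n) × ℕ))
    (hL : Function.Injective fun s => (L s : Multiset ((Bool × Fin n × Fin n) × ℕ))) :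
    LinearIndependent ℂ fun s : ι =>
      word (modes (joinFam (W1 (n := n) α) (W2 α))) VertexStructure.vac (L s) := by
  have hli := (linearIndependent_monomials (injective_aeval_rectSymbol (n := n))).comp _ hL
  rw [linearIndependent_iff'] at hli ⊢
  intro t c hc
  by_contra hne
  push Not at hne
  obtain ⟨s₀, hs₀, hcs₀⟩ := hne
  -- Take a word of maximal degree D among those with nonzero coefficient and apply the symbol of
  -- degree D to the relation.
  obtain ⟨s₁, hs₁, hmax⟩ := (t.filter fun s => c s ≠ 0).exists_max_image
    (fun s => wordDeg joinDeg (L s)) ⟨s₀, Finset.mem_filter.2 ⟨hs₀, hcs₀⟩⟩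
  set D := wordDeg joinDeg (L s₁) with hD
  have h := congrArg (pairSymbol α (testSymbol n) D) hc
  rw [map_sum, map_zero] at h
  have h' : ∑ s ∈ t, (if wordDeg joinDeg (L s) = D then c s else 0) •
      ((L s : Multiset ((Bool × Fin n × Fin n) × ℕ)).map
        fun x => rectSymbol (testSymbol n) x.1 x.2).prod = 0 := by
    rw [← h]
    refine Finset.sum_congr rfl fun s hs => ?_
    rw [map_smul]
    split_ifs with hsD
    · rw [← hsD, (word_mem_and_pairSymbol α (testSymbol n) (L s)).2, wordMonomial]
      rw [Multiset.map_coe, Multiset.prod_coe]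
    -- By maximality, a word with nonzero coefficient and degree different from D has smaller degree
    -- and vanishes under the symbol.
    · by_cases hcs : c s = 0
      · rw [hcs, zero_smul, zero_smul]
      · have := hmax s (Finset.mem_filter.2 ⟨hs, hcs⟩)
        rw [pairSymbol_eq_zero α (testSymbol n) (wordSpan_mono (by omega)
          (word_mem_and_pairSymbol α (testSymbol n) (L s)).1), zero_smul, smul_zero]
  rw [Finset.mem_filter] at hs₁
  have := hli t _ h' s₁ hs₁.1
  rw [if_pos rfl] at this
  exact hs₁.2 this

end WordIndependence

end

/-! ### Direct products of vertex algebras. -/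

section Pairs

variable {V W : Type*} [AddCommGroup V] [Module ℂ V] [AddCommGroup W] [Module ℂ W]

/-- A linear map which intertwines two pairs of fields intertwines their products. -/
theorem map_fieldProd (f : V →ₗ[ℂ] W) {A B : VertexOperator ℂ V} {A' B' : VertexOperator ℂ W}
    (hA : ∀ m v, f ((A[[m]]) v) = (A'[[m]]) (f v)) (hB : ∀ m v, f ((B[[m]]) v) = (B'[[m]]) (f v))
    (n m : ℤ) (v : V) : f (((fieldProd A n B)[[m]]) v) = ((fieldProd A' n B')[[m]]) (f v) := by
  obtain ⟨N₁, h₁⟩ := ncoeff_eventually_zero A v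
  obtain ⟨N₂, h₂⟩ := ncoeff_eventually_zero B v
  have h₁' : ∀ j : ℕ, N₁ ≤ j → (A[[(j : ℤ)]]) v = 0 := fun j hj => h₁ _ (by omega)
  have h₂' : ∀ j : ℕ, N₂ + m.natAbs ≤ j → (B[[m + j]]) v = 0 := fun j hj => h₂ _ (by omega)
  simp only [fieldProd, map_sub, Pi.sub_apply, LinearMap.sub_apply]
  rw [leftProd_apply_range _ _ _ _ _ _ h₂', rightProd_apply_range _ _ _ _ _ _ h₁',
    leftProd_apply_range (N := N₂ + m.natAbs) (h := fun j hj => by rw [← hB, h₂' j hj, map_zero]),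
    rightProd_apply_range (N := N₁) (h := fun j hj => by rw [← hA, h₁' j hj, map_zero]),
    map_sum, map_sum]
  simp only [map_smul, hA, hB]

/-- The componentwise field on a product of two spaces. -/
def pairField (A : VertexOperator ℂ V) (B : VertexOperator ℂ W) : VertexOperator ℂ (V × W) :=
  mkField (fun m => (A[[m]]).prodMap (B[[m]])) (by
    intro v
    obtain ⟨N₁, h₁⟩ := ncoeff_eventually_zero A v.1
    obtain ⟨N₂, h₂⟩ := ncoeff_eventually_zero B v.2
    exact ⟨N₁ + N₂, fun m hm => Prod.ext (h₁ m (by omega)) (h₂ m (by omega))⟩)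

theorem pairField_apply (A : VertexOperator ℂ V) (B : VertexOperator ℂ W) (m : ℤ) (v : V × W) :
    ((pairField A B)[[m]]) v = ((A[[m]]) v.1, (B[[m]]) v.2) := by
  rw [pairField, mkField_ncoeff]
  rfl

theorem fieldProd_pairField (A A' : VertexOperator ℂ V) (B B' : VertexOperator ℂ W) (n : ℤ) :
    fieldProd (pairField A B) n (pairField A' B') =
      pairField (fieldProd A n A') (fieldProd B n B') := by
  apply field_ext
  intro m v
  rw [pairField_apply]
  exact Prod.ext
    (map_fieldProd (LinearMap.fst ℂ V W) (fun m v => by simp [pairField_apply])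
      (fun m v => by simp [pairField_apply]) n m v)
    (map_fieldProd (LinearMap.snd ℂ V W) (fun m v => by simp [pairField_apply])
      (fun m v => by simp [pairField_apply]) n m v)

theorem IsLocal.pairField {A A' : VertexOperator ℂ V} {B B' : VertexOperator ℂ W}
    (h : IsLocal A A') (h' : IsLocal B B') :
    IsLocal (RectW.pairField A B) (RectW.pairField A' B') := by
  obtain ⟨N, h⟩ := h
  obtain ⟨N', h'⟩ := h'
  refine ⟨N + N', fun v => ?_⟩
  have e₁ := h.mono (Nat.le_add_right N N') v.1
  have e₂ := h'.mono (Nat.le_add_left N' N) v.2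
  have f₁ : ∀ K : ℤ → ℤ → V × W, ∀ p q, ((tau ^ (N + N')) K p q).1 =
      (tau ^ (N + N')) (fun p q => (K p q).1) p q := fun K p q =>
    congrFun (congrFun (tau_pow_map (LinearMap.fst ℂ V W) (N + N') K).symm p) q
  have f₂ : ∀ K : ℤ → ℤ → V × W, ∀ p q, ((tau ^ (N + N')) K p q).2 =
      (tau ^ (N + N')) (fun p q => (K p q).2) p q := fun K p q =>
    congrFun (congrFun (tau_pow_map (LinearMap.snd ℂ V W) (N + N') K).symm p) q
  funext p q
  refine Prod.ext ?_ ?_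
  · rw [f₁, f₁]
    simp only [prodFam, prodFamOp, pairField_apply]
    exact congrFun (congrFun e₁ p) q
  · rw [f₂, f₂]
    simp only [prodFam, prodFamOp, pairField_apply]
    exact congrFun (congrFun e₂ p) q

variable [VertexStructure V] [VertexStructure W]

/-- The direct product of vertex algebras. -/
instance : VertexStructure (V × W) where
  vac := (VertexStructure.vac, VertexStructure.vac)
  Y :=
    { toFun := fun a => pairField (VertexStructure.Y a.1) (VertexStructure.Y a.2)
      map_add' := fun a b => field_ext fun m v => by simp [pairField_apply]
      map_smul' := fun c a => field_ext fun m v => by simp [pairField_apply] }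

theorem nthProd_prod (a b : V × W) (m : ℤ) :
    nthProd a m b = (nthProd a.1 m b.1, nthProd a.2 m b.2) :=
  pairField_apply _ _ _ _

theorem translation_prod (a : V × W) : translation a = (translation a.1, translation a.2) :=
  nthProd_prod _ _ _

theorem vac_prod : (VertexStructure.vac : V × W) = (VertexStructure.vac, VertexStructure.vac) := rfl

theorem HasVacuumIdentity.prod (hV : HasVacuumIdentity V) (hW : HasVacuumIdentity W) :
    HasVacuumIdentity (V × W) := by
  change pairField (VertexStructure.Y VertexStructure.vac) (VertexStructure.Y VertexStructure.vac) = _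
  rw [hV, hW]
  apply field_ext
  intro m v
  rw [pairField_apply, idField_ncoeff, idField_ncoeff, idField_ncoeff]
  split_ifs <;> rfl

theorem IsRegular.prod {a : V} {b : W} (ha : IsRegular a) (hb : IsRegular b) : IsRegular (a, b) where
  assoc n c := by
    rw [nthProd_prod]
    change pairField (VertexStructure.Y (nthProd a n c.1)) (VertexStructure.Y (nthProd b n c.2)) = _
    rw [ha.assoc, hb.assoc]
    exact (fieldProd_pairField _ _ _ _ _).symm
  isLocal c := (ha.isLocal c.1).pairField (hb.isLocal c.2)

theorem IsCreative.prod {a : V} {b : W} (ha : IsCreative a) (hb : IsCreative b) :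
    IsCreative (a, b) where
  nonneg m hm := by
    rw [nthProd_prod]
    exact Prod.ext (ha.nonneg m hm) (hb.nonneg m hm)
  neg_one := by
    rw [nthProd_prod]
    exact Prod.ext ha.neg_one hb.neg_one

theorem RectOPE.prod {n : ℕ} {α : ℂ} {w₁ w₂ : Fin n → Fin n → V} {w₁' w₂' : Fin n → Fin n → W}
    (h : RectOPE α w₁ w₂) (h' : RectOPE α w₁' w₂') :
    RectOPE α (fun i j => (w₁ i j, w₁' i j)) (fun i j => (w₂ i j, w₂' i j)) where
  one_one p q i j := by
    obtain ⟨a₁, a₂, a₃⟩ := h.one_one p q i j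
    obtain ⟨b₁, b₂, b₃⟩ := h'.one_one p q i j
    simp only [nthProd_prod, vac_prod]
    exact ⟨Prod.ext a₁ b₁, Prod.ext a₂ b₂, fun s hs => Prod.ext (a₃ s hs) (b₃ s hs)⟩
  one_two p q i j := by
    obtain ⟨a₁, a₂, a₃, a₄⟩ := h.one_two p q i j
    obtain ⟨b₁, b₂, b₃, b₄⟩ := h'.one_two p q i j
    simp only [nthProd_prod, vac_prod]
    exact ⟨Prod.ext a₁ b₁, Prod.ext a₂ b₂, Prod.ext a₃ b₃,
      fun s hs => Prod.ext (a₄ s hs) (b₄ s hs)⟩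
  two_two p q i j := by
    obtain ⟨a₁, a₂, a₃, a₄, a₅⟩ := h.two_two p q i j
    obtain ⟨b₁, b₂, b₃, b₄, b₅⟩ := h'.two_two p q i j
    simp only [nthProd_prod, vac_prod, translation_prod]
    exact ⟨Prod.ext a₁ b₁, Prod.ext a₂ b₂, Prod.ext a₃ b₃, Prod.ext a₄ b₄,
      fun s hs => Prod.ext (a₅ s hs) (b₅ s hs)⟩

end Pairs

/-! ### Homomorphisms constructed as graphs in a direct product. -/

section Homomorphisms

variable {V W : Type*} [AddCommGroup V] [Module ℂ V] [AddCommGroup W] [Module ℂ W]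

theorem eq_zero_of_mem_span_of_linearIndependent {ι : Type*} (f : V →ₗ[ℂ] W) {v : ι → V}
    (h : LinearIndependent ℂ (f ∘ v)) {x : V} (hx : x ∈ Submodule.span ℂ (Set.range v))
    (hf : f x = 0) : x = 0 := by
  obtain ⟨c, rfl⟩ := Finsupp.mem_span_range_iff_exists_finsupp.1 hx
  have hc : c = 0 := by
    rw [linearIndependent_iff] at h
    apply h
    rw [← hf, Finsupp.linearCombination_apply, Finsupp.sum, Finsupp.sum, map_sum]
    simp
  rw [hc, Finsupp.sum_zero_index]

variable [VertexStructure V] [VertexStructure W] {I : Type*} {w : I → V} {w' : I → W} {deg : I → ℕ}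

/-- If the ordered words in two families of states which satisfy the same relations are linearly
independent, then the vertex subalgebras of the words are isomorphic. -/
theorem exists_vertexHom_of_isWordSystem (hV : HasVacuumIdentity V) (hW : HasVacuumIdentity W)
    (hw : IsWordSystem (modes fun i => (w i, w' i)) VertexStructure.vac deg)
    (hr : ∀ i, IsRegular (w i)) (hr' : ∀ i, IsRegular (w' i)) (hc : ∀ i, IsCreative (w i))
    (hc' : ∀ i, IsCreative (w' i))
    (hli : LinearIndependent ℂ fun s : Multiset (I × ℕ) =>
      word (modes w) VertexStructure.vac s.toList)
    (hli' : LinearIndependent ℂ fun s : Multiset (I × ℕ) =>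
      word (modes w') VertexStructure.vac s.toList)
    {S : VertexSubalgebra V} {S' : VertexSubalgebra W}
    (hS : S.toSubmodule = allWordSpan (modes w) VertexStructure.vac)
    (hS' : ∀ i, w' i ∈ S'.toSubmodule) :
    ∃ ι : VertexHom S.toSubmodule S'.toSubmodule, Function.Injective ι.toLinearMap ∧
      ∀ i (x : S.toSubmodule), (x : V) = w i → (ι.toLinearMap x : W) = w' i := by
  -- `T` is generated by the pairs (w i, w' i) and is going to be the graph of the homomorphism.
  let T := wordSubalgebra (hV.prod hW) (fun i => (w i, w' i)) deg hw
    fun i => (hr i).prod (hr' i)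
  have m₁ : ∀ l, LinearMap.fst ℂ V W (word (modes fun i => (w i, w' i)) VertexStructure.vac l) =
      word (modes w) VertexStructure.vac l :=
    map_word _ rfl fun i m v => congrArg Prod.fst (nthProd_prod _ _ _)
  have m₂ : ∀ l, LinearMap.snd ℂ V W (word (modes fun i => (w i, w' i)) VertexStructure.vac l) =
      word (modes w') VertexStructure.vac l :=
    map_word _ rfl fun i m v => congrArg Prod.snd (nthProd_prod _ _ _)
  have hS₂ : ∀ l, word (modes w') VertexStructure.vac l ∈ S'.toSubmodule := by
    intro l
    induction l with
    | nil => exact S'.vac_mem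
    | cons a l ih => exact S'.nthProd_mem _ (hS' _) ih
  have t₁ : ∀ x ∈ T.toSubmodule, LinearMap.fst ℂ V W x ∈ S.toSubmodule := by
    rw [hS]
    refine fun x hx => (Submodule.span_le (p := (allWordSpan _ _).comap (LinearMap.fst ℂ V W))).2 ?_ hx
    rintro _ ⟨l, rfl⟩
    exact Submodule.subset_span ⟨l, (m₁ l).symm⟩
  have t₂ : ∀ x ∈ T.toSubmodule, LinearMap.snd ℂ V W x ∈ S'.toSubmodule := by
    refine fun x hx => (Submodule.span_le (p := S'.toSubmodule.comap (LinearMap.snd ℂ V W))).2 ?_ hx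
    rintro _ ⟨l, rfl⟩
    change LinearMap.snd ℂ V W _ ∈ S'.toSubmodule
    rw [m₂]
    exact hS₂ l
  let p₁ : T.toSubmodule →ₗ[ℂ] S.toSubmodule := (LinearMap.fst ℂ V W).restrict t₁
  let p₂ : T.toSubmodule →ₗ[ℂ] S'.toSubmodule := (LinearMap.snd ℂ V W).restrict t₂
  -- The relations hold for the pairs themselves, so `T` is spanned by one word per multiset. The
  -- projection carries these words to a linearly independent family.
  have i₁ : Function.Injective p₁ := by
    rw [injective_iff_map_eq_zero]
    intro x hx
    have hx' : (x : V × W) ∈ allWordSpan (modes fun i => (w i, w' i)) VertexStructure.vac := x.2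
    rw [hw.allWordSpan_eq] at hx'
    exact Subtype.ext (eq_zero_of_mem_span_of_linearIndependent (LinearMap.fst ℂ V W)
      (by convert hli using 2 with s; exact m₁ _) hx' (congrArg Subtype.val hx))
  have i₂ : Function.Injective p₂ := by
    rw [injective_iff_map_eq_zero]
    intro x hx
    have hx' : (x : V × W) ∈ allWordSpan (modes fun i => (w i, w' i)) VertexStructure.vac := x.2
    rw [hw.allWordSpan_eq] at hx'
    exact Subtype.ext (eq_zero_of_mem_span_of_linearIndependent (LinearMap.snd ℂ V W)
      (by convert hli' using 2 with s; exact m₂ _) hx' (congrArg Subtype.val hx))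
  -- Each word in the `w i` is the first component of the corresponding word in the pairs.
  have s₁ : Function.Surjective p₁ := by
    rintro ⟨x, hx⟩
    rw [hS] at hx
    have : x ∈ T.toSubmodule.map (LinearMap.fst ℂ V W) := by
      refine (Submodule.span_le (p := T.toSubmodule.map (LinearMap.fst ℂ V W))).2 ?_ hx
      rintro _ ⟨l, rfl⟩
      exact ⟨_, Submodule.subset_span ⟨l, rfl⟩, m₁ l⟩
    obtain ⟨y, hy, rfl⟩ := this
    exact ⟨⟨y, hy⟩, rfl⟩
  have n₁ : ∀ a b m, p₁ (nthProd a m b) = nthProd (p₁ a) m (p₁ b) := by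
    intro a b m
    apply Subtype.ext
    rw [VertexSubalgebra.coe_nthProd]
    change (nthProd a m b : T.toSubmodule).1.1 = _
    rw [VertexSubalgebra.coe_nthProd, nthProd_prod]
    rfl
  have n₂ : ∀ a b m, p₂ (nthProd a m b) = nthProd (p₂ a) m (p₂ b) := by
    intro a b m
    apply Subtype.ext
    rw [VertexSubalgebra.coe_nthProd]
    change (nthProd a m b : T.toSubmodule).1.2 = _
    rw [VertexSubalgebra.coe_nthProd, nthProd_prod]
    rfl
  let e := LinearEquiv.ofBijective p₁ ⟨i₁, s₁⟩
  have he : ∀ x, e x = p₁ x := fun _ => rfl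
  refine ⟨⟨p₂.comp e.symm.toLinearMap, ?_, ?_⟩, i₂.comp e.symm.injective, ?_⟩
  · have : e.symm VertexStructure.vac = VertexStructure.vac := by
      rw [LinearEquiv.symm_apply_eq]
      rfl
    change p₂ (e.symm VertexStructure.vac) = _
    rw [this]
    rfl
  · intro a b m
    have : e.symm (nthProd a m b) = nthProd (e.symm a) m (e.symm b) := by
      rw [LinearEquiv.symm_apply_eq, he, n₁, ← he, ← he, e.apply_symm_apply, e.apply_symm_apply]
    change p₂ (e.symm _) = nthProd (p₂ (e.symm _)) m (p₂ (e.symm _))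
    rw [this, n₂]
  · intro i x hx
    have hm : (w i, w' i) ∈ T.toSubmodule := by
      refine Submodule.subset_span ⟨[(i, 0)], ?_⟩
      change nthProd (w i, w' i) _ VertexStructure.vac = _
      simpa using ((hc i).prod (hc' i)).neg_one
    have : e.symm x = ⟨(w i, w' i), hm⟩ := by
      rw [LinearEquiv.symm_apply_eq]
      exact Subtype.ext hx
    change (p₂ (e.symm x) : W) = _
    rw [this]
    rfl

end Homomorphisms

section

attribute [local instance] LieRing.ofAssociativeRing

theorem word_relabel {I J E : Type*} [AddCommGroup E] [Module ℂ E] (f : J → I)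
    (X : I → ℤ → Module.End ℂ E) (Ω : E) (l : List (J × ℕ)) :
    word (fun j => X (f j)) Ω l = word X Ω (l.map (Prod.map f id)) := by
  induction l with
  | nil => rfl
  | cons a l ih => rw [List.map_cons, word, word, ih]; rfl

/-! ### Strong generation and embedding of the rectangular W-algebras. -/

section Rectangular

variable {n : ℕ}

theorem isRegular_joinFam (α : ℂ) (x : Bool × Fin n × Fin n) :
    IsRegular (joinFam (W1 α) (W2 α) x) := by
  unfold joinFam
  split_ifs
  · exact isRegular_W2 α _ _
  · exact isRegular_W1 α _ _

theorem isCreative_joinFam (α : ℂ) (x : Bool × Fin n × Fin n) :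
    IsCreative (joinFam (W1 α) (W2 α) x) := by
  unfold joinFam
  split_ifs
  · exact isCreative_W2 α _ _
  · exact isCreative_W1 α _ _

theorem isWordSystem_joinFam (α : ℂ) :
    IsWordSystem (modes (joinFam (W1 (n := n) α) (W2 α))) VertexStructure.vac joinDeg :=
  (rectOPE α).isWordSystem (hasVacuumIdentity_affGL2 α) (isRegular_W1 α) (isRegular_W2 α)
    (isCreative_W1 α) (isCreative_W2 α)

theorem generators_eq_range (α : ℂ) : generators n α = Set.range (joinFam (W1 α) (W2 α)) := by
  ext w
  constructor
  · rintro ⟨i, j, rfl | rfl⟩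
    · exact ⟨(false, i, j), rfl⟩
    · exact ⟨(true, i, j), rfl⟩
  · rintro ⟨⟨_ | _, i, j⟩, rfl⟩
    · exact ⟨i, j, Or.inl rfl⟩
    · exact ⟨i, j, Or.inr rfl⟩

theorem stronglyGenerates_rectW (n : ℕ) (k : ℂ) :
    StronglyGenerates (generators n (k + n)) (rectW n k) := by
  rw [rectW, generators_eq_range]
  exact stronglyGenerates (hasVacuumIdentity_affGL2 _) (isWordSystem_joinFam _)
    (isRegular_joinFam _) (isCreative_joinFam _)

theorem rectW_toSubmodule (n : ℕ) (k : ℂ) : (rectW n k).toSubmodule =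
    allWordSpan (modes (joinFam (W1 (n := n) (k + n)) (W2 (k + n)))) VertexStructure.vac := by
  rw [rectW, generators_eq_range]
  exact generate_eq_allWordSpan (hasVacuumIdentity_affGL2 _) (isWordSystem_joinFam _)
    (isRegular_joinFam _) (isCreative_joinFam _)

theorem RectOPE.restrict {V : Type*} [AddCommGroup V] [Module ℂ V] [VertexStructure V] {α : ℂ}
    {S : VertexSubalgebra V} {w₁ w₂ : Fin n → Fin n → S.toSubmodule}
    (h : RectOPE α (fun i j => (w₁ i j : V)) (fun i j => (w₂ i j : V))) : RectOPE α w₁ w₂ where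
  one_one p q i j := by
    obtain ⟨a₁, a₂, a₃⟩ := h.one_one p q i j
    refine ⟨Subtype.ext ?_, Subtype.ext ?_, fun s hs => Subtype.ext ?_⟩ <;>
      rw [VertexSubalgebra.coe_nthProd]
    exacts [a₁, a₂, a₃ s hs]
  one_two p q i j := by
    obtain ⟨a₁, a₂, a₃, a₄⟩ := h.one_two p q i j
    refine ⟨Subtype.ext ?_, Subtype.ext ?_, Subtype.ext ?_, fun s hs => Subtype.ext ?_⟩ <;>
      rw [VertexSubalgebra.coe_nthProd]
    exacts [a₁, a₂, a₃, a₄ s hs]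
  two_two p q i j := by
    have t : ∀ a : S.toSubmodule, ((translation a : S.toSubmodule) : V) = translation (a : V) :=
      fun a => VertexSubalgebra.coe_nthProd _ _ _ _
    obtain ⟨a₁, a₂, a₃, a₄, a₅⟩ := h.two_two p q i j
    refine ⟨Subtype.ext ?_, Subtype.ext ?_, Subtype.ext ?_, Subtype.ext ?_,
      fun s hs => Subtype.ext ?_⟩ <;> rw [VertexSubalgebra.coe_nthProd]
    · rw [a₁]
      simp only [Submodule.coe_sub, Submodule.coe_add, Submodule.coe_smul,
        VertexSubalgebra.coe_nthProd, t]
    · rw [a₂]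
      simp only [Submodule.coe_sub, Submodule.coe_add, Submodule.coe_smul,
        VertexSubalgebra.coe_nthProd, t]
    exacts [a₃, a₄, a₅ s hs]

theorem rectOPE_genW (k : ℂ) : RectOPE (k + n) (genW1 (n := n) k) (genW2 k) :=
  (rectOPE (k + n)).restrict

theorem injective_castSucc_label : Function.Injective
    (Prod.map id (Prod.map Fin.castSucc Fin.castSucc) :
      Bool × Fin n × Fin n → Bool × Fin (n + 1) × Fin (n + 1)) :=
  Function.injective_id.prodMap ((Fin.castSucc_injective n).prodMap (Fin.castSucc_injective n))

/-- The inclusion of labels is injective, so distinct multisets of small labels remain distinct in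
the large algebra, where `linearIndependent_words` applies. -/
theorem linearIndependent_words_castSucc (α : ℂ) : LinearIndependent ℂ
    fun s : Multiset ((Bool × Fin n × Fin n) × ℕ) =>
      word (modes (joinFam (fun i j : Fin n => W1 α i.castSucc j.castSucc)
        fun i j => W2 α i.castSucc j.castSucc)) VertexStructure.vac s.toList := by
  have h := linearIndependent_words (n := n + 1) α
    (fun s : Multiset ((Bool × Fin n × Fin n) × ℕ) =>
      s.toList.map (Prod.map (Prod.map id (Prod.map Fin.castSucc Fin.castSucc)) id)) (by
    intro s t hst
    simp only [← Multiset.map_coe, Multiset.coe_toList] at hst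
    exact Multiset.map_injective (injective_castSucc_label.prodMap Function.injective_id) hst)
  simp only [← word_relabel] at h
  exact h

/-- The embedding of rectangular `W`-algebras. -/
theorem exists_embedding (n : ℕ) (k : ℂ) :
    ∃ ι : VertexHom (RectWAlg n (k + 1)) (RectWAlg (n + 1) k), Function.Injective ι.toLinearMap ∧
      ∀ i j : Fin n,
        ι.toLinearMap (genW1 (k + 1) i j) = genW1 k i.castSucc j.castSucc ∧
        ι.toLinearMap (genW2 (k + 1) i j) = genW2 k i.castSucc j.castSucc := by
  -- The level is a free variable here, since (k + 1) + n and k + (n + 1) are equal only up to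
  -- rearrangement while the ambient type of the large algebra keeps its own form. With the level
  -- written as k + 1 + n, both product lists carry the same coefficients.
  have h' : ∀ α : ℂ, α = k + (n + 1 : ℕ) →
      RectOPE α (fun i j : Fin n => W1 (k + (n + 1 : ℕ)) i.castSucc j.castSucc)
        (fun i j => W2 (k + (n + 1 : ℕ)) i.castSucc j.castSucc) := by
    rintro _ rfl
    exact (rectOPE _).castSucc
  have hw := ((rectOPE (n := n) (k + 1 + n)).prod (h' _ (by push_cast; ring))).isWordSystem
    ((hasVacuumIdentity_affGL2 _).prod (hasVacuumIdentity_affGL2 _))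
    (fun i j => (isRegular_W1 _ i j).prod (isRegular_W1 _ _ _))
    (fun i j => (isRegular_W2 _ i j).prod (isRegular_W2 _ _ _))
    (fun i j => (isCreative_W1 _ i j).prod (isCreative_W1 _ _ _))
    (fun i j => (isCreative_W2 _ i j).prod (isCreative_W2 _ _ _))
  have hj : joinFam (fun i j : Fin n => (W1 (k + 1 + n) i j, W1 (k + (n + 1 : ℕ)) i.castSucc j.castSucc))
      (fun i j => (W2 (k + 1 + n) i j, W2 (k + (n + 1 : ℕ)) i.castSucc j.castSucc)) =
      fun x => (joinFam (W1 (k + 1 + n)) (W2 (k + 1 + n)) x,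
        joinFam (fun i j : Fin n => W1 (k + (n + 1 : ℕ)) i.castSucc j.castSucc)
          (fun i j => W2 (k + (n + 1 : ℕ)) i.castSucc j.castSucc) x) := by
    funext ⟨b, i, j⟩
    cases b <;> rfl
  rw [hj] at hw
  obtain ⟨ι, hι, h⟩ := exists_vertexHom_of_isWordSystem (S := rectW n (k + 1))
    (S' := rectW (n + 1) k) (hasVacuumIdentity_affGL2 _) (hasVacuumIdentity_affGL2 _) hw
    (isRegular_joinFam _)
    (fun x => isRegular_joinFam (k + (n + 1 : ℕ)) (Prod.map id (Prod.map Fin.castSucc Fin.castSucc) x))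
    (isCreative_joinFam _)
    (fun x => isCreative_joinFam (k + (n + 1 : ℕ)) (Prod.map id (Prod.map Fin.castSucc Fin.castSucc) x))
    (linearIndependent_words _ _ (by
      simp only [Multiset.coe_toList]
      exact Function.injective_id))
    (linearIndependent_words_castSucc _) (rectW_toSubmodule n (k + 1)) (by
      rintro ⟨_ | _, i, j⟩
      · exact (genW1 k i.castSucc j.castSucc).2
      · exact (genW2 k i.castSucc j.castSucc).2)
  exact ⟨ι, hι, fun i j => ⟨Subtype.ext (h (false, i, j) _ rfl), Subtype.ext (h (true, i, j) _ rfl)⟩⟩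

end Rectangular

end

end RectW

end

theorem theorem4p2 (n : ℕ) (k α : ℂ) (hα : α = k + n) :
    -- the `W^{(1)}_{ij}`, `W^{(2)}_{ij}` are strong generators
    StronglyGenerates (generators n (k + n)) (rectW n k) ∧
    -- products of `W^{(1)}` with `W^{(1)}`
    (∀ p q i j : Fin n,
      nthProd (genW1 k p q) 0 (genW1 k i j) =
        delta q i • genW1 k p j - delta p j • genW1 k i q ∧
      nthProd (genW1 k p q) 1 (genW1 k i j) =
        (2 * delta q i * delta p j * α + 2 * delta p q * delta i j) •
          (VertexStructure.vac : RectWAlg n k) ∧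
      ∀ s : ℤ, 1 < s → nthProd (genW1 k p q) s (genW1 k i j) = 0) ∧
    -- products of `W^{(1)}` with `W^{(2)}`
    (∀ p q i j : Fin n,
      nthProd (genW1 k p q) 0 (genW2 k i j) =
        -(delta p j • genW2 k i q) + delta i q • genW2 k p j ∧
      nthProd (genW1 k p q) 1 (genW2 k i j) =
        (delta p j * α) • genW1 k i q + delta p q • genW1 k i j ∧
      nthProd (genW1 k p q) 2 (genW2 k i j) =
        (-(2 * delta q i * delta p j * α ^ 2) - 2 * delta p q * delta i j * α) •
          (VertexStructure.vac : RectWAlg n k) ∧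
      ∀ s : ℤ, 2 < s → nthProd (genW1 k p q) s (genW2 k i j) = 0) ∧
    -- products of `W^{(2)}` with `W^{(2)}`
    (∀ p q i j : Fin n,
      nthProd (genW2 k p q) 0 (genW2 k i j) =
        nthProd (genW2 k p j) (-1) (genW1 k i q) - nthProd (genW1 k p j) (-1) (genW2 k i q)
        + α • nthProd (translation (genW1 k p j)) (-1) (genW1 k i q)
        + nthProd (translation (genW1 k p q)) (-1) (genW1 k i j)
        - (delta q i * α) • translation (genW2 k p j)
        - (delta i q * ((2 * α ^ 2 + 1) / 2)) • translation (translation (genW1 k p j))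
        - delta i j • translation (genW2 k p q)
        - (3 / 2 * delta i j * α) • translation (translation (genW1 k p q)) ∧
      nthProd (genW2 k p q) 1 (genW2 k i j) =
        α • nthProd (genW1 k p j) (-1) (genW1 k i q)
        + nthProd (genW1 k p q) (-1) (genW1 k i j)
        - (delta q i * α) • genW2 k p j
        - (2 * delta q i * α ^ 2) • translation (genW1 k p j)
        - (delta p j * α) • genW2 k i q
        - delta i j • genW2 k p q
        - (2 * delta i j * α) • translation (genW1 k p q)
        - delta p q • genW2 k i j ∧
      nthProd (genW2 k p q) 2 (genW2 k i j) =
        (delta p j * (2 * α ^ 2 - 1)) • genW1 k i q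
        - (delta i j * α) • genW1 k p q
        - (delta i q * (2 * α ^ 2 - 1)) • genW1 k p j
        + (delta p q * α) • genW1 k i j ∧
      nthProd (genW2 k p q) 3 (genW2 k i j) =
        ((1 - 5 * α ^ 2) * delta p q * delta i j
          + (2 * α - 6 * α ^ 3) * delta p j * delta i q) •
          (VertexStructure.vac : RectWAlg n k) ∧
      ∀ s : ℤ, 3 < s → nthProd (genW2 k p q) s (genW2 k i j) = 0) ∧
    -- the embedding
    ∃ ι : VertexHom (RectWAlg n (k + 1)) (RectWAlg (n + 1) k),
      Function.Injective ι.toLinearMap ∧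
      ∀ i j : Fin n,
        ι.toLinearMap (genW1 (k + 1) i j) = genW1 k i.castSucc j.castSucc ∧
        ι.toLinearMap (genW2 (k + 1) i j) = genW2 k i.castSucc j.castSucc := by
  subst hα
  exact ⟨stronglyGenerates_rectW n k, (rectOPE_genW k).one_one, (rectOPE_genW k).one_two,
    (rectOPE_genW k).two_two, exists_embedding n k⟩
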